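/- Let $\epsilon_0,\mu_0,\epsilon_r>0$, $c=(\epsilon_0\mu_0)^{-1/2}$, let $E=\mathbf P(D)$ be the inverse of $E\mapsto D=\epsilon_0(1+\epsilon_r|E|^2)E$ on $\mathbb R^3$, and let $p$ be the inverse of $e\mapsto\epsilon_0(e+\epsilon_re^3)$ on $\mathbb R$. Let $\omega\in\mathbb R^3$, $|\omega|=1$, and let $u_\pm=(D_\pm,H_\pm)\in\mathbb R^6$ be arbitrary. Consider the Riemann problem for the full $6\times6$ Kerr system in the direction $\omega$, $$\partial_tD-\partial_y(\omega\times H)=0,\qquad \partial_tH+\mu_0^{-1}\partial_y(\omega\times\mathbf P(D))=0,\qquad u(0,y)=u_-\ (y<0),\quad u(0,y)=u_+\ (y>0).$$ The eigenvalues of the system are $\lambda_1\le\lambda_2<\lambda_3=\lambda_4=0<\lambda_5\le\lambda_6$, with $\lambda_6=-\lambda_1=c(1+\epsilon_r|E|^2)^{-1/2}$ and $\lambda_5=-\lambda_2=\lambda$, where $$\lambda^2=c^2\,\frac{1+\epsilon_r(|E|^2+2(E\cdot\omega)^2)}{(1+\epsilon_r|E|^2)(1+3\epsilon_r|E|^2)}.$$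 A $k$-contact discontinuity ($k=1,3,6$; it is stationary if $k=3$) is a jump from $u_l$ to $u_r$ with velocity $\sigma=\lambda_k(u_l)=\lambda_k(u_r)$ that satisfies the Rankine–Hugoniot conditions $\sigma[D]=-\omega\times[H]$, $\sigma\mu_0[H]=\omega\times[E]$. A Lax $k$-shock ($k=2,5$) is a jump $u_l\neq u_r$ that satisfies the Rankine–Hugoniot conditions and $\lambda_k(u_r)\le\sigma\le\lambda_{k+1}(u_r)$, $\lambda_{k-1}(u_l)\le\sigma\le\lambda_k(u_l)$. A $k$-wave is a Lax $k$-shock or a centred $k$-rarefaction wave. A superposition of simple waves is a self-similar function $u(t,y)=v(y/t)$, with $u_-$ on the far left and $u_+$ on the far right, made of: a 1-contact discontinuity from $u_-$ to $u_1$, a 2-wave from $u_1$ to $u_*$, a stationary contact discontinuity from $u_*$ to $u_{**}$, a 5-wave from $u_{**}$ to $u_2$, and a 6-contact discontinuity from $u_2$ to $u_+$; each of these waves may be trivial (equal left and right states). **Theorem.** There is a superposition of simple waves $v(y/t)$ that is a weak solution of the Riemann problem, and the superposition of simple waves is unique: any two such profiles $v$ coincide except at finitely many points. Put $$\sigma_-=\lambda_1(u_-),\quad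 \sigma_+=\lambda_6(u_+),\quad d_0^\pm=D_\pm\cdot\omega,\quad V=\omega\times\big(H_+-H_--\omega\times(\sigma_+D_+-\sigma_-D_-)\big).$$ 1. If $V=0$, then necessarily $u_*=(d_0^-\omega,\ H_--\sigma_-\,\omega\times D_-)$ and $u_{**}=(d_0^+\omega,\ H_+-\sigma_+\,\omega\times D_+)$, and $v=u_-$ on $(-\infty,\sigma_-)$, $v=u_*$ on $(\sigma_-,0)$, $v=u_{**}$ on $(0,\sigma_+)$, $v=u_+$ on $(\sigma_+,\infty)$. The jump from $u_-$ to $u_*$ is a Lax 2-shock with velocity $\sigma_-$ if $\omega\times D_-\ne0$, and is trivial otherwise; the jump from $u_*$ to $u_{**}$ is a stationary contact discontinuity; the jump from $u_{**}$ to $u_+$ is a Lax 5-shock with velocity $\sigma_+$ if $\omega\times D_+\neq0$, and is trivial otherwise. 2. If $V\ne0$, let $\zeta=V/|V|$, and $$d_1=|\omega\times(\omega\times D_-)|,\qquad h_1=H_-\cdot(\omega\times\zeta)+\sigma_-(d_1-D_-\cdot\zeta),$$ $$d_2=|\omega\times(\omega\times D_+)|,\qquad h_2=H_+\cdot(\omega\times\zeta)+\sigma_+(d_2-D_+\cdot\zeta).$$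 Let $f(d,d_0)=c^2d\,\big/\big(1+\epsilon_rp^2(\sqrt{d_0^2+d^2})\big)$, and let $$\phi(a,b,d_0)=\begin{cases}\sqrt{(f(a,d_0)-f(b,d_0))(a-b)}&\text{if } b\le a,\\[1mm] -\displaystyle\int_a^b\lambda(s,d_0)\,ds&\text{if } a\le b,\end{cases}$$ where $\lambda(s,d_0)$ is the value of $\lambda$ at the states with $D\cdot\omega=d_0$ and $|\omega\times(\omega\times D)|=s$. Then the system $$f(d_*,d_0^-)=f(d_{**},d_0^+),\qquad h_1+\phi(d_1,d_*,d_0^-)=h_2-\phi(d_2,d_{**},d_0^+)$$ has a unique solution $(d_*,d_{**})\in[0,\infty)^2$. Both $d_*$ and $d_{**}$ are positive. With $G=f(\cdot,d_0^+)^{-1}\circ f(\cdot,d_0^-)$, $d_*$ is the unique solution in $[0,\infty)$ of the scalar equation $$h_2-h_1=\phi(d_1,d_*,d_0^-)+\phi(d_2,G(d_*),d_0^+),$$ and $d_{**}=G(d_*)$. The solution is the superposition of a 1-contact discontinuity, a 2-wave, a stationary contact discontinuity, a 5-wave and a 6-contact discontinuity (each possibly trivial), whose intermediate states $u_i=(D_i,H_i)$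 are necessarily $$D_1=d_0^-\omega+d_1\zeta,\quad H_1=H_-+\sigma_-\,\omega\times(D_1-D_-),\qquad D_2=d_0^+\omega+d_2\zeta,\quad H_2=H_+-\sigma_+\,\omega\times(D_+-D_2),$$ $$D_*=d_0^-\omega+d_*\zeta,\quad H_*=H_1+\phi(d_1,d_*,d_0^-)\,\omega\times\zeta,\qquad D_{**}=d_0^+\omega+d_{**}\zeta,\quad H_{**}=H_2-\phi(d_2,d_{**},d_0^+)\,\omega\times\zeta.$$ -/

import Mathlib

open MeasureTheory Set

noncomputable section

namespace Kerr

/-- Euclidean three-space. -/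
abbrev E3 := EuclideanSpace ℝ (Fin 3)

/-- States `u = (D, H)` of the full six-dimensional system. -/
abbrev State := E3 × E3

/-- The cross product of Euclidean three-space. -/
def cross (a b : E3) : E3 := WithLp.toLp 2 (crossProduct a.ofLp b.ofLp)

/-- The physical constants of a Kerr medium: free space permittivity and permeability, and
relative permittivity. -/
structure Medium where
  eps0 : ℝ
  mu0 : ℝ
  epsr : ℝ
  eps0_pos : 0 < eps0
  mu0_pos : 0 < mu0
  epsr_pos : 0 < epsr

variable (m : Medium)

/-- The light velocity `c = 1 / √(ε₀ μ₀)`. -/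
def lightSpeed : ℝ := (Real.sqrt (m.eps0 * m.mu0))⁻¹

/-- The displacement as a function of the electric field, `D(E) = ε₀ (1 + ε_r |E|²) E`. -/
def displacement (E : E3) : E3 := (m.eps0 * (1 + m.epsr * ‖E‖ ^ 2)) • E

/-- The electric field `E = P(D)`: the reciprocal function of `E ↦ D(E)`, which is a bijection
of three-space. -/
def elecField : E3 → E3 := Function.invFun (displacement m)

/-- `q(e) = ε₀ (e + ε_r e³)`. -/
def q (e : ℝ) : ℝ := m.eps0 * (e + m.epsr * e ^ 3)

/-- `p = q⁻¹`, the reciprocal function of the bijection `q` of the real line. -/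
def p : ℝ → ℝ := Function.invFun (q m)

/-- The flux in the direction `ω`: the system is `∂_t u + ∂_y (flux u) = 0`, that is,
`∂_t D - ∂_y (ω × H) = 0` and `∂_t H + μ₀⁻¹ ∂_y (ω × P(D)) = 0`. -/
def flux (ω : E3) (u : State) : State :=
  (-cross ω u.2, m.mu0⁻¹ • cross ω (elecField m u.1))

/-- `|λ₁| = λ₆ = c / √(1 + ε_r |E|²)`. -/
def fastSpeed (u : State) : ℝ :=
  lightSpeed m / Real.sqrt (1 + m.epsr * ‖elecField m u.1‖ ^ 2)

/-- `|λ₂| = λ₅ = λ`, with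
`λ² = c² (1 + ε_r (|E|² + 2 (E·ω)²)) / ((1 + ε_r |E|²) (1 + 3 ε_r |E|²))`. -/
def slowSpeed (ω : E3) (u : State) : ℝ :=
  Real.sqrt (lightSpeed m ^ 2 *
    (1 + m.epsr * (‖elecField m u.1‖ ^ 2 + 2 * (inner ℝ (elecField m u.1) ω) ^ 2)) /
    ((1 + m.epsr * ‖elecField m u.1‖ ^ 2) * (1 + 3 * m.epsr * ‖elecField m u.1‖ ^ 2)))

/-- The eigenvalues `λ₁ ≤ λ₂ < λ₃ = λ₄ = 0 < λ₅ ≤ λ₆` of the system in the direction `ω`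
(indices other than `1, …, 6` are not used). -/
def eigenvalue (ω : E3) (k : ℕ) (u : State) : ℝ :=
  match k with
  | 1 => -fastSpeed m u
  | 2 => -slowSpeed m ω u
  | 3 => 0
  | 4 => 0
  | 5 => slowSpeed m ω u
  | 6 => fastSpeed m u
  | _ => 0

/-- The Rankine-Hugoniot conditions `σ [u] = [flux u]`, that is, `σ [D] = -ω × [H]` and
`σ μ₀ [H] = ω × [E]`. -/
def RankineHugoniot (ω : E3) (σ : ℝ) (ul ur : State) : Prop :=
  σ • (ur - ul) = flux m ω ur - flux m ω ul

/-- Contact discontinuity of the `k`-th field, `k ∈ {1, 3, 4, 6}`, with velocity `σ`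
(trivial if `ul = ur`). -/
def IsContact (ω : E3) (k : ℕ) (σ : ℝ) (ul ur : State) : Prop :=
  σ = eigenvalue m ω k ul ∧ σ = eigenvalue m ω k ur ∧ RankineHugoniot m ω σ ul ur

/-- Lax `k`-shocks, `k ∈ {2, 5}`. -/
def IsLaxShock (ω : E3) (k : ℕ) (σ : ℝ) (ul ur : State) : Prop :=
  ul ≠ ur ∧ RankineHugoniot m ω σ ul ur ∧
    eigenvalue m ω k ur ≤ σ ∧ σ ≤ eigenvalue m ω (k + 1) ur ∧
    eigenvalue m ω (k - 1) ul ≤ σ ∧ σ ≤ eigenvalue m ω k ul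

/-- The profile `v` is on `[a, b]` a centred `k`-rarefaction wave from `ul` to `ur`: it is
continuous, at interior points it is differentiable with `-ξ v' + (flux v)' = 0` (so `v'` is an
eigenvector, and `v (y / t)` is a classical solution), and the `k`-th eigenvalue at `v ξ` is `ξ`. -/
def IsRarefaction (ω : E3) (k : ℕ) (a b : ℝ) (ul ur : State) (v : ℝ → State) : Prop :=
  a < b ∧ ContinuousOn v (Icc a b) ∧ v a = ul ∧ v b = ur ∧
    ∀ ξ ∈ Ioo a b, eigenvalue m ω k (v ξ) = ξ ∧
      ∃ v' : State, HasDerivAt v v' ξ ∧ HasDerivAt (fun η => flux m ω (v η)) (ξ • v') ξ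

/-- The profile `v` has on `[a, b]` a `k`-wave from `ul` to `ur`, `k ∈ {2, 5}`: no wave at all,
a Lax `k`-shock (then `a = b` is its velocity), or a `k`-rarefaction wave. -/
def IsWave (ω : E3) (k : ℕ) (a b : ℝ) (ul ur : State) (v : ℝ → State) : Prop :=
  (ul = ur ∧ a = eigenvalue m ω k ul ∧ b = eigenvalue m ω k ul) ∨
  (a = b ∧ IsLaxShock m ω k a ul ur) ∨
  IsRarefaction m ω k a b ul ur v

/-- The profile `v`, a function of `ξ = y / t`, is the superposition of a `1`-contact
discontinuity from `uL` to `u1`, a `2`-wave from `u1` to `us`, a stationary contact discontinuity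
from `us` to `uss`, a `5`-wave from `uss` to `u2` and a `6`-contact discontinuity from `u2` to
`uR`. The values at the velocities of the discontinuities are left free. -/
def IsWaveFan (ω : E3) (uL uR u1 us uss u2 : State) (v : ℝ → State) : Prop :=
  ∃ s1 a2 b2 a5 b5 s6 : ℝ,
    IsContact m ω 1 s1 uL u1 ∧
    IsWave m ω 2 a2 b2 u1 us v ∧
    IsContact m ω 3 0 us uss ∧
    IsWave m ω 5 a5 b5 uss u2 v ∧
    IsContact m ω 6 s6 u2 uR ∧
    (∀ ξ ∈ Iio s1, v ξ = uL) ∧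
    (∀ ξ ∈ Ioo s1 a2, v ξ = u1) ∧
    (∀ ξ ∈ Ioo b2 0, v ξ = us) ∧
    (∀ ξ ∈ Ioo 0 a5, v ξ = uss) ∧
    (∀ ξ ∈ Ioo b5 s6, v ξ = u2) ∧
    (∀ ξ ∈ Ioi s6, v ξ = uR)

/-- The class of superpositions of simple waves with end states `uL`, `uR`. -/
def IsSuperposition (ω : E3) (uL uR : State) (v : ℝ → State) : Prop :=
  ∃ u1 us uss u2 : State, IsWaveFan m ω uL uR u1 us uss u2 v

/-- The bounded function `u(t, y) = v (y / t)`, `t > 0`, is a weak (distributional) solution of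
the Riemann problem `∂_t u + ∂_y (flux u) = 0`, `u(0, y) = uL` for `y < 0` and `uR` for `y > 0`.
Points of the plane are pairs `(t, y)`. -/
def IsWeakRiemannSolution (ω : E3) (uL uR : State) (v : ℝ → State) : Prop :=
  MemLp (fun z : ℝ × ℝ => v (z.2 / z.1)) ⊤ (volume.restrict (Ioi (0 : ℝ) ×ˢ univ)) ∧
  ∀ φ : ℝ × ℝ → ℝ, ContDiff ℝ (⊤ : ℕ∞) φ → HasCompactSupport φ →
    (∫ z in Ioi (0 : ℝ) ×ˢ (univ : Set ℝ),
      ((fderiv ℝ φ z (1, 0)) • v (z.2 / z.1) +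
        (fderiv ℝ φ z (0, 1)) • flux m ω (v (z.2 / z.1)))) +
    (∫ y : ℝ, φ (0, y) • (if y < 0 then uL else uR)) = 0

/-- `f(d, d₀) = c² d / (1 + ε_r p²(√(d₀² + d²)))`. -/
def f (d d0 : ℝ) : ℝ :=
  lightSpeed m ^ 2 * d / (1 + m.epsr * p m (Real.sqrt (d0 ^ 2 + d ^ 2)) ^ 2)

/-- `S(d₁, d₂, d₀) = √((f(d₁, d₀) - f(d₂, d₀)) (d₁ - d₂))`. -/
def S (d1 d2 d0 : ℝ) : ℝ := Real.sqrt ((f m d1 d0 - f m d2 d0) * (d1 - d2))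

/-- The eigenvalue `λ` as a function of `d = |ω × (ω × D)|` and `d₀ = D · ω`. -/
def lam (d d0 : ℝ) : ℝ :=
  let e := p m (Real.sqrt (d0 ^ 2 + d ^ 2))
  Real.sqrt (lightSpeed m ^ 2 *
    (1 + m.epsr * (e ^ 2 + 2 * (d0 / (m.eps0 * (1 + m.epsr * e ^ 2))) ^ 2)) /
    ((1 + m.epsr * e ^ 2) * (1 + 3 * m.epsr * e ^ 2)))

/-- `R(d₁, d₂, d₀) = ∫_{d₁}^{d₂} λ(s, d₀) ds`. -/
def R (d1 d2 d0 : ℝ) : ℝ := ∫ s in d1..d2, lam m s d0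

open Classical in
/-- The wave function `φ`: equal to `S` (shock) if `d₂ ≤ d₁` and to `-R` (rarefaction) if
`d₁ ≤ d₂`. -/
def waveFn (d1 d2 d0 : ℝ) : ℝ := if d2 ≤ d1 then S m d1 d2 d0 else -R m d1 d2 d0

/-- `G = f(·, d₀⁺)⁻¹ ∘ f(·, d₀⁻)`; here `f(·, d₀⁺)` is a bijection of the real line. -/
def G (d0m d0p d : ℝ) : ℝ := Function.invFun (fun x => f m x d0p) (f m d d0m)

/-- `V = ω × (H₊ - H₋ - ω × (σ₊ D₊ - σ₋ D₋))`, where `σ₋ = λ₁(u₋)` and `σ₊ = λ₆(u₊)`. -/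
def vecV (ω : E3) (uL uR : State) : E3 :=
  cross ω (uR.2 - uL.2 -
    cross ω (eigenvalue m ω 6 uR • uR.1 - eigenvalue m ω 1 uL • uL.1))

end Kerr

end

namespace Kerr

open Filter Topology

variable (m : Medium)

/-! ### Scalar functions of the constitutive law -/

/-! Split a displacement as `d₀ ω + d ζ` with `ζ` a unit vector orthogonal to `ω` and `d ≥ 0`. Since
`E` is parallel to `D` with a factor depending on `|D|` only, the flux sees `D` through `f(d, d₀) ω
× ζ` alone (`flux_eq`). Fields 1 and 6 then rotate `ζ` with `d` and `d₀` fixed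
(`isContact_one_iff`), while fields 2 and 5 keep `ζ` and change `d`. On `[0, ∞)` the function `f(·,
d₀)` is increasing and strictly concave, with slope `λ²`. So the Lax inequalities select shocks
where `d` decreases, rarefaction waves have `d` increasing, and in both cases the 2-wave adds `φ ω ×
ζ` to `H` (`isSlowWave_of_isWave`). The fields 5 and 6 follow from the reflection `(D, H) ↦ (D,
-H)`, `y ↦ -y`.

A fan is thus encoded by two directions `ζ₁, ζ₂` and two moduli `y₁, y₂`. The stationary contact
asks for equal fluxes, which by `flux_eq_iff` means that `f(y₁) ω × ζ₁ = f(y₂) ω × ζ₂` and that `V`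
is the sum of the `(φ(dᵢ, 0) - φ(dᵢ, yᵢ)) ζᵢ`. As `φ` is strictly decreasing in its second argument,
these coefficients are positive when `yᵢ > 0`. Hence either `y₁ = y₂ = 0` and `V = 0`, or the two
directions agree, equal `V / |V|`, and `y₁` solves a scalar equation whose right-hand side is
strictly decreasing (`IsFanForm.dichotomy`, `scalar_strictAntiOn`). If `V = 0` the directions are
not determined, but a wave down to `d = 0` moves exactly as fast as the contact discontinuity
(`rightSpeed_zero`), so the undetermined states occupy no interval.

For existence, the right-hand side tends to `-∞`, so the scalar equation has a root
(`exists_scalar_solution`). The waves are built explicitly and glued along the condition that `flux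
v - ξ v` be continuous, which is Rankine-Hugoniot at a jump. Multiplied by `t`, this function is a
potential for the conservation law, so integration by parts gives the weak formulation
(`IsProfile.isWeakRiemannSolution`). -/

theorem lightSpeed_pos : 0 < lightSpeed m :=
  inv_pos.2 (Real.sqrt_pos.2 (mul_pos m.eps0_pos m.mu0_pos))

theorem lightSpeed_sq : lightSpeed m ^ 2 = (m.eps0 * m.mu0)⁻¹ := by
  rw [lightSpeed, inv_pow, Real.sq_sqrt (mul_pos m.eps0_pos m.mu0_pos).le]

theorem one_add_epsr_mul_sq_pos (e : ℝ) : 0 < 1 + m.epsr * e ^ 2 := by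
  have := m.epsr_pos
  positivity

theorem one_add_three_epsr_mul_sq_pos (e : ℝ) : 0 < 1 + 3 * m.epsr * e ^ 2 := by
  have := m.epsr_pos
  positivity

theorem q_neg (e : ℝ) : q m (-e) = -q m e := by
  simp only [q]; ring

theorem q_strictMono : StrictMono (q m) := by
  have h1 := m.eps0_pos
  have h2 := m.epsr_pos
  intro a b hab
  have h3 : a ^ 3 < b ^ 3 := (Odd.strictMono_pow (by decide)) hab
  simp only [q]
  have : m.epsr * a ^ 3 < m.epsr * b ^ 3 := by gcongr
  gcongr

theorem continuous_q : Continuous (q m) := by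
  unfold q
  fun_prop

theorem tendsto_q_atTop : Tendsto (q m) atTop atTop := by
  have h1 := m.eps0_pos
  have h2 := m.epsr_pos
  refine tendsto_atTop_mono' _ ?_ (tendsto_id.const_mul_atTop h1)
  filter_upwards [eventually_ge_atTop (0 : ℝ)] with e he
  simp only [q, id]
  have : 0 ≤ m.epsr * e ^ 3 := by positivity
  gcongr
  linarith

theorem q_surjective : Function.Surjective (q m) := by
  refine (continuous_q m).surjective (tendsto_q_atTop m) ?_
  have h := tendsto_neg_atTop_atBot.comp ((tendsto_q_atTop m).comp tendsto_neg_atBot_atTop)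
  refine h.congr fun e => ?_
  simp [q_neg]

theorem p_q (e : ℝ) : p m (q m e) = e :=
  Function.leftInverse_invFun (q_strictMono m).injective e

theorem q_p (r : ℝ) : q m (p m r) = r :=
  Function.rightInverse_invFun (q_surjective m) r

theorem p_strictMono : StrictMono (p m) := by
  intro a b hab
  rw [← (q_strictMono m).lt_iff_lt, q_p, q_p]
  exact hab

theorem p_surjective : Function.Surjective (p m) := fun e => ⟨q m e, p_q m e⟩

theorem continuous_p : Continuous (p m) :=
  (p_strictMono m).monotone.continuous_of_surjective (p_surjective m)

theorem p_zero : p m 0 = 0 := by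
  have h : q m 0 = 0 := by simp [q]
  conv_lhs => rw [← h]
  exact p_q m 0

theorem p_nonneg {r : ℝ} (hr : 0 ≤ r) : 0 ≤ p m r := by
  rw [← p_zero m]
  exact (p_strictMono m).monotone hr

theorem tendsto_p_atTop : Tendsto (p m) atTop atTop :=
  tendsto_atTop_atTop_of_monotone (p_strictMono m).monotone
    fun b => ⟨q m b, (p_q m b).ge⟩

theorem hasDerivAt_q (e : ℝ) :
    HasDerivAt (q m) (m.eps0 * (1 + 3 * m.epsr * e ^ 2)) e := by
  have h : HasDerivAt (fun e : ℝ => m.eps0 * (e + m.epsr * e ^ 3))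
      (m.eps0 * (1 + m.epsr * (3 * e ^ 2))) e := by
    simpa using ((hasDerivAt_id e).add ((hasDerivAt_pow 3 e).const_mul m.epsr)).const_mul m.eps0
  exact h.congr_deriv (by ring)

theorem hasDerivAt_p (r : ℝ) :
    HasDerivAt (p m) (m.eps0 * (1 + 3 * m.epsr * p m r ^ 2))⁻¹ r :=
  HasDerivAt.of_local_left_inverse (continuous_p m).continuousAt (hasDerivAt_q m (p m r))
    (mul_pos m.eps0_pos (one_add_three_epsr_mul_sq_pos m _)).ne' (.of_forall (q_p m))

/-! ### Speeds as functions of the tangential displacement `d` and the normal one `d0` -/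

/-- The modulus of the electric field at the states with normal displacement `d0` and tangential
displacement of modulus `d`. -/
noncomputable def modE (d d0 : ℝ) : ℝ := p m (Real.sqrt (d0 ^ 2 + d ^ 2))

/-- The square of the fast speed, as a function of `d` and `d0`. -/
noncomputable def fastSq (d d0 : ℝ) : ℝ := lightSpeed m ^ 2 / (1 + m.epsr * modE m d d0 ^ 2)

theorem modE_nonneg (d d0 : ℝ) : 0 ≤ modE m d d0 := p_nonneg m (Real.sqrt_nonneg _)

theorem continuous_modE (d0 : ℝ) : Continuous fun d => modE m d d0 :=
  (continuous_p m).comp (by fun_prop)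

theorem modE_lt_modE {a b d0 : ℝ} (ha : 0 ≤ a) (hab : a < b) : modE m a d0 < modE m b d0 := by
  apply p_strictMono m
  apply Real.sqrt_lt_sqrt (by positivity)
  gcongr

theorem modE_sq_lt {a b d0 : ℝ} (ha : 0 ≤ a) (hab : a < b) :
    modE m a d0 ^ 2 < modE m b d0 ^ 2 := by
  have h := modE_nonneg m a d0
  have := modE_lt_modE m (d0 := d0) ha hab
  gcongr

theorem modE_neg (d d0 : ℝ) : modE m (-d) d0 = modE m d d0 := by simp [modE]

theorem eps0_mul_modE (d d0 : ℝ) :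
    m.eps0 * (modE m d d0 * (1 + m.epsr * modE m d d0 ^ 2)) = Real.sqrt (d0 ^ 2 + d ^ 2) := by
  have h := q_p m (Real.sqrt (d0 ^ 2 + d ^ 2))
  rw [← h]
  simp only [q, modE]
  ring

theorem eps0_mul_modE_sq (d d0 : ℝ) :
    m.eps0 ^ 2 * modE m d d0 ^ 2 * (1 + m.epsr * modE m d d0 ^ 2) ^ 2 = d0 ^ 2 + d ^ 2 := by
  have h := congrArg (· ^ 2) (eps0_mul_modE m d d0)
  beta_reduce at h
  rw [Real.sq_sqrt (by positivity)] at h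
  rw [← h]
  ring

theorem hasDerivAt_modE {d : ℝ} (hd : 0 < d) (d0 : ℝ) :
    HasDerivAt (fun d => modE m d d0)
      (d / (m.eps0 ^ 2 * modE m d d0 * (1 + m.epsr * modE m d d0 ^ 2) *
        (1 + 3 * m.epsr * modE m d d0 ^ 2))) d := by
  have hr : 0 < d0 ^ 2 + d ^ 2 := by positivity
  have h1 : HasDerivAt (fun d : ℝ => d0 ^ 2 + d ^ 2) (2 * d) d := by
    simpa using (hasDerivAt_pow 2 d).const_add (d0 ^ 2)
  have h2 := (hasDerivAt_p m (Real.sqrt (d0 ^ 2 + d ^ 2))).comp d (h1.sqrt hr.ne')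
  refine h2.congr_deriv ?_
  have h3 := eps0_mul_modE m d d0
  have h4 := Real.sqrt_pos.2 hr
  have h5 : 0 < modE m d d0 := (modE_nonneg m 0 d0).trans_lt (modE_lt_modE m le_rfl hd)
  have h6 := m.eps0_pos
  have h7 := one_add_epsr_mul_sq_pos m (modE m d d0)
  have h8 := one_add_three_epsr_mul_sq_pos m (modE m d d0)
  change (m.eps0 * (1 + 3 * m.epsr * modE m d d0 ^ 2))⁻¹ * _ = _
  rw [← h3]
  field_simp

theorem modE_pos {d : ℝ} (hd : 0 < d) (d0 : ℝ) : 0 < modE m d d0 :=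
  (modE_nonneg m 0 d0).trans_lt (modE_lt_modE m le_rfl hd)

theorem fastSq_pos (d d0 : ℝ) : 0 < fastSq m d d0 :=
  div_pos (pow_pos (lightSpeed_pos m) 2) (one_add_epsr_mul_sq_pos m _)

theorem fastSq_le (d d0 : ℝ) : fastSq m d d0 ≤ lightSpeed m ^ 2 := by
  have h := m.epsr_pos
  refine div_le_self (sq_nonneg _) ?_
  have : 0 ≤ m.epsr * modE m d d0 ^ 2 := by positivity
  linarith

theorem fastSq_lt {a b d0 : ℝ} (ha : 0 ≤ a) (hab : a < b) : fastSq m b d0 < fastSq m a d0 := by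
  have h1 := modE_sq_lt m (d0 := d0) ha hab
  have h2 := m.epsr_pos
  have h3 := lightSpeed_pos m
  have h4 := one_add_epsr_mul_sq_pos m (modE m a d0)
  unfold fastSq
  gcongr

theorem continuous_fastSq (d0 : ℝ) : Continuous fun d => fastSq m d d0 := by
  have := continuous_modE m d0
  exact continuous_const.div (by fun_prop) fun d => (one_add_epsr_mul_sq_pos m _).ne'

theorem fastSq_neg (d d0 : ℝ) : fastSq m (-d) d0 = fastSq m d d0 := by simp [fastSq, modE_neg]

theorem f_eq (d d0 : ℝ) : f m d d0 = fastSq m d d0 * d := by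
  simp only [f, fastSq, modE]; ring

/-- The square of the slow speed as a function of `s = |E| ^ 2` and `d0`. -/
noncomputable def slowSq (s d0 : ℝ) : ℝ :=
  lightSpeed m ^ 2 * (1 + 3 * m.epsr * s)⁻¹ +
    lightSpeed m ^ 2 * (2 * m.epsr * d0 ^ 2 / m.eps0 ^ 2) *
      ((1 + m.epsr * s) ^ 3 * (1 + 3 * m.epsr * s))⁻¹

theorem slowSq_pos {s : ℝ} (hs : 0 ≤ s) (d0 : ℝ) : 0 < slowSq m s d0 := by
  have h1 := m.eps0_pos
  have h2 := m.epsr_pos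
  have h3 := lightSpeed_pos m
  unfold slowSq
  positivity

theorem slowSq_lt {s t : ℝ} (hs : 0 ≤ s) (hst : s < t) (d0 : ℝ) :
    slowSq m t d0 < slowSq m s d0 := by
  have h1 := m.eps0_pos
  have h2 := m.epsr_pos
  have h3 := lightSpeed_pos m
  have ht := hs.trans_lt hst
  unfold slowSq
  refine add_lt_add_of_lt_of_le (by gcongr) ?_
  gcongr

theorem lam_eq_sqrt (d d0 : ℝ) : lam m d d0 = Real.sqrt (slowSq m (modE m d d0 ^ 2) d0) := by
  have h1 := m.eps0_pos
  have h2 := one_add_epsr_mul_sq_pos m (modE m d d0)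
  have h3 := one_add_three_epsr_mul_sq_pos m (modE m d d0)
  simp only [lam, slowSq]
  change Real.sqrt (lightSpeed m ^ 2 * (1 + m.epsr * (modE m d d0 ^ 2 +
    2 * (d0 / (m.eps0 * (1 + m.epsr * modE m d d0 ^ 2))) ^ 2)) /
      ((1 + m.epsr * modE m d d0 ^ 2) * (1 + 3 * m.epsr * modE m d d0 ^ 2))) = _
  congr 1
  field_simp
  ring

theorem lam_pos (d d0 : ℝ) : 0 < lam m d d0 := by
  rw [lam_eq_sqrt]
  exact Real.sqrt_pos.2 (slowSq_pos m (sq_nonneg _) _)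

theorem lam_sq (d d0 : ℝ) : lam m d d0 ^ 2 = slowSq m (modE m d d0 ^ 2) d0 := by
  rw [lam_eq_sqrt, Real.sq_sqrt (slowSq_pos m (sq_nonneg _) _).le]

/-- Eliminating `d0` through `|D|² = d0² + d²` shows that the gap between the slow and the fast
speed is governed by `d²`: the two speeds coincide exactly at `d = 0`. The product rule for `f`
produces the same form. -/
theorem lam_sq_eq (d d0 : ℝ) : lam m d d0 ^ 2 = fastSq m d d0 *
    (1 - 2 * m.epsr * d ^ 2 / (m.eps0 ^ 2 * (1 + m.epsr * modE m d d0 ^ 2) ^ 2 *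
      (1 + 3 * m.epsr * modE m d d0 ^ 2))) := by
  have h1 := m.eps0_pos
  have h2 := one_add_epsr_mul_sq_pos m (modE m d d0)
  have h3 := one_add_three_epsr_mul_sq_pos m (modE m d d0)
  have h4 : d ^ 2 = m.eps0 ^ 2 * modE m d d0 ^ 2 * (1 + m.epsr * modE m d d0 ^ 2) ^ 2 - d0 ^ 2 := by
    rw [eps0_mul_modE_sq]; ring
  rw [lam_sq, slowSq, fastSq, h4]
  field_simp
  ring

theorem lam_sq_le (d d0 : ℝ) : lam m d d0 ^ 2 ≤ fastSq m d d0 := by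
  rw [lam_sq_eq]
  have h1 := m.eps0_pos
  have h2 := m.epsr_pos
  refine mul_le_of_le_one_right (fastSq_pos m d d0).le (sub_le_self _ (by positivity))

theorem lam_sq_lt {d : ℝ} (hd : d ≠ 0) (d0 : ℝ) : lam m d d0 ^ 2 < fastSq m d d0 := by
  rw [lam_sq_eq]
  have h1 := m.eps0_pos
  have h2 := m.epsr_pos
  refine mul_lt_of_lt_one_right (fastSq_pos m d d0) (sub_lt_self _ (by positivity))

theorem lam_sq_zero (d0 : ℝ) : lam m 0 d0 ^ 2 = fastSq m 0 d0 := by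
  rw [lam_sq_eq]
  simp

theorem lam_le_lightSpeed (d d0 : ℝ) : lam m d d0 ≤ lightSpeed m :=
  le_of_sq_le_sq ((lam_sq_le m d d0).trans (fastSq_le m d d0)) (lightSpeed_pos m).le

theorem lam_lt {a b d0 : ℝ} (ha : 0 ≤ a) (hab : a < b) : lam m b d0 < lam m a d0 := by
  rw [lam_eq_sqrt, lam_eq_sqrt]
  exact Real.sqrt_lt_sqrt (slowSq_pos m (sq_nonneg _) _).le
    (slowSq_lt m (sq_nonneg _) (modE_sq_lt m ha hab) d0)

theorem lam_strictAntiOn (d0 : ℝ) : StrictAntiOn (fun d => lam m d d0) (Ici 0) :=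
  fun _ ha _ _ hab => lam_lt m ha hab

theorem continuous_lam (d0 : ℝ) : Continuous fun d => lam m d d0 := by
  simp only [lam_eq_sqrt, slowSq]
  have h := continuous_modE m d0
  have h2 := m.epsr_pos
  have h3 : ∀ d : ℝ, 1 + 3 * m.epsr * modE m d d0 ^ 2 ≠ 0 := fun d => by positivity
  have h4 : ∀ d : ℝ, (1 + m.epsr * modE m d d0 ^ 2) ^ 3 * (1 + 3 * m.epsr * modE m d d0 ^ 2) ≠ 0 :=
    fun d => by positivity
  exact Real.continuous_sqrt.comp (.add (continuous_const.mul (.inv₀ (by fun_prop) h3))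
    (continuous_const.mul (.inv₀ (by fun_prop) h4)))

theorem hasDerivAt_slowSq {s : ℝ} (hs : 0 ≤ s) (d0 : ℝ) :
    ∃ L < 0, HasDerivAt (fun s => slowSq m s d0) L s := by
  have h1 := m.eps0_pos
  have h2 := m.epsr_pos
  have h3 := lightSpeed_pos m
  have e1 : HasDerivAt (fun s : ℝ => 1 + m.epsr * s) m.epsr s := by
    simpa using ((hasDerivAt_id s).const_mul m.epsr).const_add 1
  have e3 : HasDerivAt (fun s : ℝ => 1 + 3 * m.epsr * s) (3 * m.epsr) s := by
    simpa using ((hasDerivAt_id s).const_mul (3 * m.epsr)).const_add 1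
  have hn : (1 + m.epsr * s) ^ 3 * (1 + 3 * m.epsr * s) ≠ 0 := by positivity
  have e4 := ((e3.fun_inv (by positivity)).const_mul (lightSpeed m ^ 2)).add
    ((((e1.fun_pow 3).fun_mul e3).fun_inv hn).const_mul
      (lightSpeed m ^ 2 * (2 * m.epsr * d0 ^ 2 / m.eps0 ^ 2)))
  refine ⟨_, ?_, e4⟩
  simp only [neg_div, mul_neg]
  refine add_neg_of_neg_of_nonpos (neg_neg_of_pos (by positivity))
    (neg_nonpos_of_nonneg ?_)
  positivity

/-- This is genuine nonlinearity away from `d = 0`; the strict sign lets `λ` be inverted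
differentiably along a rarefaction wave. -/
theorem hasDerivAt_lam {d : ℝ} (hd : 0 < d) (d0 : ℝ) :
    ∃ L < 0, HasDerivAt (fun d => lam m d d0) L d := by
  obtain ⟨L, hL, h⟩ := hasDerivAt_slowSq m (sq_nonneg (modE m d d0)) d0
  have h0 := modE_pos m hd d0
  have h1 := m.eps0_pos
  have h2 := m.epsr_pos
  have e0 := h.comp d ((hasDerivAt_modE m hd d0).fun_pow 2)
  have e1 := e0.sqrt
    (slowSq_pos m (sq_nonneg (modE m d d0)) d0).ne'
  have e2 : (fun d => lam m d d0) =
      fun d => Real.sqrt (((fun s => slowSq m s d0) ∘ fun d => modE m d d0 ^ 2) d) :=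
    funext fun d => lam_eq_sqrt m d d0
  rw [e2]
  refine ⟨_, ?_, e1⟩
  have h3 := Real.sqrt_pos.2 (slowSq_pos m (sq_nonneg (modE m d d0)) d0)
  refine div_neg_of_neg_of_pos (mul_neg_of_neg_of_pos hL ?_) (mul_pos two_pos h3)
  positivity

/-! ### The function `f` -/

theorem f_zero (d0 : ℝ) : f m 0 d0 = 0 := by simp [f_eq]

theorem f_neg (d d0 : ℝ) : f m (-d) d0 = -f m d d0 := by simp [f_eq, fastSq_neg]

theorem continuous_f (d0 : ℝ) : Continuous fun d => f m d d0 := by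
  simp only [f_eq]
  exact (continuous_fastSq m d0).mul continuous_id

theorem hasDerivAt_f {d : ℝ} (hd : 0 < d) (d0 : ℝ) :
    HasDerivAt (fun d => f m d d0) (lam m d d0 ^ 2) d := by
  have h0 := modE_pos m hd d0
  have h1 := m.eps0_pos
  have h2 := one_add_epsr_mul_sq_pos m (modE m d d0)
  have h3 := one_add_three_epsr_mul_sq_pos m (modE m d d0)
  have e1 := ((((hasDerivAt_modE m hd d0).fun_pow 2).const_mul m.epsr).const_add 1)
  have e2 := ((hasDerivAt_id d).const_mul (lightSpeed m ^ 2)).div e1 h2.ne'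
  refine e2.congr_deriv ?_
  rw [lam_sq_eq, fastSq]
  simp
  field_simp

theorem f_strictMonoOn (d0 : ℝ) : StrictMonoOn (fun d => f m d d0) (Ici 0) := by
  refine strictMonoOn_of_deriv_pos (convex_Ici 0) (continuous_f m d0).continuousOn fun d hd => ?_
  rw [interior_Ici] at hd
  rw [(hasDerivAt_f m hd d0).deriv]
  exact pow_pos (lam_pos m d d0) 2

theorem f_strictMono (d0 : ℝ) : StrictMono fun d => f m d d0 :=
  strictMono_of_odd_strictMonoOn_nonneg (fun d => f_neg m d d0) (f_strictMonoOn m d0)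

/-- The constitutive law gives `fastSq * |D| = c² ε₀ |E|`, so `f` equals `c² ε₀ |E| d / |D|`, and
`|E|` is unbounded. -/
theorem tendsto_f_atTop (d0 : ℝ) : Tendsto (fun d => f m d d0) atTop atTop := by
  have h1 := m.eps0_pos
  have h3 := lightSpeed_pos m
  -- The factor `1 / 2` comes from `|D| ≤ 2 d`, valid once `d ≥ |d0|`.
  have hk : 0 < lightSpeed m ^ 2 * m.eps0 / 2 := by positivity
  refine tendsto_atTop_mono' _ ?_ ((tendsto_p_atTop m).const_mul_atTop hk)
  filter_upwards [eventually_ge_atTop |d0|, eventually_gt_atTop 0] with d hd hd'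
  have h4 := eps0_mul_modE m d d0
  have h5 : Real.sqrt (d0 ^ 2 + d ^ 2) ≤ 2 * d := by
    refine Real.sqrt_le_iff.2 ⟨by positivity, ?_⟩
    have : d0 ^ 2 ≤ d ^ 2 := sq_le_sq' (by linarith [neg_abs_le d0]) ((le_abs_self d0).trans hd)
    nlinarith
  have h6 : p m d ≤ modE m d d0 := by
    refine (p_strictMono m).monotone (Real.le_sqrt_of_sq_le ?_)
    nlinarith [sq_nonneg d0]
  have h7 := one_add_epsr_mul_sq_pos m (modE m d d0)
  rw [f_eq, fastSq, div_mul_eq_mul_div (lightSpeed m ^ 2), le_div_iff₀ h7]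
  have h8 : lightSpeed m ^ 2 * m.eps0 / 2 * p m d * (1 + m.epsr * modE m d d0 ^ 2) ≤
      lightSpeed m ^ 2 * m.eps0 / 2 * modE m d d0 * (1 + m.epsr * modE m d d0 ^ 2) := by gcongr
  have h9 : lightSpeed m ^ 2 * m.eps0 / 2 * modE m d d0 * (1 + m.epsr * modE m d d0 ^ 2) =
      lightSpeed m ^ 2 / 2 * Real.sqrt (d0 ^ 2 + d ^ 2) := by rw [← h4]; ring
  rw [h9] at h8
  refine h8.trans ?_
  have : lightSpeed m ^ 2 / 2 * Real.sqrt (d0 ^ 2 + d ^ 2) ≤ lightSpeed m ^ 2 / 2 * (2 * d) := by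
    gcongr
  linarith

theorem f_surjective (d0 : ℝ) : Function.Surjective fun d => f m d d0 := by
  refine (continuous_f m d0).surjective (tendsto_f_atTop m d0) ?_
  have h := tendsto_neg_atTop_atBot.comp ((tendsto_f_atTop m d0).comp tendsto_neg_atBot_atTop)
  refine h.congr fun e => ?_
  simp [f_neg]

/-- The chord slopes of the concave function `f(·, d0)` are between the values of its derivative
`λ ^ 2` at the end points. -/
theorem f_sub_bounds {a b d0 : ℝ} (ha : 0 ≤ a) (hab : a < b) :
    lam m b d0 ^ 2 * (b - a) < f m b d0 - f m a d0 ∧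
      f m b d0 - f m a d0 < lam m a d0 ^ 2 * (b - a) := by
  obtain ⟨s, hs, h⟩ := exists_hasDerivAt_eq_slope (fun d => f m d d0) (fun d => lam m d d0 ^ 2) hab
    (continuous_f m d0).continuousOn fun s hs => hasDerivAt_f m (ha.trans_lt hs.1) d0
  have hba : 0 < b - a := sub_pos.2 hab
  have h1 := lam_lt m (d0 := d0) ha hs.1
  have h2 := lam_lt m (d0 := d0) (ha.trans hs.1.le) hs.2
  have p1 := lam_pos m b d0
  have p2 := lam_pos m s d0
  rw [eq_div_iff hba.ne'] at h
  rw [← h]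
  constructor <;> gcongr

/-! ### The function `G` -/

theorem f_G (d0m d0p d : ℝ) : f m (G m d0m d0p d) d0p = f m d d0m :=
  Function.rightInverse_invFun (f_surjective m d0p) (f m d d0m)

theorem G_strictMono (d0m d0p : ℝ) : StrictMono (G m d0m d0p) := by
  intro a b hab
  rw [← (f_strictMono m d0p).lt_iff_lt]
  simp only [f_G]
  exact f_strictMono m d0m hab

theorem eq_G_of_f_eq {d0m d0p x y : ℝ} (h : f m x d0m = f m y d0p) : y = G m d0m d0p x :=
  (f_strictMono m d0p).injective (by simp only [f_G]; exact h.symm)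

theorem G_zero (d0m d0p : ℝ) : G m d0m d0p 0 = 0 :=
  (eq_G_of_f_eq m (by rw [f_zero, f_zero])).symm

theorem continuous_G (d0m d0p : ℝ) : Continuous (G m d0m d0p) :=
  (G_strictMono m d0m d0p).monotone.continuous_of_surjective fun y => by
    obtain ⟨x, hx⟩ := f_surjective m d0m (f m y d0p)
    exact ⟨x, (eq_G_of_f_eq m hx).symm⟩

/-! ### The wave function -/

theorem waveFn_of_le {a b : ℝ} (h : b ≤ a) (d0 : ℝ) : waveFn m a b d0 = S m a b d0 := if_pos h

theorem waveFn_self (a d0 : ℝ) : waveFn m a a d0 = 0 := by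
  rw [waveFn_of_le m le_rfl, S]
  simp

theorem waveFn_of_ge {a b : ℝ} (h : a ≤ b) (d0 : ℝ) : waveFn m a b d0 = -R m a b d0 := by
  rcases h.lt_or_eq with h | rfl
  · exact if_neg h.not_ge
  · rw [waveFn_self]
    simp [R]

theorem hasDerivAt_R (a b d0 : ℝ) : HasDerivAt (fun b => R m a b d0) (lam m b d0) b :=
  (continuous_lam m d0).integral_hasStrictDerivAt a b |>.hasDerivAt

theorem continuous_R (a d0 : ℝ) : Continuous fun b => R m a b d0 :=
  continuous_iff_continuousAt.2 fun b => (hasDerivAt_R m a b d0).continuousAt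

theorem R_strictMono (a d0 : ℝ) : StrictMono fun b => R m a b d0 :=
  strictMono_of_deriv_pos fun b => by
    rw [(hasDerivAt_R m a b d0).deriv]
    exact lam_pos m b d0

/-- On the shock branch both factors under the root shrink as `b` grows towards `a`; on the
rarefaction branch the integrand `λ` is positive. The branches meet at `b = a`. -/
theorem waveFn_strictAntiOn {a : ℝ} (ha : 0 ≤ a) (d0 : ℝ) :
    StrictAntiOn (fun b => waveFn m a b d0) (Ici 0) := by
  have h1 : StrictAntiOn (fun b => waveFn m a b d0) (Icc 0 a) := by
    intro b hb c hc hbc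
    simp only [waveFn_of_le m hb.2, waveFn_of_le m hc.2, S]
    have hf : f m b d0 < f m c d0 := f_strictMono m d0 hbc
    have hf' : f m c d0 ≤ f m a d0 := (f_strictMono m d0).monotone hc.2
    have hc2 := hc.2
    refine Real.sqrt_lt_sqrt (mul_nonneg (by linarith) (by linarith)) ?_
    refine mul_lt_mul_of_nonneg_of_pos' ?_ ?_ ?_ ?_ <;> linarith
  have h2 : StrictAntiOn (fun b => waveFn m a b d0) (Ici a) := by
    intro b hb c hc hbc
    simp only [waveFn_of_ge m hb, waveFn_of_ge m hc]
    exact neg_lt_neg (R_strictMono m a d0 hbc)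
  have h3 := h1.union h2 (c := a) ⟨⟨ha, le_rfl⟩, fun x hx => hx.2⟩ isLeast_Ici
  rwa [Icc_union_Ici_eq_Ici ha] at h3

theorem continuous_waveFn (a d0 : ℝ) : Continuous fun b => waveFn m a b d0 := by
  have h1 : Continuous fun b => S m a b d0 := by
    unfold S
    have := continuous_f m d0
    fun_prop
  have h2 := (continuous_R m a d0).neg
  refine Continuous.if_le h1 h2 continuous_id continuous_const ?_
  rintro b rfl
  rw [← waveFn_of_le m le_rfl, ← waveFn_of_ge m le_rfl]

/-- From `λ ≤ c` follows `λ ≥ λ² / c = f' / c`. This makes the integral of `λ` diverge with `f`,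
although `λ` has no positive lower bound. -/
theorem waveFn_le {a b : ℝ} (ha : 0 ≤ a) (hab : a ≤ b) (d0 : ℝ) :
    waveFn m a b d0 ≤ -((f m b d0 - f m a d0) / lightSpeed m) := by
  have hc := lightSpeed_pos m
  have h : MonotoneOn (fun b => R m a b d0 - f m b d0 / lightSpeed m) (Ici 0) := by
    refine monotoneOn_of_deriv_nonneg (convex_Ici 0)
      ((continuous_R m a d0).sub ((continuous_f m d0).div_const _)).continuousOn ?_ ?_ <;>
      rw [interior_Ici]
    · exact fun x hx => ((hasDerivAt_R m a x d0).sub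
        ((hasDerivAt_f m hx d0).div_const _)).differentiableAt.differentiableWithinAt
    · intro x hx
      have e := ((hasDerivAt_R m a x d0).sub ((hasDerivAt_f m hx d0).div_const (lightSpeed m)))
      refine le_of_le_of_eq ?_ e.deriv.symm
      have h1 := lam_le_lightSpeed m x d0
      have h2 := lam_pos m x d0
      rw [sub_nonneg, div_le_iff₀ hc, sq]
      gcongr
  have h1 := h ha (ha.trans hab) hab
  have h2 : R m a a d0 = 0 := by simp [R]
  rw [waveFn_of_ge m hab]
  simp only [h2] at h1
  rw [sub_div]
  linarith

theorem tendsto_waveFn {a : ℝ} (ha : 0 ≤ a) (d0 : ℝ) :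
    Tendsto (fun b => waveFn m a b d0) atTop atBot := by
  have h1 : Tendsto (fun b => -((f m b d0 - f m a d0) / lightSpeed m)) atTop atBot :=
    tendsto_neg_atTop_atBot.comp
      ((tendsto_atTop_add_const_right _ _ (tendsto_f_atTop m d0)).atTop_div_const
        (lightSpeed_pos m))
  refine tendsto_atBot_mono' _ ?_ h1
  filter_upwards [eventually_ge_atTop a] with b hb using waveFn_le m ha hb d0

/-- Because `f(0) = 0`, the quantity under the root is `fastSq * a²`. The fast speed thus appears in
a slow wave, which is what ties the 2-wave to the 1-contact discontinuity. -/
theorem waveFn_zero {a : ℝ} (ha : 0 ≤ a) (d0 : ℝ) :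
    waveFn m a 0 d0 = Real.sqrt (fastSq m a d0) * a := by
  rw [waveFn_of_le m ha, S, f_zero, f_eq, sub_zero, sub_zero, mul_assoc,
    Real.sqrt_mul (fastSq_pos m a d0).le, Real.sqrt_mul_self ha]

/-- The scalar equation that determines the tangential displacements of the inner states. -/
theorem exists_scalar_solution {d1 d2 : ℝ} (hd1 : 0 ≤ d1) (hd2 : 0 ≤ d2) (d0m d0p : ℝ) {h : ℝ}
    (hh : h ≤ waveFn m d1 0 d0m + waveFn m d2 0 d0p) :
    ∃ x, 0 ≤ x ∧ h = waveFn m d1 x d0m + waveFn m d2 (G m d0m d0p x) d0p := by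
  have hc : Continuous fun x => waveFn m d1 x d0m + waveFn m d2 (G m d0m d0p x) d0p :=
    (continuous_waveFn m d1 d0m).add ((continuous_waveFn m d2 d0p).comp (continuous_G m d0m d0p))
  have hl : Tendsto (fun x => waveFn m d1 x d0m + waveFn m d2 (G m d0m d0p x) d0p)
      atTop atBot := by
    -- The second summand never exceeds its value at `0`, since `G` maps `[0, ∞)` to itself;
    -- divergence of the first suffices.
    refine tendsto_atBot_mono' _ ?_
      (tendsto_atBot_add_const_right _ (waveFn m d2 0 d0p) (tendsto_waveFn m hd1 d0m))
    filter_upwards [eventually_ge_atTop 0] with x hx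
    gcongr
    have hG : 0 ≤ G m d0m d0p x := by
      rw [← G_zero m d0m d0p]
      exact (G_strictMono m d0m d0p).monotone hx
    exact (waveFn_strictAntiOn m hd2 d0p).antitoneOn self_mem_Ici hG hG
  obtain ⟨b, hb, hb0⟩ := ((hl.eventually (eventually_le_atBot h)).and
    (eventually_ge_atTop 0)).exists
  obtain ⟨x, hx, hx'⟩ := intermediate_value_Icc' hb0 hc.continuousOn
    (show h ∈ Icc _ _ from ⟨hb, by simpa only [G_zero] using hh⟩)
  exact ⟨x, hx.1, hx'.symm⟩

theorem scalar_strictAntiOn {d1 d2 : ℝ} (hd1 : 0 ≤ d1) (hd2 : 0 ≤ d2) (d0m d0p : ℝ) :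
    StrictAntiOn (fun x => waveFn m d1 x d0m + waveFn m d2 (G m d0m d0p x) d0p) (Ici 0) := by
  have hG : ∀ x ∈ Ici (0 : ℝ), G m d0m d0p x ∈ Ici (0 : ℝ) := fun x hx => by
    rw [← G_zero m d0m d0p]
    exact (G_strictMono m d0m d0p).monotone hx
  exact fun a ha b hb hab => add_lt_add (waveFn_strictAntiOn m hd1 d0m ha hb hab)
    (waveFn_strictAntiOn m hd2 d0p (hG a ha) (hG b hb) (G_strictMono m d0m d0p hab))

end Kerr

namespace Kerr

variable (m : Medium)

/-! ### The cross product with a unit vector -/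

theorem cross_apply_zero (a b : E3) : cross a b 0 = a 1 * b 2 - a 2 * b 1 := by
  simp [cross, cross_apply]

theorem cross_apply_one (a b : E3) : cross a b 1 = a 2 * b 0 - a 0 * b 2 := by
  simp [cross, cross_apply]

theorem cross_apply_two (a b : E3) : cross a b 2 = a 0 * b 1 - a 1 * b 0 := by
  simp [cross, cross_apply]

theorem inner_eq_sum (a b : E3) : inner ℝ a b = a 0 * b 0 + a 1 * b 1 + a 2 * b 2 := by
  simp [PiLp.inner_apply, Fin.sum_univ_three, mul_comm]

theorem cross_add (a b c : E3) : cross a (b + c) = cross a b + cross a c := by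
  simp [cross]

theorem cross_smul (a : E3) (r : ℝ) (b : E3) : cross a (r • b) = r • cross a b := by
  simp [cross]

/-- The map `b ↦ a × b` as a continuous linear map. -/
noncomputable def crossL (a : E3) : E3 →L[ℝ] E3 :=
  LinearMap.toContinuousLinearMap
    { toFun := cross a, map_add' := cross_add a, map_smul' := cross_smul a }

theorem cross_sub (a b c : E3) : cross a (b - c) = cross a b - cross a c := map_sub (crossL a) b c

theorem cross_neg (a b : E3) : cross a (-b) = -cross a b := map_neg (crossL a) b

theorem cross_zero (a : E3) : cross a 0 = 0 := map_zero (crossL a)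

theorem cross_self (a : E3) : cross a a = 0 := by simp [cross]

theorem continuous_cross (a : E3) : Continuous (cross a) := (crossL a).continuous

theorem inner_cross_self (a b : E3) : inner ℝ (cross a b) a = 0 := by
  rw [inner_eq_sum, cross_apply_zero, cross_apply_one, cross_apply_two]
  ring

variable {ω : E3}

theorem inner_self_of_norm_one (hω : ‖ω‖ = 1) : inner ℝ ω ω = 1 := by
  rw [real_inner_self_eq_norm_sq, hω, one_pow]

theorem cross_cross (hω : ‖ω‖ = 1) (a : E3) : cross ω (cross ω a) = inner ℝ a ω • ω - a := by
  have h := inner_self_of_norm_one hω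
  rw [inner_eq_sum] at h
  ext i
  fin_cases i
  · change cross ω (cross ω a) 0 = inner ℝ a ω * ω 0 - a 0
    rw [cross_apply_zero, cross_apply_one, cross_apply_two, inner_eq_sum]
    linear_combination -a 0 * h
  · change cross ω (cross ω a) 1 = inner ℝ a ω * ω 1 - a 1
    rw [cross_apply_one, cross_apply_zero, cross_apply_two, inner_eq_sum]
    linear_combination -a 1 * h
  · change cross ω (cross ω a) 2 = inner ℝ a ω * ω 2 - a 2
    rw [cross_apply_two, cross_apply_one, cross_apply_zero, inner_eq_sum]
    linear_combination -a 2 * h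

theorem inner_cross_cross (hω : ‖ω‖ = 1) (a b : E3) :
    inner ℝ (cross ω a) (cross ω b) = inner ℝ a b - inner ℝ a ω * inner ℝ b ω := by
  have h := inner_self_of_norm_one hω
  simp only [inner_eq_sum, cross_apply_two, cross_apply_one, cross_apply_zero] at h ⊢
  linear_combination (a 0 * b 0 + a 1 * b 1 + a 2 * b 2) * h

theorem inner_cross_left (a b : E3) : inner ℝ (cross ω a) b = -inner ℝ a (cross ω b) := by
  simp only [inner_eq_sum, cross_apply_two, cross_apply_one, cross_apply_zero]
  ring

theorem norm_cross_sq (hω : ‖ω‖ = 1) (a : E3) :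
    ‖cross ω a‖ ^ 2 = ‖a‖ ^ 2 - inner ℝ a ω ^ 2 := by
  rw [← real_inner_self_eq_norm_sq, inner_cross_cross hω, real_inner_self_eq_norm_sq]
  ring

theorem norm_cross_of_orthogonal (hω : ‖ω‖ = 1) {a : E3} (ha : inner ℝ a ω = 0) :
    ‖cross ω a‖ = ‖a‖ := by
  have h := norm_cross_sq hω a
  rw [ha] at h
  exact (sq_eq_sq₀ (norm_nonneg _) (norm_nonneg _)).1 (by linarith)

theorem norm_cross_cross (hω : ‖ω‖ = 1) (a : E3) : ‖cross ω (cross ω a)‖ = ‖cross ω a‖ :=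
  norm_cross_of_orthogonal hω (inner_cross_self ω a)

theorem norm_eq_sqrt (hω : ‖ω‖ = 1) (a : E3) :
    ‖a‖ = Real.sqrt (inner ℝ a ω ^ 2 + ‖cross ω a‖ ^ 2) := by
  rw [norm_cross_sq hω, add_sub_cancel, Real.sqrt_sq (norm_nonneg a)]

theorem cross_cross_of_orthogonal (hω : ‖ω‖ = 1) {a : E3} (ha : inner ℝ a ω = 0) :
    cross ω (cross ω a) = -a := by
  rw [cross_cross hω, ha, zero_smul, zero_sub]

theorem exists_unit_orthogonal (ω : E3) : ∃ ζ : E3, ‖ζ‖ = 1 ∧ inner ℝ ζ ω = 0 := by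
  have h : ∃ a : E3, a ≠ 0 ∧ inner ℝ a ω = 0 := by
    by_cases h0 : ω 0 = 0 ∧ ω 1 = 0
    · refine ⟨!₂[1, 0, 0], fun h => ?_, ?_⟩
      · simpa using congrArg (fun a : E3 => a 0) h
      · simp [inner_eq_sum, h0.1]
    · refine ⟨!₂[ω 1, -ω 0, 0], fun h => h0 ⟨?_, ?_⟩, ?_⟩
      · simpa using congrArg (fun a : E3 => a 1) h
      · simpa using congrArg (fun a : E3 => a 0) h
      · simp [inner_eq_sum]
        ring
  obtain ⟨a, ha, ha'⟩ := h
  refine ⟨‖a‖⁻¹ • a, norm_smul_inv_norm ha, ?_⟩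
  rw [inner_smul_left, ha', mul_zero]

/-- Polar decomposition of a vector with respect to the direction `ω`. -/
theorem exists_polar (hω : ‖ω‖ = 1) (a : E3) :
    ∃ ζ : E3, ‖ζ‖ = 1 ∧ inner ℝ ζ ω = 0 ∧ a = inner ℝ a ω • ω + ‖cross ω a‖ • ζ := by
  -- A vanishing tangential part leaves the direction free; otherwise it is that of the tangential
  -- projection `-ω × (ω × a)`.
  by_cases h : cross ω a = 0
  · obtain ⟨ζ, h1, h2⟩ := exists_unit_orthogonal ω
    refine ⟨ζ, h1, h2, ?_⟩
    have h3 := cross_cross hω a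
    rw [h, cross_zero] at h3
    rw [h, norm_zero, zero_smul, add_zero]
    exact (sub_eq_zero.1 h3.symm).symm
  · refine ⟨-(‖cross ω a‖⁻¹ • cross ω (cross ω a)), ?_, ?_, ?_⟩
    · rw [norm_neg, ← norm_cross_cross hω]
      refine norm_smul_inv_norm fun h0 => h ?_
      rw [← norm_eq_zero, ← norm_cross_cross hω, h0, norm_zero]
    · rw [inner_neg_left, inner_smul_left, inner_cross_self]
      simp
    · rw [smul_neg, smul_inv_smul₀ (norm_ne_zero_iff.2 h), cross_cross hω]
      abel

theorem eq_of_inner_eq_of_cross_eq (hω : ‖ω‖ = 1) {a b : E3} (h1 : inner ℝ a ω = inner ℝ b ω)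
    (h2 : cross ω a = cross ω b) : a = b := by
  have h3 := cross_cross hω a
  rw [h2, cross_cross hω, h1] at h3
  exact (sub_right_injective h3).symm

section Polar

variable {ζ : E3}

theorem inner_polar (hω : ‖ω‖ = 1) (hζ : inner ℝ ζ ω = 0) (d0 d : ℝ) :
    inner ℝ (d0 • ω + d • ζ) ω = d0 := by
  rw [inner_add_left, inner_smul_left, inner_smul_left, hζ, inner_self_of_norm_one hω]
  simp

theorem cross_polar (d0 d : ℝ) : cross ω (d0 • ω + d • ζ) = d • cross ω ζ := by
  rw [cross_add, cross_smul, cross_smul, cross_self, smul_zero, zero_add]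

theorem norm_cross_polar (hω : ‖ω‖ = 1) (hζ1 : ‖ζ‖ = 1) (hζ : inner ℝ ζ ω = 0) (d0 : ℝ) {d : ℝ}
    (hd : 0 ≤ d) : ‖cross ω (d0 • ω + d • ζ)‖ = d := by
  rw [cross_polar, norm_smul, norm_cross_of_orthogonal hω hζ, hζ1, mul_one, Real.norm_of_nonneg hd]

end Polar

/-! ### The constitutive law and the flux -/

theorem norm_displacement (E : E3) : ‖displacement m E‖ = q m ‖E‖ := by
  have h := mul_pos m.eps0_pos (one_add_epsr_mul_sq_pos m ‖E‖)
  rw [displacement, norm_smul, Real.norm_of_nonneg h.le, q]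
  ring

theorem displacement_injective : Function.Injective (displacement m) := by
  intro E E' h
  have h1 : ‖E‖ = ‖E'‖ := (q_strictMono m).injective (by
    rw [← norm_displacement, ← norm_displacement, h])
  have h2 := (mul_pos m.eps0_pos (one_add_epsr_mul_sq_pos m ‖E'‖)).ne'
  simp only [displacement, h1] at h
  exact smul_right_injective _ h2 h

/-- The right-hand side has norm `p ‖D‖`, so `displacement` maps it back to `D`; injectivity then
identifies it with the inverse. -/
theorem elecField_eq (D : E3) :
    elecField m D = (m.eps0 * (1 + m.epsr * p m ‖D‖ ^ 2))⁻¹ • D := by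
  have h0 := mul_pos m.eps0_pos (one_add_epsr_mul_sq_pos m (p m ‖D‖))
  have hn : ‖(m.eps0 * (1 + m.epsr * p m ‖D‖ ^ 2))⁻¹ • D‖ = p m ‖D‖ := by
    rw [norm_smul, Real.norm_of_nonneg (inv_pos.2 h0).le, inv_mul_eq_iff_eq_mul₀ h0.ne']
    conv_lhs => rw [← q_p m ‖D‖]
    rw [q]
    ring
  have h : displacement m ((m.eps0 * (1 + m.epsr * p m ‖D‖ ^ 2))⁻¹ • D) = D := by
    rw [displacement, hn, smul_inv_smul₀ h0.ne']
  conv_lhs => rw [← h]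
  exact Function.leftInverse_invFun (displacement_injective m) _

theorem norm_elecField (D : E3) : ‖elecField m D‖ = p m ‖D‖ := by
  have h0 := mul_pos m.eps0_pos (one_add_epsr_mul_sq_pos m (p m ‖D‖))
  rw [elecField_eq, norm_smul, Real.norm_of_nonneg (inv_pos.2 h0).le, inv_mul_eq_iff_eq_mul₀ h0.ne']
  conv_lhs => rw [← q_p m ‖D‖]
  rw [q]
  ring

theorem continuous_elecField : Continuous (elecField m) := by
  have h := continuous_p m
  simp only [funext (elecField_eq m)]
  have h2 : ∀ D : E3, m.eps0 * (1 + m.epsr * p m ‖D‖ ^ 2) ≠ 0 := fun D =>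
    (mul_pos m.eps0_pos (one_add_epsr_mul_sq_pos m _)).ne'
  exact .smul (.inv₀ (by fun_prop) h2) continuous_id

theorem continuous_flux (ω : E3) : Continuous (flux m ω) := by
  have h1 := continuous_cross ω
  have h2 := continuous_elecField m
  unfold flux
  fun_prop

theorem p_norm (hω : ‖ω‖ = 1) (D : E3) : p m ‖D‖ = modE m ‖cross ω D‖ (inner ℝ D ω) := by
  rw [modE, ← norm_eq_sqrt hω]

/-- `E` is a scalar multiple of `D`, and the constants combine through `(ε₀ μ₀)⁻¹ = c²`. All later
computations use this form, in which only `ω × D` and `D · ω` occur. -/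
theorem flux_eq (hω : ‖ω‖ = 1) (u : State) :
    flux m ω u = (-cross ω u.2, fastSq m ‖cross ω u.1‖ (inner ℝ u.1 ω) • cross ω u.1) := by
  rw [flux, elecField_eq, cross_smul, smul_smul, p_norm m hω, fastSq, lightSpeed_sq, mul_inv,
    mul_inv]
  congr 2
  ring

theorem fastSpeed_eq (hω : ‖ω‖ = 1) (u : State) :
    fastSpeed m u = Real.sqrt (fastSq m ‖cross ω u.1‖ (inner ℝ u.1 ω)) := by
  rw [fastSpeed, norm_elecField, p_norm m hω, fastSq, Real.sqrt_div (sq_nonneg _),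
    Real.sqrt_sq (lightSpeed_pos m).le]

theorem slowSpeed_eq (hω : ‖ω‖ = 1) (u : State) :
    slowSpeed m ω u = lam m ‖cross ω u.1‖ (inner ℝ u.1 ω) := by
  rw [slowSpeed, norm_elecField, elecField_eq, p_norm m hω, inner_smul_left]
  simp only [lam, modE]
  rw [conj_trivial, ← div_eq_inv_mul]

theorem fastSpeed_pos (hω : ‖ω‖ = 1) (u : State) : 0 < fastSpeed m u := by
  rw [fastSpeed_eq m hω]
  exact Real.sqrt_pos.2 (fastSq_pos m _ _)

theorem fastSpeed_sq (hω : ‖ω‖ = 1) (u : State) :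
    fastSpeed m u ^ 2 = fastSq m ‖cross ω u.1‖ (inner ℝ u.1 ω) := by
  rw [fastSpeed_eq m hω, Real.sq_sqrt (fastSq_pos m _ _).le]

theorem slowSpeed_pos (hω : ‖ω‖ = 1) (u : State) : 0 < slowSpeed m ω u := by
  rw [slowSpeed_eq m hω]
  exact lam_pos m _ _

theorem rankineHugoniot_iff (hω : ‖ω‖ = 1) (σ : ℝ) (ul ur : State) :
    RankineHugoniot m ω σ ul ur ↔
      σ • (ur.1 - ul.1) = -cross ω (ur.2 - ul.2) ∧
      σ • (ur.2 - ul.2) = fastSq m ‖cross ω ur.1‖ (inner ℝ ur.1 ω) • cross ω ur.1 -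
        fastSq m ‖cross ω ul.1‖ (inner ℝ ul.1 ω) • cross ω ul.1 := by
  rw [RankineHugoniot, flux_eq m hω, flux_eq m hω, Prod.ext_iff, cross_sub]
  simp only [Prod.smul_fst, Prod.smul_snd, Prod.fst_sub, Prod.snd_sub]
  rw [neg_sub_neg, neg_sub]

end Kerr

namespace Kerr

variable (m : Medium) {ω : E3}

/-! ### Analysis of the contact discontinuities, shocks and rarefaction waves -/

theorem fastSq_injOn {a b d0 : ℝ} (ha : 0 ≤ a) (hb : 0 ≤ b)
    (h : fastSq m a d0 = fastSq m b d0) : a = b := by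
  rcases lt_trichotomy a b with hab | hab | hab
  · exact absurd h (fastSq_lt m ha hab).ne'
  · exact hab
  · exact absurd h (fastSq_lt m hb hab).ne

/-- Since `s ≠ 0`, the normal displacement is continuous; equal fast speeds then force equal
tangential moduli by strict monotonicity of `fastSq`. With the common factor `s²`, the second
Rankine-Hugoniot equation divided by `s` is the formula for `H`, and a double cross product recovers
the first. -/
theorem isContact_one_iff (hω : ‖ω‖ = 1) (s : ℝ) (ul ur : State) :
    IsContact m ω 1 s ul ur ↔ s = -fastSpeed m ul ∧ inner ℝ ur.1 ω = inner ℝ ul.1 ω ∧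
      ‖cross ω ur.1‖ = ‖cross ω ul.1‖ ∧ ur.2 = ul.2 + s • cross ω (ur.1 - ul.1) := by
  simp only [IsContact, eigenvalue, rankineHugoniot_iff m hω]
  constructor
  · rintro ⟨h1, h2, h3, h4⟩
    have hs : s < 0 := h1 ▸ neg_neg_of_pos (fastSpeed_pos m hω ul)
    have h5 : inner ℝ ur.1 ω = inner ℝ ul.1 ω := by
      have h := congrArg (fun a => inner ℝ a ω) h3
      simp only [inner_smul_left, inner_neg_left, inner_cross_self, conj_trivial, neg_zero,
        mul_eq_zero, hs.ne, false_or, inner_sub_left] at h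
      linarith
    have e1 : s ^ 2 = fastSq m ‖cross ω ul.1‖ (inner ℝ ul.1 ω) := by
      rw [h1, neg_sq, fastSpeed_sq m hω]
    have e2 : s ^ 2 = fastSq m ‖cross ω ur.1‖ (inner ℝ ur.1 ω) := by
      rw [h2, neg_sq, fastSpeed_sq m hω]
    refine ⟨h1, h5, ?_, ?_⟩
    · rw [h5, e1] at e2
      exact (fastSq_injOn m (norm_nonneg _) (norm_nonneg _) e2).symm
    · rw [← e1, ← e2, ← smul_sub, sq, mul_smul] at h4
      have h6 := smul_right_injective _ hs.ne h4
      rw [cross_sub, ← h6]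
      abel
  · rintro ⟨h1, h2, h3, h4⟩
    have hf : fastSpeed m ur = fastSpeed m ul := by
      rw [fastSpeed_eq m hω, fastSpeed_eq m hω, h2, h3]
    have e1 : s ^ 2 = fastSq m ‖cross ω ul.1‖ (inner ℝ ul.1 ω) := by
      rw [h1, neg_sq, fastSpeed_sq m hω]
    refine ⟨h1, by rw [hf, h1], ?_, ?_⟩
    · rw [h4, add_sub_cancel_left, cross_smul, cross_cross hω, inner_sub_left, h2, sub_self,
        zero_smul, zero_sub, smul_neg, neg_neg]
    · rw [h4, add_sub_cancel_left, h2, h3, ← e1, cross_sub, smul_smul, sq, smul_sub]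

/-- The state with tangential displacement `y • ζ` on the wave curve of the second field through
the state with tangential displacement `x • ζ` and magnetic field `H`. -/
noncomputable def waveState (ω ζ H : E3) (d0 x y : ℝ) : State :=
  (d0 • ω + y • ζ, H + waveFn m x y d0 • cross ω ζ)

theorem waveState_self (ω ζ H : E3) (d0 x : ℝ) : waveState m ω ζ H d0 x x = (d0 • ω + x • ζ, H) := by
  rw [waveState, waveFn_self, zero_smul, add_zero]

/-- The velocity of the left end of the wave of the second field. -/
noncomputable def leftSpeed (d0 x y : ℝ) : ℝ :=
  if y < x then -(S m x y d0 / (x - y)) else -lam m x d0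

/-- The velocity of the right end of the wave of the second field. -/
noncomputable def rightSpeed (d0 x y : ℝ) : ℝ :=
  if y < x then -(S m x y d0 / (x - y)) else -lam m y d0

/-- The normal form of a wave of the second field. -/
structure IsSlowWave (ω ζ H : E3) (d0 x y a b : ℝ) (ul ur : State) (v : ℝ → State) : Prop where
  norm_eq : ‖ζ‖ = 1
  orthogonal : inner ℝ ζ ω = 0
  x_nonneg : 0 ≤ x
  y_nonneg : 0 ≤ y
  left_eq : ul = waveState m ω ζ H d0 x x
  right_eq : ur = waveState m ω ζ H d0 x y
  left_speed : a = leftSpeed m d0 x y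
  right_speed : b = rightSpeed m d0 x y
  inner_eq : ∀ ξ ∈ Ioo a b, ∃ ρ, 0 ≤ ρ ∧ lam m ρ d0 = -ξ ∧ v ξ = waveState m ω ζ H d0 x ρ

theorem lam_injOn {a b d0 : ℝ} (ha : 0 ≤ a) (hb : 0 ≤ b) (h : lam m a d0 = lam m b d0) : a = b :=
  (lam_strictAntiOn m d0).injOn ha hb h

theorem isSlowWave_of_trivial (hω : ‖ω‖ = 1) {a b : ℝ} {ul ur : State} {v : ℝ → State}
    (h : ul = ur) (ha : a = -slowSpeed m ω ul) (hb : b = -slowSpeed m ω ul) :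
    ∃ ζ y, IsSlowWave m ω ζ ul.2 (inner ℝ ul.1 ω) ‖cross ω ul.1‖ y a b ul ur v := by
  obtain ⟨ζ, h1, h2, h3⟩ := exists_polar hω ul.1
  have e : ul = waveState m ω ζ ul.2 (inner ℝ ul.1 ω) ‖cross ω ul.1‖ ‖cross ω ul.1‖ := by
    rw [waveState_self, ← h3]
  refine ⟨ζ, ‖cross ω ul.1‖, h1, h2, norm_nonneg _, norm_nonneg _, e, h ▸ e, ?_, ?_, ?_⟩
  · rw [leftSpeed, if_neg (lt_irrefl _), ha, slowSpeed_eq m hω]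
  · rw [rightSpeed, if_neg (lt_irrefl _), hb, slowSpeed_eq m hω]
  · rw [ha, hb, Ioo_self]
    simp

/-- Eliminating `H` leaves one vector equation between the two tangential displacements. The Lax
inequalities make its coefficients nonnegative, so the right one is a nonnegative multiple of the
left one; they also give `λ(left) ≤ -σ ≤ λ(right)`, which rules out an increase of the modulus. -/
theorem isSlowWave_of_isLaxShock (hω : ‖ω‖ = 1) {σ : ℝ} {ul ur : State} {v : ℝ → State}
    (h : IsLaxShock m ω 2 σ ul ur) :
    ∃ ζ y, IsSlowWave m ω ζ ul.2 (inner ℝ ul.1 ω) ‖cross ω ul.1‖ y σ σ ul ur v := by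
  obtain ⟨hne, hRH, h1, -, h2, h3⟩ := h
  simp only [eigenvalue, Nat.add_one_sub_one] at h1 h2 h3
  have hσ : σ < 0 := h3.trans_lt (neg_neg_of_pos (slowSpeed_pos m hω ul))
  rw [rankineHugoniot_iff m hω] at hRH
  obtain ⟨hD, hH⟩ := hRH
  obtain ⟨ζ, hζ1, hζ2, hpol⟩ := exists_polar hω ul.1
  have hd0 : inner ℝ ur.1 ω = inner ℝ ul.1 ω := by
    have h := congrArg (fun a => inner ℝ a ω) hD
    simp only [inner_smul_left, inner_neg_left, inner_cross_self, conj_trivial, neg_zero,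
      mul_eq_zero, hσ.ne, false_or, inner_sub_left] at h
    linarith
  have hH0 : inner ℝ (ur.2 - ul.2) ω = 0 := by
    have h := congrArg (fun a => inner ℝ a ω) hH
    beta_reduce at h
    rw [inner_smul_left, inner_sub_left (_ • _), inner_smul_left (cross ω _),
      inner_smul_left (cross ω _), inner_cross_self, inner_cross_self, mul_zero, mul_zero,
      sub_zero] at h
    exact (mul_eq_zero.1 h).resolve_left hσ.ne
  set d0 : ℝ := inner ℝ ul.1 ω with hd0_def
  set x := ‖cross ω ul.1‖ with hx
  have hHσ : ur.2 - ul.2 = σ • (cross ω ur.1 - cross ω ul.1) := by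
    have h := congrArg (cross ω) hD
    rw [cross_neg, cross_cross_of_orthogonal hω hH0, neg_neg, cross_smul, cross_sub] at h
    exact h.symm
  have hkey : (fastSq m ‖cross ω ur.1‖ d0 - σ ^ 2) • cross ω ur.1 =
      (fastSq m x d0 - σ ^ 2) • cross ω ul.1 := by
    rw [hHσ, smul_smul, hd0, ← sq] at hH
    rw [sub_smul, sub_smul, sub_eq_sub_iff_sub_eq_sub, ← hH, smul_sub]
  rw [slowSpeed_eq m hω, hd0] at h1
  rw [slowSpeed_eq m hω] at h3
  have hσl : σ ^ 2 ≤ fastSq m x d0 := by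
    have : (-σ) ^ 2 ≤ fastSpeed m ul ^ 2 := by
      have := fastSpeed_pos m hω ul
      gcongr
      · linarith
      · linarith
    rwa [neg_sq, fastSpeed_sq m hω] at this
  have hσr : σ ^ 2 ≤ lam m ‖cross ω ur.1‖ d0 ^ 2 := by
    rw [← neg_sq σ]
    gcongr
    · linarith
    · linarith
  -- For a nonzero right tangential part, `σ² ≤ λ² < fastSq` is strict there, so the coefficient in
  -- `hkey` can be divided out.
  obtain ⟨t, ht, htr⟩ : ∃ t : ℝ, 0 ≤ t ∧ cross ω ur.1 = t • cross ω ul.1 := by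
    by_cases hr : cross ω ur.1 = 0
    · exact ⟨0, le_rfl, by rw [hr, zero_smul]⟩
    · have hlt := hσr.trans_lt (lam_sq_lt m (norm_ne_zero_iff.2 hr) d0)
      refine ⟨(fastSq m ‖cross ω ur.1‖ d0 - σ ^ 2)⁻¹ * (fastSq m x d0 - σ ^ 2), ?_, ?_⟩
      · exact mul_nonneg (inv_nonneg.2 (sub_pos.2 hlt).le) (sub_nonneg.2 hσl)
      · rw [mul_smul, ← hkey, inv_smul_smul₀ (sub_pos.2 hlt).ne']
  have hx0 : 0 ≤ x := norm_nonneg _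
  have hy : ‖cross ω ur.1‖ = t * x := by rw [htr, norm_smul, Real.norm_of_nonneg ht]
  have hl : cross ω ul.1 = x • cross ω ζ := by
    conv_lhs => rw [hpol, cross_polar]
  have hr : cross ω ur.1 = (t * x) • cross ω ζ := by rw [htr, hl, smul_smul]
  have hrD : ur.1 = d0 • ω + (t * x) • ζ := by
    refine eq_of_inner_eq_of_cross_eq hω ?_ ?_
    · rw [hd0, inner_polar hω hζ2]
    · rw [hr, cross_polar]
  have hcr : cross ω ur.1 ≠ cross ω ul.1 := by
    intro h
    apply hne
    have hD' : ul.1 = ur.1 := eq_of_inner_eq_of_cross_eq hω hd0.symm h.symm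
    rw [h, sub_self, smul_zero, sub_eq_zero] at hHσ
    exact Prod.ext hD' hHσ.symm
  have hyx : t * x < x := by
    rcases lt_trichotomy (t * x) x with h | h | h
    · exact h
    · rw [hr, hl, h] at hcr
      exact absurd rfl hcr
    · have := lam_lt m (d0 := d0) hx0 h
      rw [hy] at h1
      linarith
  have hζ0 : cross ω ζ ≠ 0 := by
    rw [← norm_ne_zero_iff, norm_cross_of_orthogonal hω hζ2, hζ1]
    exact one_ne_zero
  -- The component of `hkey` along `ω × ζ`: the squared shock speed is a chord slope of `f`.
  have hf : f m x d0 - f m (t * x) d0 = σ ^ 2 * (x - t * x) := by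
    rw [hr, hl, smul_smul, smul_smul, norm_smul, norm_cross_of_orthogonal hω hζ2, hζ1, mul_one,
      Real.norm_of_nonneg (mul_nonneg ht hx0)] at hkey
    have := smul_left_injective ℝ hζ0 hkey
    simp only [f_eq]
    linarith
  have hS : S m x (t * x) d0 = -σ * (x - t * x) := by
    have : (f m x d0 - f m (t * x) d0) * (x - t * x) = (-σ * (x - t * x)) ^ 2 := by
      rw [hf]; ring
    rw [S, this, Real.sqrt_sq (mul_nonneg (by linarith) (by linarith))]
  have hspeed : σ = -(S m x (t * x) d0 / (x - t * x)) := by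
    rw [hS, mul_div_cancel_right₀ _ (by linarith), neg_neg]
  refine ⟨ζ, t * x, hζ1, hζ2, hx0, mul_nonneg ht hx0, ?_, ?_, ?_, ?_, ?_⟩
  · rw [waveState_self]
    exact Prod.ext hpol rfl
  · rw [waveState, waveFn_of_le m hyx.le, hS]
    refine Prod.ext hrD ?_
    rw [eq_add_of_sub_eq' hHσ, hr, hl, ← sub_smul, smul_smul]
    congr 2
    ring
  · rw [leftSpeed, if_pos hyx, ← hspeed]
  · rw [rightSpeed, if_pos hyx, ← hspeed]
  · rw [Ioo_self]
    simp

/-! ### Rarefaction waves in normal form -/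

theorem eq_left_of_hasDerivAt_zero {E : Type*} [NormedAddCommGroup E] [NormedSpace ℝ E]
    [CompleteSpace E] {g : ℝ → E} {a b : ℝ} (hc : ContinuousOn g (Icc a b))
    (hd : ∀ ξ ∈ Ioo a b, HasDerivAt g 0 ξ) : ∀ ξ ∈ Icc a b, g ξ = g a := by
  intro ξ hξ
  have h := intervalIntegral.integral_eq_sub_of_hasDerivAt_of_le hξ.1
    (hc.mono (Icc_subset_Icc_right hξ.2))
    (fun s hs => hd s ⟨hs.1, hs.2.trans_le hξ.2⟩) (by simp)
  simp only [intervalIntegral.integral_zero] at h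
  exact (sub_eq_zero.1 h.symm)

theorem exists_hasDerivAt_fastSq {d : ℝ} (hd : 0 < d) (d0 : ℝ) :
    ∃ k, HasDerivAt (fun d => fastSq m d d0) k d :=
  ⟨_, (hasDerivAt_const d (lightSpeed m ^ 2)).fun_div
    ((((hasDerivAt_modE m hd d0).fun_pow 2).const_mul m.epsr).const_add 1)
    (one_add_epsr_mul_sq_pos m _).ne'⟩

theorem hasDerivAt_norm {w : ℝ → E3} {w' : E3} {ξ : ℝ} (h : HasDerivAt w w' ξ) (h0 : w ξ ≠ 0) :
    HasDerivAt (fun η => ‖w η‖) (inner ℝ (w ξ) w' / ‖w ξ‖) ξ := by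
  have h1 := h.norm_sq.sqrt (pow_ne_zero 2 (norm_ne_zero_iff.2 h0))
  simp only [Real.sqrt_sq (norm_nonneg _)] at h1
  refine h1.congr_deriv ?_
  rw [mul_div_mul_left _ _ two_ne_zero]

/-- A velocity parallel to the position changes the length only, not the direction. -/
theorem hasDerivAt_inv_norm_smul {w : ℝ → E3} {μ ξ : ℝ} (h : HasDerivAt w (μ • w ξ) ξ)
    (h0 : w ξ ≠ 0) : HasDerivAt (fun η => ‖w η‖⁻¹ • w η) 0 ξ := by
  have hn := norm_ne_zero_iff.2 h0
  refine (((hasDerivAt_norm h h0).fun_inv hn).fun_smul h).congr_deriv ?_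
  rw [smul_smul, ← add_smul, inner_smul_right, real_inner_self_eq_norm_sq]
  rw [show ‖w ξ‖⁻¹ * μ + -(μ * ‖w ξ‖ ^ 2 / ‖w ξ‖) / ‖w ξ‖ ^ 2 = 0 by field_simp; ring, zero_smul]

/-- With `w = ω × D` and `κ = fastSq`, the equations read `(κ w)' = ξ² w'`, so `(ξ² - κ) w'` is
parallel to `w`. As `ξ² = λ² < κ` where `w ≠ 0`, the direction of `w` is constant. The relation
`λ(|w|) = -ξ` makes `|w|` increase, and `H' = ξ w'` integrates to `-R`. -/
theorem isSlowWave_of_isRarefaction (hω : ‖ω‖ = 1) {a b : ℝ} {ul ur : State} {v : ℝ → State}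
    (h : IsRarefaction m ω 2 a b ul ur v) :
    ∃ ζ y, IsSlowWave m ω ζ ul.2 (inner ℝ ul.1 ω) ‖cross ω ul.1‖ y a b ul ur v := by
  obtain ⟨hab, hc, ha, hb, hint⟩ := h
  have hneg : ∀ ξ ∈ Ioo a b, ξ < 0 := fun ξ hξ => by
    rw [← (hint ξ hξ).1]
    exact neg_neg_of_pos (slowSpeed_pos m hω _)
  set d0 : ℝ := inner ℝ ul.1 ω with hd0
  have hc1 : ContinuousOn (fun ξ => (v ξ).1) (Icc a b) := continuous_fst.comp_continuousOn hc
  have hc2 : ContinuousOn (fun ξ => (v ξ).2) (Icc a b) := continuous_snd.comp_continuousOn hc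
  have hcw : ContinuousOn (fun ξ => cross ω (v ξ).1) (Icc a b) :=
    (continuous_cross ω).comp_continuousOn hc1
  have hcρ : ContinuousOn (fun ξ => ‖cross ω (v ξ).1‖) (Icc a b) := hcw.norm
  -- the differential equations
  have hode : ∀ ξ ∈ Ioo a b, ∃ D' H' : E3, HasDerivAt (fun ξ => (v ξ).1) D' ξ ∧
      HasDerivAt (fun ξ => (v ξ).2) H' ξ ∧ inner ℝ D' ω = 0 ∧ H' = ξ • cross ω D' ∧
      HasDerivAt (fun ξ => fastSq m ‖cross ω (v ξ).1‖ (inner ℝ (v ξ).1 ω) • cross ω (v ξ).1)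
        (ξ ^ 2 • cross ω D') ξ := by
    intro ξ hξ
    obtain ⟨-, v', hv, hF⟩ := hint ξ hξ
    have hξ0 := (hneg ξ hξ).ne
    simp only [flux_eq m hω] at hF
    have e1 : HasDerivAt (fun ξ => (v ξ).1) v'.1 ξ :=
      (ContinuousLinearMap.fst ℝ E3 E3).hasFDerivAt.comp_hasDerivAt ξ hv
    have e2 : HasDerivAt (fun ξ => (v ξ).2) v'.2 ξ :=
      (ContinuousLinearMap.snd ℝ E3 E3).hasFDerivAt.comp_hasDerivAt ξ hv
    have e3 : HasDerivAt (fun ξ => -cross ω (v ξ).2) (ξ • v'.1) ξ :=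
      (ContinuousLinearMap.fst ℝ E3 E3).hasFDerivAt.comp_hasDerivAt ξ hF
    have e4 : HasDerivAt
        (fun ξ => fastSq m ‖cross ω (v ξ).1‖ (inner ℝ (v ξ).1 ω) • cross ω (v ξ).1)
        (ξ • v'.2) ξ :=
      (ContinuousLinearMap.snd ℝ E3 E3).hasFDerivAt.comp_hasDerivAt ξ hF
    have e5 : HasDerivAt (fun ξ => -cross ω (v ξ).2) (-cross ω v'.2) ξ :=
      ((crossL ω).hasFDerivAt.comp_hasDerivAt ξ e2).neg
    have e6 := e3.unique e5
    have e7 : inner ℝ v'.1 ω = 0 := by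
      have h := congrArg (fun a => inner ℝ a ω) e6
      simpa only [inner_smul_left, inner_neg_left, inner_cross_self, conj_trivial, neg_zero,
        mul_eq_zero, hξ0, false_or] using h
    have e8 : inner ℝ v'.2 ω = 0 := by
      have h1 := e4.inner ℝ (hasDerivAt_const ξ ω)
      have h2 : (fun ξ => inner ℝ
          (fastSq m ‖cross ω (v ξ).1‖ (inner ℝ (v ξ).1 ω) • cross ω (v ξ).1) ω) =
          fun _ => (0 : ℝ) := by
        funext ξ
        rw [inner_smul_left, inner_cross_self, mul_zero]
      rw [h2] at h1
      have h3 := h1.unique (hasDerivAt_const ξ (0 : ℝ))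
      simpa [inner_smul_left, hξ0] using h3
    have e9 : v'.2 = ξ • cross ω v'.1 := by
      have h := congrArg (cross ω) e6
      rw [cross_neg, cross_cross_of_orthogonal hω e8, neg_neg, cross_smul] at h
      exact h.symm
    refine ⟨v'.1, v'.2, e1, e2, e7, e9, ?_⟩
    rwa [e9, smul_smul, ← sq] at e4
  have hn : ∀ ξ ∈ Icc a b, inner ℝ (v ξ).1 ω = d0 := by
    intro ξ hξ
    rw [hd0, ← ha]
    refine eq_left_of_hasDerivAt_zero (g := fun ξ => inner ℝ (v ξ).1 ω)
      (hc1.inner continuousOn_const) (fun η hη => ?_) ξ hξ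
    obtain ⟨D', H', h1, -, h2, -⟩ := hode η hη
    simpa [h2] using h1.inner ℝ (hasDerivAt_const η ω)
  have hlam : ∀ ξ ∈ Icc a b, lam m ‖cross ω (v ξ).1‖ d0 = -ξ := by
    have h1 : EqOn (fun ξ => lam m ‖cross ω (v ξ).1‖ d0) (fun ξ => -ξ) (Ioo a b) := by
      intro ξ hξ
      have h2 := (hint ξ hξ).1
      simp only [eigenvalue, slowSpeed_eq m hω, hn ξ (Ioo_subset_Icc_self hξ)] at h2 ⊢
      linarith
    exact h1.of_subset_closure ((continuous_lam m d0).comp_continuousOn hcρ) continuousOn_neg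
      Ioo_subset_Icc_self (closure_Ioo hab.ne).ge
  have hmono : ∀ ξ ∈ Icc a b, ∀ η ∈ Icc a b, ξ < η → ‖cross ω (v ξ).1‖ < ‖cross ω (v η).1‖ := by
    intro ξ hξ η hη hlt
    by_contra! hle
    have := (lam_strictAntiOn m d0).antitoneOn (norm_nonneg _) (norm_nonneg _) hle
    simp only [hlam ξ hξ, hlam η hη] at this
    linarith
  have hpos : ∀ ξ ∈ Ioc a b, 0 < ‖cross ω (v ξ).1‖ := fun ξ hξ =>
    (norm_nonneg _).trans_lt (hmono a ⟨le_rfl, hab.le⟩ ξ (Ioc_subset_Icc_self hξ) hξ.1)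
  -- the direction of the tangential displacement is constant
  have hdir0 : ∀ ξ ∈ Ioo a b, HasDerivAt (fun ξ => ‖cross ω (v ξ).1‖⁻¹ • cross ω (v ξ).1) 0 ξ := by
    intro ξ hξ
    obtain ⟨D', H', h1, -, -, -, h2⟩ := hode ξ hξ
    have hw0 := hpos ξ (Ioo_subset_Ioc_self hξ)
    have hw : HasDerivAt (fun ξ => cross ω (v ξ).1) (cross ω D') ξ :=
      (crossL ω).hasFDerivAt.comp_hasDerivAt ξ h1
    obtain ⟨k, hk⟩ := exists_hasDerivAt_fastSq m hw0 d0
    have hk' := (hk.comp ξ (hasDerivAt_norm hw (norm_pos_iff.1 hw0))).fun_smul hw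
    have h3 : HasDerivAt
        (fun ξ => ((fun d => fastSq m d d0) ∘ fun ξ => ‖cross ω (v ξ).1‖) ξ • cross ω (v ξ).1)
        (ξ ^ 2 • cross ω D') ξ := by
      refine h2.congr_of_eventuallyEq ?_
      filter_upwards [isOpen_Ioo.mem_nhds hξ] with η hη
      simp only [Function.comp, hn η (Ioo_subset_Icc_self hη)]
    have h4 := hk'.unique h3
    have h5 : fastSq m ‖cross ω (v ξ).1‖ d0 ≠ ξ ^ 2 := by
      rw [← neg_sq ξ, ← hlam ξ (Ioo_subset_Icc_self hξ)]
      exact (lam_sq_lt m hw0.ne' d0).ne'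
    have h6 : ∃ μ : ℝ, cross ω D' = μ • cross ω (v ξ).1 := by
      refine ⟨(ξ ^ 2 - fastSq m ‖cross ω (v ξ).1‖ d0)⁻¹ *
        (k * (inner ℝ (cross ω (v ξ).1) (cross ω D') / ‖cross ω (v ξ).1‖)), ?_⟩
      rw [mul_smul, eq_inv_smul_iff₀ (sub_ne_zero.2 h5.symm), sub_smul, ← h4]
      simp only [Function.comp]
      rw [add_sub_cancel_left]
    obtain ⟨μ, h6⟩ := h6
    rw [h6] at hw
    exact hasDerivAt_inv_norm_smul hw (norm_pos_iff.1 hw0)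
  -- The direction is read off at the right end, because the tangential displacement may vanish at
  -- `a`.
  set η0 : E3 := ‖cross ω (v b).1‖⁻¹ • cross ω (v b).1 with hη0
  have hb0 := hpos b ⟨hab, le_rfl⟩
  have hη1 : ‖η0‖ = 1 := norm_smul_inv_norm (norm_pos_iff.1 hb0)
  have hη2 : inner ℝ η0 ω = 0 := by
    rw [hη0, inner_smul_left, inner_cross_self, mul_zero]
  have hdir1 : ∀ ξ ∈ Ioo a b, cross ω (v ξ).1 = ‖cross ω (v ξ).1‖ • η0 := by
    intro ξ hξ
    have hsub : Icc ξ b ⊆ Icc a b := Icc_subset_Icc_left hξ.1.le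
    have h1 := eq_left_of_hasDerivAt_zero (g := fun ξ => ‖cross ω (v ξ).1‖⁻¹ • cross ω (v ξ).1)
      (((hcρ.mono hsub).inv₀ fun η hη => (hpos η ⟨hξ.1.trans_le hη.1, hη.2⟩).ne').smul
        (hcw.mono hsub)) (fun η hη => hdir0 η ⟨hξ.1.trans hη.1, hη.2⟩) b ⟨hξ.2.le, le_rfl⟩
    beta_reduce at h1
    rw [hη0, h1, smul_inv_smul₀ (hpos ξ (Ioo_subset_Ioc_self hξ)).ne']
  have hdir : ∀ ξ ∈ Icc a b, cross ω (v ξ).1 = ‖cross ω (v ξ).1‖ • η0 :=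
    EqOn.of_subset_closure (s := Ioo a b) hdir1 hcw (hcρ.smul continuousOn_const)
      Ioo_subset_Icc_self (closure_Ioo hab.ne).ge
  -- `η0` is the direction of `ω × D`; turning it back by a quarter turn gives the direction `ζ` of
  -- the tangential part of `D`.
  have hζ : cross ω (-cross ω η0) = η0 := by
    rw [cross_neg, cross_cross_of_orthogonal hω hη2, neg_neg]
  set ζ : E3 := -cross ω η0 with hζ_def
  have hζ2 : inner ℝ ζ ω = 0 := by rw [hζ_def, inner_neg_left, inner_cross_self, neg_zero]
  have hζ1 : ‖ζ‖ = 1 := by rw [← norm_cross_of_orthogonal hω hζ2, hζ, hη1]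
  have hD : ∀ ξ ∈ Icc a b, (v ξ).1 = d0 • ω + ‖cross ω (v ξ).1‖ • ζ := by
    intro ξ hξ
    refine eq_of_inner_eq_of_cross_eq hω ?_ ?_
    · rw [hn ξ hξ, inner_polar hω hζ2]
    · rw [cross_polar, hζ]
      exact hdir ξ hξ
  -- the magnetic field
  have hH : ∀ ξ ∈ Icc a b, (v ξ).2 + R m ‖cross ω ul.1‖ ‖cross ω (v ξ).1‖ d0 • η0 = ul.2 := by
    intro ξ hξ
    have h0 : (v a).2 + R m ‖cross ω ul.1‖ ‖cross ω (v a).1‖ d0 • η0 = ul.2 := by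
      rw [ha, R, intervalIntegral.integral_same, zero_smul, add_zero]
    rw [← h0]
    refine eq_left_of_hasDerivAt_zero
      (g := fun ξ => (v ξ).2 + R m ‖cross ω ul.1‖ ‖cross ω (v ξ).1‖ d0 • η0)
      (hc2.add (((continuous_R m _ d0).comp_continuousOn hcρ).smul continuousOn_const))
      (fun η hη => ?_) ξ hξ
    obtain ⟨D', H', h1, h2, -, h3, -⟩ := hode η hη
    have hw0 := hpos η (Ioo_subset_Ioc_self hη)
    have hw : HasDerivAt (fun ξ => cross ω (v ξ).1) (cross ω D') η :=
      (crossL ω).hasFDerivAt.comp_hasDerivAt η h1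
    obtain ⟨ρ', hρ⟩ : ∃ ρ', HasDerivAt (fun ξ => ‖cross ω (v ξ).1‖) ρ' η :=
      ⟨_, hasDerivAt_norm hw (norm_pos_iff.1 hw0)⟩
    have hw2 : HasDerivAt (fun ξ => ‖cross ω (v ξ).1‖ • η0) (cross ω D') η := by
      refine hw.congr_of_eventuallyEq ?_
      filter_upwards [isOpen_Ioo.mem_nhds hη] with ξ hξ
      exact (hdir1 ξ hξ).symm
    have h4 := hw2.unique (hρ.smul_const η0)
    refine (h2.add (((hasDerivAt_R m ‖cross ω ul.1‖ _ d0).comp η hρ).smul_const η0)).congr_deriv ?_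
    rw [h3, h4, hlam η (Ioo_subset_Icc_self hη), smul_smul, neg_mul, neg_smul, add_neg_cancel]
  have hstate : ∀ ξ ∈ Icc a b,
      v ξ = waveState m ω ζ ul.2 d0 ‖cross ω ul.1‖ ‖cross ω (v ξ).1‖ := by
    intro ξ hξ
    have hle : ‖cross ω ul.1‖ ≤ ‖cross ω (v ξ).1‖ := by
      rcases hξ.1.eq_or_lt with h | h
      · rw [← h, ha]
      · rw [← ha]
        exact (hmono a ⟨le_rfl, hab.le⟩ ξ hξ h).le
    refine Prod.ext (hD ξ hξ) ?_
    rw [waveState, waveFn_of_ge m hle, hζ, neg_smul, ← sub_eq_add_neg]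
    exact eq_sub_of_add_eq (hH ξ hξ)
  have ha' : a ∈ Icc a b := ⟨le_rfl, hab.le⟩
  have hb' : b ∈ Icc a b := ⟨hab.le, le_rfl⟩
  have hlt := hmono a ha' b hb' hab
  have hla := hlam a ha'
  have hlb := hlam b hb'
  have hsa := hstate a ha'
  have hsb := hstate b hb'
  rw [ha] at hlt hla hsa
  refine ⟨ζ, ‖cross ω (v b).1‖, hζ1, hζ2, norm_nonneg _, norm_nonneg _, hsa, ?_, ?_, ?_, ?_⟩
  · rw [← hb]
    exact hsb
  · rw [leftSpeed, if_neg hlt.not_gt, hla, neg_neg]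
  · rw [rightSpeed, if_neg hlt.not_gt, hlb, neg_neg]
  · exact fun ξ hξ => ⟨_, norm_nonneg _, hlam ξ (Ioo_subset_Icc_self hξ),
      hstate ξ (Ioo_subset_Icc_self hξ)⟩

theorem isSlowWave_of_isWave (hω : ‖ω‖ = 1) {a b : ℝ} {ul ur : State} {v : ℝ → State}
    (h : IsWave m ω 2 a b ul ur v) :
    ∃ ζ y, IsSlowWave m ω ζ ul.2 (inner ℝ ul.1 ω) ‖cross ω ul.1‖ y a b ul ur v := by
  rcases h with ⟨h1, h2, h3⟩ | ⟨rfl, h⟩ | h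
  · exact isSlowWave_of_trivial m hω h1 h2 h3
  · exact isSlowWave_of_isLaxShock m hω h
  · exact isSlowWave_of_isRarefaction m hω h

end Kerr

namespace Kerr

open Filter Topology

variable (m : Medium) {ω : E3}

/-! ### Construction of the waves of the second field -/

theorem flux_waveState (hω : ‖ω‖ = 1) {ζ : E3} (hζ1 : ‖ζ‖ = 1) (hζ : inner ℝ ζ ω = 0) (H : E3)
    (d0 x : ℝ) {y : ℝ} (hy : 0 ≤ y) : flux m ω (waveState m ω ζ H d0 x y) =
      (-cross ω H + waveFn m x y d0 • ζ, f m y d0 • cross ω ζ) := by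
  rw [flux_eq m hω]
  simp only [waveState]
  rw [norm_cross_polar hω hζ1 hζ d0 hy, inner_polar hω hζ, cross_polar, smul_smul, f_eq, cross_add,
    cross_smul, cross_cross_of_orthogonal hω hζ, smul_neg, neg_add, neg_neg]

theorem slowSpeed_waveState (hω : ‖ω‖ = 1) {ζ : E3} (hζ1 : ‖ζ‖ = 1) (hζ : inner ℝ ζ ω = 0) (H : E3)
    (d0 x : ℝ) {y : ℝ} (hy : 0 ≤ y) :
    slowSpeed m ω (waveState m ω ζ H d0 x y) = lam m y d0 := by
  rw [slowSpeed_eq m hω, waveState, norm_cross_polar hω hζ1 hζ d0 hy, inner_polar hω hζ]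

theorem fastSpeed_waveState (hω : ‖ω‖ = 1) {ζ : E3} (hζ1 : ‖ζ‖ = 1) (hζ : inner ℝ ζ ω = 0) (H : E3)
    (d0 x : ℝ) {y : ℝ} (hy : 0 ≤ y) :
    fastSpeed m (waveState m ω ζ H d0 x y) = Real.sqrt (fastSq m y d0) := by
  rw [fastSpeed_eq m hω, waveState, norm_cross_polar hω hζ1 hζ d0 hy, inner_polar hω hζ]

theorem S_sq {x y : ℝ} (hyx : y ≤ x) (d0 : ℝ) :
    S m x y d0 ^ 2 = (f m x d0 - f m y d0) * (x - y) :=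
  Real.sq_sqrt (mul_nonneg (sub_nonneg.2 ((f_strictMono m d0).monotone hyx)) (sub_nonneg.2 hyx))

/-- The squared speed is the slope of a chord of `f`, hence by concavity lies between the end slopes
`λ²`. For the last bound, `fastSq` decreases, so `f(x) - f(y)` is at most `fastSq(x) (x - y)`. -/
theorem shock_speed_bounds {x y : ℝ} (hy : 0 ≤ y) (hyx : y < x) (d0 : ℝ) :
    lam m x d0 ≤ S m x y d0 / (x - y) ∧ S m x y d0 / (x - y) ≤ lam m y d0 ∧
      S m x y d0 / (x - y) ≤ Real.sqrt (fastSq m x d0) := by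
  have h := sub_pos.2 hyx
  have hS := S_sq m hyx.le d0
  obtain ⟨h1, h2⟩ := f_sub_bounds m (d0 := d0) hy hyx
  have hS0 : 0 ≤ S m x y d0 := Real.sqrt_nonneg _
  have l1 := lam_pos m x d0
  have l2 := lam_pos m y d0
  have hκ : f m x d0 - f m y d0 ≤ fastSq m x d0 * (x - y) := by
    have := fastSq_lt m (d0 := d0) hy hyx
    rw [f_eq, f_eq]
    nlinarith
  refine ⟨?_, ?_, ?_⟩
  · rw [le_div_iff₀ h]
    refine le_of_sq_le_sq ?_ hS0
    rw [hS, mul_pow, sq (x - y), ← mul_assoc]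
    gcongr
  · rw [div_le_iff₀ h]
    refine le_of_sq_le_sq ?_ (by positivity)
    rw [hS, mul_pow, sq (x - y), ← mul_assoc]
    gcongr
  · rw [div_le_iff₀ h]
    refine le_of_sq_le_sq ?_ (by positivity)
    rw [hS, mul_pow, Real.sq_sqrt (fastSq_pos m x d0).le, sq (x - y), ← mul_assoc]
    gcongr

theorem isLaxShock_waveState (hω : ‖ω‖ = 1) {ζ : E3} (hζ1 : ‖ζ‖ = 1) (hζ : inner ℝ ζ ω = 0) (H : E3)
    (d0 : ℝ) {x y : ℝ} (hy : 0 ≤ y) (hyx : y < x) :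
    IsLaxShock m ω 2 (-(S m x y d0 / (x - y))) (waveState m ω ζ H d0 x x)
      (waveState m ω ζ H d0 x y) := by
  have hx := hy.trans hyx.le
  have h := sub_pos.2 hyx
  have hS := S_sq m hyx.le d0
  obtain ⟨h1, h2, h3⟩ := shock_speed_bounds m hy hyx d0
  have hl := lam_pos m x d0
  refine ⟨fun he => ?_, ?_, ?_, ?_, ?_, ?_⟩
  · have := congrArg (fun u : State => ‖cross ω u.1‖) he
    simp only [waveState, norm_cross_polar hω hζ1 hζ d0 hx, norm_cross_polar hω hζ1 hζ d0 hy] at this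
    exact hyx.ne' this
  · rw [RankineHugoniot, flux_waveState m hω hζ1 hζ H d0 x hx,
      flux_waveState m hω hζ1 hζ H d0 x hy, waveState_self, waveState, waveFn_self,
      waveFn_of_le m hyx.le]
    refine Prod.ext ?_ ?_
    · simp only [Prod.smul_fst, Prod.fst_sub]
      rw [add_sub_add_left_eq_sub, add_sub_add_left_eq_sub, ← sub_smul, ← sub_smul, smul_smul,
        sub_zero]
      congr 1
      field_simp
      ring
    · simp only [Prod.smul_snd, Prod.snd_sub]
      rw [add_sub_cancel_left, smul_smul, ← sub_smul]
      congr 1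
      field_simp
      rw [hS]
      ring
  · simp only [eigenvalue]
    rw [slowSpeed_waveState m hω hζ1 hζ H d0 x hy]
    exact neg_le_neg h2
  · simp only [eigenvalue]
    linarith
  · simp only [eigenvalue, Nat.add_one_sub_one]
    rw [fastSpeed_waveState m hω hζ1 hζ H d0 x hx]
    exact neg_le_neg h3
  · simp only [eigenvalue]
    rw [slowSpeed_waveState m hω hζ1 hζ H d0 x hx]
    exact neg_le_neg h1

/-- The inverse of the function `-λ(·, d0)` on `[x, y]`, continued by constants. -/
theorem exists_rarefaction_parameter {x y : ℝ} (hx : 0 ≤ x) (hxy : x < y) (d0 : ℝ) :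
    ∃ ρ : ℝ → ℝ, Continuous ρ ∧ (∀ ξ, ρ ξ ∈ Icc x y) ∧ (∀ ξ, ξ ≤ -lam m x d0 → ρ ξ = x) ∧
      (∀ ξ, -lam m y d0 ≤ ξ → ρ ξ = y) ∧
      ∀ ξ ∈ Ioo (-lam m x d0) (-lam m y d0),
        x < ρ ξ ∧ lam m (ρ ξ) d0 = -ξ ∧ ∃ ρ', HasDerivAt ρ ρ' ξ := by
  -- `P` is the projection of the line onto `[x, y]`.
  set P : ℝ → ℝ := fun d => max x (min d y) with hP
  have hPc : Continuous P := by fun_prop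
  have hPI : ∀ d, P d ∈ Icc x y := fun d => ⟨le_max_left _ _, max_le hxy.le (min_le_right _ _)⟩
  have hPx : ∀ d, d ≤ x → P d = x := fun d hd => by
    simp only [hP, min_eq_left (hd.trans hxy.le), max_eq_left hd]
  have hPy : ∀ d, y ≤ d → P d = y := fun d hd => by
    simp only [hP, min_eq_right hd, max_eq_right hxy.le]
  have hPe : ∀ d ∈ Icc x y, P d = d := fun d hd => by
    simp only [hP, min_eq_left hd.2, max_eq_right hd.1]
  have hPm : ∀ d d', d ≤ d' → P d ≤ P d' ∧ P d' - P d ≤ d' - d := fun d d' h => by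
    refine ⟨max_le_max le_rfl (min_le_min h le_rfl), ?_⟩
    rcases le_total d x with h1 | h1 <;> rcases le_total d' y with h2 | h2 <;>
      rcases le_total d' x with h3 | h3 <;> rcases le_total d y with h4 | h4 <;>
      simp only [hP, h1, h2, h3, h4, min_eq_left, min_eq_right, max_eq_left, max_eq_right,
        hxy.le] <;> linarith
  -- The term `d - P d` continues `-λ` with slope one outside `[x, y]`, so that `ψ` is a
  -- homeomorphism of the line; projecting its inverse by `P` gives the constant continuation.
  set ψ : ℝ → ℝ := fun d => -lam m (P d) d0 + (d - P d) with hψ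
  have hψc : Continuous ψ :=
    (((continuous_lam m d0).comp hPc).neg).add (continuous_id.sub hPc)
  have hψm : StrictMono ψ := by
    intro d d' hd
    obtain ⟨h1, h2⟩ := hPm d d' hd.le
    rcases h1.eq_or_lt with h | h
    · simp only [hψ, h]
      linarith
    · have := lam_lt m (d0 := d0) (hx.trans (hPI d).1) h
      simp only [hψ]
      linarith
  have hψs : Function.Surjective ψ := by
    refine hψc.surjective ?_ ?_
    · refine tendsto_atTop_mono (fun d => ?_)
        (tendsto_atTop_add_const_right _ (-y - lam m x d0) tendsto_id)
      have := (lam_strictAntiOn m d0).antitoneOn hx (hx.trans (hPI d).1) (hPI d).1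
      have h2 := (hPI d).2
      simp only [hψ, id] at this ⊢
      linarith
    · refine tendsto_atBot_mono (fun d => ?_)
        (tendsto_atBot_add_const_right _ (-x) tendsto_id)
      have := lam_pos m (P d) d0
      have h2 := (hPI d).1
      simp only [hψ, id]
      linarith
  have hψx : ψ x = -lam m x d0 := by
    simp only [hψ, hPx x le_rfl, sub_self, add_zero]
  have hψy : ψ y = -lam m y d0 := by
    simp only [hψ, hPy y le_rfl, sub_self, add_zero]
  obtain ⟨ρ0, hρ0⟩ := hψs.hasRightInverse
  have hρm : StrictMono ρ0 := fun a b hab => by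
    rwa [← hψm.lt_iff_lt, hρ0, hρ0]
  have hρc : Continuous ρ0 := hρm.monotone.continuous_of_surjective fun d =>
    ⟨ψ d, hψm.injective (hρ0 _)⟩
  have hin : ∀ ξ ∈ Ioo (-lam m x d0) (-lam m y d0), ρ0 ξ ∈ Ioo x y := fun ξ hξ => by
    rw [← hψx, ← hψy] at hξ
    exact ⟨hψm.lt_iff_lt.1 (by rw [hρ0]; exact hξ.1), hψm.lt_iff_lt.1 (by rw [hρ0]; exact hξ.2)⟩
  refine ⟨P ∘ ρ0, hPc.comp hρc, fun ξ => hPI _, fun ξ hξ => hPx _ ?_, fun ξ hξ => hPy _ ?_,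
    fun ξ hξ => ?_⟩
  · rw [← hψm.le_iff_le, hρ0, hψx]
    exact hξ
  · rw [← hψm.le_iff_le, hρ0, hψy]
    exact hξ
  · have h0 := hin ξ hξ
    have h1 : P (ρ0 ξ) = ρ0 ξ := hPe _ (Ioo_subset_Icc_self h0)
    obtain ⟨L, hL, hd⟩ := hasDerivAt_lam m (hx.trans_lt h0.1) d0
    refine ⟨?_, ?_, (-L)⁻¹, ?_⟩
    · rw [Function.comp, h1]
      exact h0.1
    · have := hρ0 ξ
      simp only [hψ, h1, sub_self, add_zero] at this
      rw [Function.comp, h1]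
      linarith
    · have h2 : HasDerivAt ψ (-L) (ρ0 ξ) := by
        refine hd.neg.congr_of_eventuallyEq ?_
        filter_upwards [isOpen_Ioo.mem_nhds h0] with d hd
        simp [hψ, hPe d (Ioo_subset_Icc_self hd)]
      have h3 := HasDerivAt.of_local_left_inverse hρc.continuousAt h2 (neg_ne_zero.2 hL.ne)
        (.of_forall hρ0)
      refine h3.congr_of_eventuallyEq ?_
      filter_upwards [isOpen_Ioo.mem_nhds hξ] with η hη
      exact hPe _ (Ioo_subset_Icc_self (hin η hη))

/-- A bounded profile that satisfies the self-similar form `-ξ v' + (flux v)' = 0` of the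
system: `flux v - ξ v` is continuous, and off a finite set its derivative is `-v`. -/
structure IsProfile (ω : E3) (v : ℝ → State) : Prop where
  measurable : Measurable v
  bounded : ∃ C, ∀ ξ, ‖v ξ‖ ≤ C
  continuous : Continuous fun ξ => flux m ω (v ξ) - ξ • v ξ
  hasDerivAt : ∃ B : Set ℝ, B.Finite ∧
    ∀ ξ ∉ B, HasDerivAt (fun ξ => flux m ω (v ξ) - ξ • v ξ) (-v ξ) ξ

/-! ### Gluing of self-similar profiles -/

theorem hasDerivAt_const_sub_smul (a u : State) (ξ : ℝ) :
    HasDerivAt (fun ξ : ℝ => a - ξ • u) (-u) ξ := by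
  simpa using ((hasDerivAt_id ξ).smul_const u).const_sub a

theorem IsProfile.const (ω : E3) (u : State) : IsProfile m ω fun _ => u where
  measurable := measurable_const
  bounded := ⟨‖u‖, fun _ => le_rfl⟩
  continuous := by fun_prop
  hasDerivAt := ⟨∅, finite_empty, fun ξ _ => hasDerivAt_const_sub_smul _ _ _⟩

variable {m}

/-- The hypothesis is the Rankine-Hugoniot condition at speed `κ` in disguise. It keeps `flux v - ξ
v` continuous, so a jump costs only one more exceptional point. -/
theorem IsProfile.glue {v w : ℝ → State} (hv : IsProfile m ω v) (hw : IsProfile m ω w) {κ : ℝ}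
    (h : flux m ω (v κ) - κ • v κ = flux m ω (w κ) - κ • w κ) :
    IsProfile m ω fun ξ => if ξ < κ then v ξ else w ξ where
  measurable := hv.measurable.ite measurableSet_Iio hw.measurable
  bounded := by
    obtain ⟨C, hC⟩ := hv.bounded
    obtain ⟨C', hC'⟩ := hw.bounded
    refine ⟨max C C', fun ξ => ?_⟩
    split_ifs
    · exact (hC ξ).trans (le_max_left _ _)
    · exact (hC' ξ).trans (le_max_right _ _)
  continuous := by
    have e : (fun ξ => flux m ω (if ξ < κ then v ξ else w ξ) -
        ξ • (if ξ < κ then v ξ else w ξ)) =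
        fun ξ => if κ ≤ ξ then flux m ω (w ξ) - ξ • w ξ else flux m ω (v ξ) - ξ • v ξ := by
      funext ξ
      by_cases hξ : ξ < κ
      · simp only [if_pos hξ, if_neg hξ.not_ge]
      · simp only [if_neg hξ, if_pos (not_lt.1 hξ)]
    rw [e]
    refine Continuous.if_le hw.continuous hv.continuous continuous_const continuous_id ?_
    rintro ξ rfl
    exact h.symm
  hasDerivAt := by
    obtain ⟨B, hB, hd⟩ := hv.hasDerivAt
    obtain ⟨B', hB', hd'⟩ := hw.hasDerivAt
    refine ⟨insert κ (B ∪ B'), (hB.union hB').insert κ, fun ξ hξ => ?_⟩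
    simp only [mem_insert_iff, mem_union, not_or] at hξ
    rcases lt_or_gt_of_ne hξ.1 with h | h
    · rw [if_pos h]
      refine (hd ξ hξ.2.1).congr_of_eventuallyEq ?_
      filter_upwards [isOpen_Iio.mem_nhds h] with η hη
      rw [if_pos (mem_Iio.1 hη)]
    · rw [if_neg h.le.not_gt]
      refine (hd' ξ hξ.2.2).congr_of_eventuallyEq ?_
      filter_upwards [isOpen_Ioi.mem_nhds h] with η hη
      rw [if_neg (mem_Ioi.1 hη).le.not_gt]

/-- At `a` itself `v` may already have jumped, but the continuous combination still has its left
limit. This covers a contact discontinuity and a shock of equal speed. -/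
theorem IsProfile.eq_of_forall_lt {v : ℝ → State} (hv : IsProfile m ω v) {u : State} {a : ℝ}
    (h : ∀ ξ < a, v ξ = u) {ξ : ℝ} (hξ : ξ ≤ a) :
    flux m ω (v ξ) - ξ • v ξ = flux m ω u - ξ • u := by
  have h1 : EqOn (fun ξ => flux m ω (v ξ) - ξ • v ξ) (fun ξ => flux m ω u - ξ • u) (Iio a) :=
    fun ξ hξ => by simp only [h ξ hξ]
  have h2 := h1.closure hv.continuous (by fun_prop)
  rw [closure_Iio] at h2
  exact h2 hξ

variable (m)

theorem IsWave.congr {k : ℕ} {a b : ℝ} {ul ur : State} {v w : ℝ → State}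
    (h : IsWave m ω k a b ul ur v) (hvw : EqOn v w (Icc a b)) : IsWave m ω k a b ul ur w := by
  rcases h with h | h | ⟨h1, h2, h3, h4, h5⟩
  · exact Or.inl h
  · exact Or.inr (Or.inl h)
  · refine Or.inr (Or.inr ⟨h1, h2.congr hvw.symm, ?_, ?_, fun ξ hξ => ?_⟩)
    · rw [← hvw ⟨le_rfl, h1.le⟩, h3]
    · rw [← hvw ⟨h1.le, le_rfl⟩, h4]
    · obtain ⟨e1, v', e2, e3⟩ := h5 ξ hξ
      have e4 : w =ᶠ[𝓝 ξ] v := by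
        filter_upwards [isOpen_Ioo.mem_nhds hξ] with η hη
        exact (hvw (Ioo_subset_Icc_self hη)).symm
      refine ⟨by rw [← hvw (Ioo_subset_Icc_self hξ), e1], v', e2.congr_of_eventuallyEq e4,
        e3.congr_of_eventuallyEq (e4.fun_comp (flux m ω))⟩

/-- Parametrize the wave curve by `ρ` with `λ(ρ ξ) = -ξ`. There `dφ/dρ = -λ = ξ` and `df/dρ = λ² =
ξ²`, so the derivative of the flux is `ξ` times that of the state. -/
theorem exists_rarefaction (hω : ‖ω‖ = 1) {ζ : E3} (hζ1 : ‖ζ‖ = 1) (hζ : inner ℝ ζ ω = 0) (H : E3)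
    (d0 : ℝ) {x y : ℝ} (hx : 0 ≤ x) (hxy : x < y) :
    ∃ r : ℝ → State,
      IsRarefaction m ω 2 (-lam m x d0) (-lam m y d0) (waveState m ω ζ H d0 x x)
        (waveState m ω ζ H d0 x y) r ∧
      (∀ ξ < -lam m x d0, r ξ = waveState m ω ζ H d0 x x) ∧
      (∀ ξ, -lam m y d0 < ξ → r ξ = waveState m ω ζ H d0 x y) ∧ IsProfile m ω r := by
  obtain ⟨ρ, hc, hI, hl, hr, hi⟩ := exists_rarefaction_parameter m hx hxy d0
  have hW : Continuous fun d => waveState m ω ζ H d0 x d := by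
    have := continuous_waveFn m x d0
    unfold waveState
    fun_prop
  have hcont : Continuous fun ξ => waveState m ω ζ H d0 x (ρ ξ) := hW.comp hc
  have hode : ∀ ξ ∈ Ioo (-lam m x d0) (-lam m y d0), ∃ v' : State,
      HasDerivAt (fun ξ => waveState m ω ζ H d0 x (ρ ξ)) v' ξ ∧
      HasDerivAt (fun ξ => flux m ω (waveState m ω ζ H d0 x (ρ ξ))) (ξ • v') ξ := by
    intro ξ hξ
    obtain ⟨h1, h2, ρ', h3⟩ := hi ξ hξ
    have h4 : HasDerivAt (fun ξ => waveFn m x (ρ ξ) d0) (ξ * ρ') ξ := by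
      have h5 : HasDerivAt (fun d => waveFn m x d d0) (-lam m (ρ ξ) d0) (ρ ξ) := by
        refine (hasDerivAt_R m x (ρ ξ) d0).neg.congr_of_eventuallyEq ?_
        filter_upwards [isOpen_Ioi.mem_nhds h1] with d hd
        exact waveFn_of_ge m (mem_Ioi.1 hd).le d0
      rw [h2, neg_neg] at h5
      exact h5.comp ξ h3
    have h6 := hasDerivAt_f m (hx.trans_lt h1) d0
    rw [h2, neg_sq] at h6
    have h7 := h6.comp ξ h3
    refine ⟨(ρ' • ζ, (ξ * ρ') • cross ω ζ), ?_, ?_⟩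
    · exact ((h3.smul_const ζ).const_add _).prodMk ((h4.smul_const _).const_add _)
    · simp only [flux_waveState m hω hζ1 hζ H d0 x (hx.trans (hI _).1)]
      refine (((h4.smul_const _).const_add _).prodMk (h7.smul_const _)).congr_deriv ?_
      simp only [Prod.smul_mk, smul_smul]
      refine Prod.ext rfl ?_
      simp only
      congr 1
      ring
  have ha : ∀ ξ ≤ -lam m x d0, waveState m ω ζ H d0 x (ρ ξ) = waveState m ω ζ H d0 x x :=
    fun ξ hξ => by rw [hl ξ hξ]
  have hb : ∀ ξ, -lam m y d0 ≤ ξ → waveState m ω ζ H d0 x (ρ ξ) = waveState m ω ζ H d0 x y :=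
    fun ξ hξ => by rw [hr ξ hξ]
  refine ⟨fun ξ => waveState m ω ζ H d0 x (ρ ξ), ⟨neg_lt_neg (lam_lt m hx hxy),
    hcont.continuousOn, ha _ le_rfl, hb _ le_rfl, fun ξ hξ => ⟨?_, hode ξ hξ⟩⟩,
    fun ξ hξ => ha ξ hξ.le, fun ξ hξ => hb ξ hξ.le, hcont.measurable, ?_, ?_,
    {-lam m x d0, -lam m y d0}, by simp, fun ξ hξ => ?_⟩
  · simp only [eigenvalue]
    rw [slowSpeed_waveState m hω hζ1 hζ H d0 x (hx.trans (hI _).1), (hi ξ hξ).2.1, neg_neg]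
  · obtain ⟨C, hC⟩ := isCompact_Icc.exists_bound_of_continuousOn (s := Icc x y) hW.continuousOn
    exact ⟨C, fun ξ => hC _ (hI ξ)⟩
  · exact ((continuous_flux m ω).comp hcont).sub (continuous_id.smul hcont)
  · simp only [mem_insert_iff, mem_singleton_iff, not_or] at hξ
    have hconst : ∀ u : State, (fun ξ => waveState m ω ζ H d0 x (ρ ξ)) =ᶠ[𝓝 ξ] (fun _ => u) →
        HasDerivAt (fun ξ => flux m ω (waveState m ω ζ H d0 x (ρ ξ)) -
          ξ • waveState m ω ζ H d0 x (ρ ξ)) (-waveState m ω ζ H d0 x (ρ ξ)) ξ := by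
      intro u hu
      rw [hu.eq_of_nhds]
      refine (hasDerivAt_const_sub_smul (flux m ω u) u ξ).congr_of_eventuallyEq ?_
      filter_upwards [hu] with η hη
      rw [hη]
    rcases lt_or_gt_of_ne hξ.1 with h1 | h1
    · refine hconst (waveState m ω ζ H d0 x x) ?_
      filter_upwards [isOpen_Iio.mem_nhds h1] with η hη
      exact ha η (mem_Iio.1 hη).le
    · rcases lt_or_gt_of_ne hξ.2 with h2 | h2
      · obtain ⟨v', e1, e2⟩ := hode ξ ⟨h1, h2⟩
        refine (e2.sub ((hasDerivAt_id ξ).smul e1)).congr_deriv ?_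
        simp
      · refine hconst (waveState m ω ζ H d0 x y) ?_
        filter_upwards [isOpen_Ioi.mem_nhds h2] with η hη
        exact hb η (mem_Ioi.1 hη).le

/-- The sign of `y - x` decides between a rarefaction wave, no wave and a shock. The bounds on `a`
and `b` leave room for the 1-contact discontinuity on the left and the stationary one on the right.
-/
theorem exists_wave (hω : ‖ω‖ = 1) {ζ : E3} (hζ1 : ‖ζ‖ = 1) (hζ : inner ℝ ζ ω = 0) (H : E3)
    (d0 : ℝ) {x y : ℝ} (hx : 0 ≤ x) (hy : 0 ≤ y) :
    ∃ (a b : ℝ) (r : ℝ → State),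
      IsWave m ω 2 a b (waveState m ω ζ H d0 x x) (waveState m ω ζ H d0 x y) r ∧
      -Real.sqrt (fastSq m x d0) ≤ a ∧ b < 0 ∧
      (∀ ξ < a, r ξ = waveState m ω ζ H d0 x x) ∧
      (∀ ξ, b < ξ → r ξ = waveState m ω ζ H d0 x y) ∧ IsProfile m ω r := by
  have hlx : lam m x d0 ≤ Real.sqrt (fastSq m x d0) := Real.le_sqrt_of_sq_le (lam_sq_le m x d0)
  rcases lt_trichotomy x y with h | rfl | h
  · obtain ⟨r, h1, h2, h3, h4⟩ := exists_rarefaction m hω hζ1 hζ H d0 hx h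
    exact ⟨_, _, r, Or.inr (Or.inr h1), neg_le_neg hlx, neg_neg_of_pos (lam_pos m y d0), h2, h3, h4⟩
  · refine ⟨-lam m x d0, -lam m x d0, fun _ => waveState m ω ζ H d0 x x, Or.inl ⟨rfl, ?_, ?_⟩,
      neg_le_neg hlx, neg_neg_of_pos (lam_pos m x d0), fun _ _ => rfl, fun _ _ => rfl,
      IsProfile.const m ω _⟩ <;>
    simp only [eigenvalue, slowSpeed_waveState m hω hζ1 hζ H d0 x hx]
  · obtain ⟨h1, -, h3⟩ := shock_speed_bounds m hy h d0
    have hs := isLaxShock_waveState m hω hζ1 hζ H d0 hy h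
    refine ⟨_, _, fun ξ => if ξ < -(S m x y d0 / (x - y)) then waveState m ω ζ H d0 x x
      else waveState m ω ζ H d0 x y, Or.inr (Or.inl ⟨rfl, hs⟩), neg_le_neg h3,
      neg_neg_of_pos ((lam_pos m x d0).trans_le h1), fun ξ hξ => if_pos hξ,
      fun ξ hξ => if_neg hξ.le.not_gt, (IsProfile.const m ω _).glue (IsProfile.const m ω _) ?_⟩
    have hRH := hs.2.1
    rw [RankineHugoniot, smul_sub] at hRH
    rw [sub_eq_sub_iff_sub_eq_sub, ← neg_sub (flux m ω _), ← hRH, neg_sub]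

/-- The left half of the wave fan: a contact discontinuity of the first field and a wave of the
second field. -/
theorem exists_left_fan (hω : ‖ω‖ = 1) {ζ : E3} (hζ1 : ‖ζ‖ = 1) (hζ : inner ℝ ζ ω = 0)
    (uL u1 : State) {y : ℝ} (hy : 0 ≤ y)
    (h1 : u1.1 = (inner ℝ uL.1 ω : ℝ) • ω + ‖cross ω uL.1‖ • ζ)
    (h2 : u1.2 = uL.2 - fastSpeed m uL • cross ω (u1.1 - uL.1)) :
    ∃ (s a b : ℝ) (r : ℝ → State), IsContact m ω 1 s uL u1 ∧
      IsWave m ω 2 a b u1 (waveState m ω ζ u1.2 (inner ℝ uL.1 ω) ‖cross ω uL.1‖ y) r ∧ b < 0 ∧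
      (∀ ξ < s, r ξ = uL) ∧ (∀ ξ, s < ξ → ξ < a → r ξ = u1) ∧
      (∀ ξ, b < ξ → r ξ = waveState m ω ζ u1.2 (inner ℝ uL.1 ω) ‖cross ω uL.1‖ y) ∧
      IsProfile m ω r := by
  obtain ⟨a, b, r, hw, hsa, hb, hl, hr, hp⟩ :=
    exists_wave m hω hζ1 hζ u1.2 (inner ℝ uL.1 ω) (norm_nonneg (cross ω uL.1)) hy
  have hu1 : waveState m ω ζ u1.2 (inner ℝ uL.1 ω) ‖cross ω uL.1‖ ‖cross ω uL.1‖ = u1 := by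
    rw [waveState_self, ← h1]
  rw [hu1] at hw hl
  rw [← fastSpeed_eq m hω] at hsa
  have hcontact : IsContact m ω 1 (-fastSpeed m uL) uL u1 := by
    rw [isContact_one_iff m hω]
    refine ⟨rfl, ?_, ?_, ?_⟩
    · rw [h1, inner_polar hω hζ]
    · rw [h1, norm_cross_polar hω hζ1 hζ _ (norm_nonneg _)]
    · rw [h2, neg_smul, ← sub_eq_add_neg]
  have hab : a ≤ b := by
    rcases hw with ⟨-, e1, e2⟩ | ⟨e, -⟩ | h
    · rw [e1, e2]
    · exact e.le
    · exact h.1.le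
  refine ⟨-fastSpeed m uL, a, b, fun ξ => if ξ < -fastSpeed m uL then uL else r ξ, hcontact,
    hw.congr m fun ξ hξ => (if_neg (hsa.trans hξ.1).not_gt).symm, hb, fun ξ hξ => if_pos hξ,
    fun ξ h3 h4 => ?_, fun ξ h3 => ?_, (IsProfile.const m ω uL).glue hp ?_⟩
  · beta_reduce
    rw [if_neg h3.le.not_gt, hl ξ h4]
  · beta_reduce
    rw [if_neg (hsa.trans (hab.trans h3.le)).not_gt, hr ξ h3]
  · rw [hp.eq_of_forall_lt hl hsa]
    have hRH := hcontact.2.2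
    rw [RankineHugoniot, smul_sub] at hRH
    rw [sub_eq_sub_iff_sub_eq_sub, ← neg_sub (flux m ω _), ← hRH, neg_sub]

end Kerr

namespace Kerr

open Filter Topology

variable {m : Medium} {ω : E3}

/-! ### Profiles are weak solutions -/

section OneVariable

variable {E : Type*} [NormedAddCommGroup E] [NormedSpace ℝ E] [CompleteSpace E]

theorem integral_eq_zero_of_hasDerivAt_off_finite {h h' : ℝ → E} {B : Set ℝ} {M : ℝ}
    (hc : Continuous h) (hB : B.Finite) (hd : ∀ x ∉ B, HasDerivAt h (h' x) x)
    (hi : Integrable h') (h0 : ∀ x, M ≤ |x| → h x = 0) (h0' : ∀ x, M ≤ |x| → h' x = 0) :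
    ∫ x, h' x = 0 := by
  have hM : -|M| ≤ |M| := by linarith [abs_nonneg M]
  have hs : Function.support h' ⊆ Ioc (-|M|) |M| := by
    intro x hx
    have h1 : |x| < |M| := by
      by_contra! h2
      exact hx (h0' x ((le_abs_self M).trans h2))
    exact ⟨(abs_lt.1 h1).1, (abs_lt.1 h1).2.le⟩
  rw [← intervalIntegral.integral_eq_integral_of_support_subset hs,
    integral_eq_of_hasDerivAt_off_countable_of_le h h' hM hB.countable hc.continuousOn
      (fun x hx => hd x hx.2) hi.intervalIntegrable,
    h0 _ (by rw [abs_abs]; exact le_abs_self M),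
    h0 _ (by rw [abs_neg, abs_abs]; exact le_abs_self M), sub_zero]

theorem integral_Ioi_eq_neg_of_hasDerivAt_off_finite {h h' : ℝ → E} {B : Set ℝ} {M : ℝ}
    (hc : ContinuousOn h (Ici 0)) (hB : B.Finite)
    (hd : ∀ x, 0 < x → x ∉ B → HasDerivAt h (h' x) x) (hi : IntegrableOn h' (Ioi 0))
    (h0 : ∀ x, 0 < x → M ≤ x → h x = 0) (h0' : ∀ x, M ≤ x → h' x = 0) :
    ∫ x in Ioi 0, h' x = -h 0 := by
  have hM : 0 < |M| + 1 := by positivity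
  have hM' : M ≤ |M| + 1 := (le_abs_self M).trans (by linarith)
  have e : ∫ x in Ioi 0, h' x = ∫ x in Ioc 0 (|M| + 1), h' x := by
    refine setIntegral_eq_of_subset_of_forall_sdiff_eq_zero measurableSet_Ioi
      Ioc_subset_Ioi_self fun x hx => h0' x ?_
    by_contra! h
    exact hx.2 ⟨hx.1, h.le.trans hM'⟩
  rw [e, ← intervalIntegral.integral_of_le hM.le,
    integral_eq_of_hasDerivAt_off_countable_of_le h h' hM.le hB.countable
      (hc.mono Icc_subset_Ici_self) (fun x hx => hd x hx.1.1 hx.2)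
      ((intervalIntegrable_iff_integrableOn_Ioc_of_le hM.le).2 (hi.mono_set Ioc_subset_Ioi_self)),
    h0 _ hM hM', zero_sub]

end OneVariable

/-- Linear growth has to be allowed because the potential of a profile grows linearly. -/
theorem integrable_smul_of_linear_bound {c : ℝ × ℝ → ℝ} {w : ℝ × ℝ → State} {C C' : ℝ}
    (hc : Continuous c) (hs : HasCompactSupport c) (hw : Measurable w)
    (hb : ∀ z, ‖w z‖ ≤ C + C' * ‖z‖) :
    Integrable (fun z => c z • w z) ((volume.restrict (Ioi (0 : ℝ))).prod volume) := by
  have h1 : Integrable (fun z => c z * (C + C' * ‖z‖)) (volume : Measure (ℝ × ℝ)) :=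
    Continuous.integrable_of_hasCompactSupport (by fun_prop) hs.mul_right
  have h2 : (volume.restrict (Ioi (0 : ℝ))).prod (volume : Measure ℝ) =
      (volume : Measure (ℝ × ℝ)).restrict (Ioi 0 ×ˢ univ) := by
    rw [Measure.volume_eq_prod, ← Measure.prod_restrict, Measure.restrict_univ]
  rw [h2]
  refine (h1.restrict).mono (hc.measurable.smul hw).aestronglyMeasurable (.of_forall fun z => ?_)
  rw [norm_smul, norm_mul]
  gcongr
  exact (hb z).trans (le_abs_self _)

theorem IsProfile.exists_flux_bound {v : ℝ → State} (hv : IsProfile m ω v) :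
    ∃ C, ∀ ξ, ‖flux m ω (v ξ)‖ ≤ C := by
  obtain ⟨C, hC⟩ := hv.bounded
  obtain ⟨C', hC'⟩ := (isCompact_closedBall (0 : State) C).exists_bound_of_continuousOn
    (continuous_flux m ω).continuousOn
  exact ⟨C', fun ξ => hC' _ (by simpa using hC ξ)⟩

/-- The potential of a profile: its derivatives are `-v (y / t)` in `y` and `flux (v (y / t))`
in `t`. -/
noncomputable def potential (m : Medium) (ω : E3) (v : ℝ → State) (t y : ℝ) : State :=
  t • (flux m ω (v (y / t)) - (y / t) • v (y / t))

theorem IsProfile.norm_potential_le {v : ℝ → State} {C C' : ℝ}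
    (hC : ∀ ξ, ‖v ξ‖ ≤ C) (hC' : ∀ ξ, ‖flux m ω (v ξ)‖ ≤ C') (z : ℝ × ℝ) :
    ‖potential m ω v z.1 z.2‖ ≤ (C' + C) * ‖z‖ := by
  have hC0 : 0 ≤ C := (norm_nonneg _).trans (hC 0)
  have hC0' : 0 ≤ C' := (norm_nonneg _).trans (hC' 0)
  by_cases hz : z.1 = 0
  · rw [potential, hz, zero_smul, norm_zero]
    positivity
  · rw [potential, smul_sub, smul_smul, mul_div_cancel₀ _ hz]
    refine (norm_sub_le _ _).trans ?_
    rw [norm_smul, norm_smul, add_mul, mul_comm C', mul_comm C]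
    gcongr
    · exact norm_fst_le z
    · exact hC' _
    · exact norm_snd_le z
    · exact hC _

theorem IsProfile.continuous_potential {v : ℝ → State} (hv : IsProfile m ω v) (t : ℝ) :
    Continuous fun y => potential m ω v t y :=
  (hv.continuous.comp (continuous_id.div_const t)).const_smul t

theorem IsProfile.hasDerivAt_potential {v : ℝ → State} (hv : IsProfile m ω v) :
    ∃ B : Set ℝ, B.Finite ∧ ∀ t ≠ 0, ∀ y, y / t ∉ B →
      HasDerivAt (fun y => potential m ω v t y) (-v (y / t)) y ∧
      HasDerivAt (fun t => potential m ω v t y) (flux m ω (v (y / t))) t := by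
  obtain ⟨B, hB, hd⟩ := hv.hasDerivAt
  refine ⟨B, hB, fun t ht y hy => ⟨?_, ?_⟩⟩
  · have h := ((hd _ hy).scomp y ((hasDerivAt_id y).div_const t)).const_smul t
    refine h.congr_deriv ?_
    rw [smul_smul, mul_one_div_cancel ht, one_smul]
  · have h := (hasDerivAt_id t).smul
      ((hd _ hy).scomp t ((hasDerivAt_const t y).fun_div (hasDerivAt_id t) ht))
    refine h.congr_deriv ?_
    simp only [id, Function.comp, zero_mul, mul_one, zero_sub, one_smul, smul_smul, smul_neg]
    rw [show t * (-y / t ^ 2) = -(y / t) by field_simp, neg_smul, neg_neg]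
    abel

/-- The boundary values of the potential at `t = 0`. -/
theorem IsProfile.continuousOn_potential {v : ℝ → State} (hv : IsProfile m ω v)
    {uL uR : State} {a b : ℝ} (hl : ∀ ξ < a, v ξ = uL) (hr : ∀ ξ, b < ξ → v ξ = uR)
    {y : ℝ} (hy : y ≠ 0) :
    ContinuousOn (fun t => if t ≤ 0 then -(y • if y < 0 then uL else uR) else potential m ω v t y)
      (Ici 0) := by
  intro t ht
  rcases (mem_Ici.1 ht).eq_or_lt with rfl | ht
  · set u := if y < 0 then uL else uR with hu
    -- As `t` decreases to `0`, the ratio `y / t` leaves `[a, b]`; from then on the potential is `t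
    -- flux u - y u`.
    have hev : ∀ᶠ t in 𝓝[>] (0 : ℝ), v (y / t) = u := by
      rcases lt_or_gt_of_ne hy with h | h
      · rw [hu, if_pos h]
        have h1 : Tendsto (fun t => y * t⁻¹) (𝓝[>] 0) atBot :=
          tendsto_inv_nhdsGT_zero.const_mul_atTop_of_neg h
        filter_upwards [h1.eventually (eventually_lt_atBot a)] with t ht
        exact hl _ (by rwa [div_eq_mul_inv])
      · rw [hu, if_neg h.not_gt]
        have h1 : Tendsto (fun t => y * t⁻¹) (𝓝[>] 0) atTop :=
          tendsto_inv_nhdsGT_zero.const_mul_atTop h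
        filter_upwards [h1.eventually (eventually_gt_atTop b)] with t ht
        exact hr _ (by rwa [div_eq_mul_inv])
    have hc : ContinuousWithinAt (fun t : ℝ => t • flux m ω u - y • u) (Ici 0) 0 := by fun_prop
    refine hc.congr_of_eventuallyEq ?_ (by simp)
    rw [← Ioi_insert, nhdsWithin_insert]
    refine eventually_sup.2 ⟨by simp, ?_⟩
    filter_upwards [hev, self_mem_nhdsWithin] with t h1 h2
    rw [if_neg (mem_Ioi.1 h2).not_ge, potential, h1, smul_sub, smul_smul,
      mul_div_cancel₀ _ (mem_Ioi.1 h2).ne']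
  · have hc : ContinuousAt (fun t => potential m ω v t y) t :=
      continuousAt_id.smul (hv.continuous.continuousAt.comp
        (continuousAt_const.div continuousAt_id ht.ne'))
    refine (hc.congr ?_).continuousWithinAt
    filter_upwards [isOpen_Ioi.mem_nhds ht] with s hs
    rw [if_neg (mem_Ioi.1 hs).not_ge]

theorem hasDerivAt_fst_line {c : ℝ × ℝ → ℝ} (hc : Differentiable ℝ c) (t y : ℝ) :
    HasDerivAt (fun t => c (t, y)) (fderiv ℝ c (t, y) (1, 0)) t :=
  (hc (t, y)).hasFDerivAt.comp_hasDerivAt t ((hasDerivAt_id t).prodMk (hasDerivAt_const t y))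

theorem hasDerivAt_snd_line {c : ℝ × ℝ → ℝ} (hc : Differentiable ℝ c) (t y : ℝ) :
    HasDerivAt (fun y => c (t, y)) (fderiv ℝ c (t, y) (0, 1)) y :=
  (hc (t, y)).hasFDerivAt.comp_hasDerivAt y ((hasDerivAt_const y t).prodMk (hasDerivAt_id y))

theorem fderiv_fderiv_apply {φ : ℝ × ℝ → ℝ} (hφ : ContDiff ℝ (⊤ : ℕ∞) φ) (z a b : ℝ × ℝ) :
    fderiv ℝ (fun z => fderiv ℝ φ z a) z b = fderiv ℝ (fderiv ℝ φ) z b a := by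
  have h : DifferentiableAt ℝ (fderiv ℝ φ) z :=
    (hφ.fderiv_right (m := 1) (by norm_cast)).differentiable (by simp) z
  rw [fderiv_clm_apply h (differentiableAt_const a)]
  simp

theorem mixed_derivative_symm {φ : ℝ × ℝ → ℝ} (hφ : ContDiff ℝ (⊤ : ℕ∞) φ) (z a b : ℝ × ℝ) :
    fderiv ℝ (fun z => fderiv ℝ φ z a) z b = fderiv ℝ (fun z => fderiv ℝ φ z b) z a := by
  rw [fderiv_fderiv_apply hφ, fderiv_fderiv_apply hφ]
  exact (hφ.contDiffAt.isSymmSndFDerivAt (by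
    rw [minSmoothness_of_isRCLikeNormedField]
    exact WithTop.coe_le_coe.2 (le_top : (2 : ℕ∞) ≤ ⊤))) b a

/-- The sum of the integrands is the derivative of `φ(0, y) y u₀(y)`, with `u₀` the initial datum.
The factor `y` makes this product continuous across the jump. -/
theorem integral_initial (uL uR : State) {φ : ℝ × ℝ → ℝ} (hφ : ContDiff ℝ (⊤ : ℕ∞) φ)
    {M : ℝ} (hM : ∀ z, M ≤ ‖z‖ → φ z = 0 ∧ fderiv ℝ φ z = 0) :
    (∫ y : ℝ, fderiv ℝ φ (0, y) (0, 1) • (y • if y < 0 then uL else uR)) +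
      ∫ y : ℝ, φ (0, y) • (if y < 0 then uL else uR) = 0 := by
  have hd : Differentiable ℝ φ := hφ.differentiable (by simp)
  have hc1 : Continuous fun y : ℝ => φ (0, y) := hφ.continuous.comp (by fun_prop)
  have hc2 : Continuous fun y : ℝ => fderiv ℝ φ (0, y) (0, 1) :=
    ((hφ.continuous_fderiv (by simp)).comp (by fun_prop : Continuous fun y : ℝ => ((0 : ℝ), y))).clm_apply
      continuous_const
  have hz : ∀ y : ℝ, M ≤ |y| → φ (0, y) = 0 ∧ fderiv ℝ φ (0, y) (0, 1) = 0 := fun y hy => by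
    have := hM (0, y) (hy.trans (norm_snd_le ((0 : ℝ), y)))
    exact ⟨this.1, by rw [this.2]; rfl⟩
  have hcs1 : HasCompactSupport fun y : ℝ => φ (0, y) :=
    .of_support_subset_isCompact (isCompact_Icc (a := -M) (b := M)) fun y hy => by
      by_contra h
      refine hy (hz y ?_).1
      by_contra! h'
      exact h (abs_le.1 h'.le)
  have hcs2 : HasCompactSupport fun y : ℝ => fderiv ℝ φ (0, y) (0, 1) :=
    .of_support_subset_isCompact (isCompact_Icc (a := -M) (b := M)) fun y hy => by
      by_contra h
      refine hy (hz y ?_).2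
      by_contra! h'
      exact h (abs_le.1 h'.le)
  have hm : Measurable fun y : ℝ => if y < 0 then uL else uR :=
    measurable_const.ite measurableSet_Iio measurable_const
  have hbound : ∀ y : ℝ, ‖if y < 0 then uL else uR‖ ≤ ‖uL‖ + ‖uR‖ := fun y => by
    split_ifs
    · linarith [norm_nonneg uR]
    · linarith [norm_nonneg uL]
  have hi : ∀ c : ℝ → ℝ, Continuous c → HasCompactSupport c →
      Integrable fun y : ℝ => c y • (if y < 0 then uL else uR) := fun c hc hcs =>
    (hc.integrable_of_hasCompactSupport hcs : Integrable c).smul_bdd (‖uL‖ + ‖uR‖)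
      hm.aestronglyMeasurable (.of_forall hbound)
  have hi1 := hi _ hc1 hcs1
  have hi2 : Integrable fun y : ℝ => fderiv ℝ φ (0, y) (0, 1) • (y • if y < 0 then uL else uR) := by
    refine (hi _ (hc2.mul continuous_id) hcs2.mul_right).congr (.of_forall fun y => ?_)
    simp only [smul_smul, Pi.mul_apply, id]
  rw [← integral_add hi2 hi1]
  have hcont : Continuous fun y : ℝ => y • if y < 0 then uL else uR := by
    have e : (fun y : ℝ => y • if y < 0 then uL else uR) =
        fun y => if 0 ≤ y then y • uR else y • uL := by
      funext y
      by_cases h : y < 0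
      · rw [if_pos h, if_neg h.not_ge]
      · rw [if_neg h, if_pos (not_lt.1 h)]
    rw [e]
    refine Continuous.if_le (by fun_prop) (by fun_prop) continuous_const continuous_id ?_
    rintro y rfl
    simp
  refine integral_eq_zero_of_hasDerivAt_off_finite (M := M) (B := {0})
    (h := fun y : ℝ => φ (0, y) • (y • if y < 0 then uL else uR))
    (hc1.smul hcont) (finite_singleton 0) (fun y hy => ?_) (hi2.add hi1)
    (fun y hy => by rw [(hz y hy).1, zero_smul])
    (fun y hy => by rw [(hz y hy).1, (hz y hy).2, zero_smul, zero_smul, add_zero])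
  have h1 : HasDerivAt (fun y : ℝ => y • if y < 0 then uL else uR) (if y < 0 then uL else uR) y := by
    rcases lt_or_gt_of_ne hy with h | h
    · rw [if_pos h]
      have h2 : HasDerivAt (fun y : ℝ => y • uL) uL y := by
        simpa using (hasDerivAt_id y).smul_const uL
      refine h2.congr_of_eventuallyEq ?_
      filter_upwards [isOpen_Iio.mem_nhds h] with s hs
      rw [if_pos (mem_Iio.1 hs)]
    · rw [if_neg h.le.not_gt]
      have h2 : HasDerivAt (fun y : ℝ => y • uR) uR y := by
        simpa using (hasDerivAt_id y).smul_const uR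
      refine h2.congr_of_eventuallyEq ?_
      filter_upwards [isOpen_Ioi.mem_nhds h] with s hs
      rw [if_neg (mem_Ioi.1 hs).le.not_gt]
  refine ((hasDerivAt_snd_line hd 0 y).fun_smul h1).congr_deriv ?_
  rw [add_comm]

/-- Let `Φ` be the potential, so that `v = -∂_y Φ` and `flux v = ∂_t Φ`. Integration by parts in `y`
turns `∂_t φ v` into `∂_y ∂_t φ Φ`; integration by parts in `t` turns `∂_y φ flux v` into the
opposite term, up to a boundary integral at `t = 0`. There `Φ = -y u₀`, and `integral_initial`
cancels the rest. -/
theorem IsProfile.isWeakRiemannSolution {v : ℝ → State} (hv : IsProfile m ω v)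
    {uL uR : State} {a b : ℝ} (hl : ∀ ξ < a, v ξ = uL) (hr : ∀ ξ, b < ξ → v ξ = uR) :
    IsWeakRiemannSolution m ω uL uR v := by
  obtain ⟨C, hC⟩ := hv.bounded
  obtain ⟨C', hC'⟩ := hv.exists_flux_bound
  have hdiv : Measurable fun z : ℝ × ℝ => z.2 / z.1 := measurable_snd.div measurable_fst
  have hvm : Measurable fun z : ℝ × ℝ => v (z.2 / z.1) := hv.measurable.comp hdiv
  have hFm : Measurable fun z : ℝ × ℝ => flux m ω (v (z.2 / z.1)) :=
    (continuous_flux m ω).measurable.comp hvm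
  have hΦm : Measurable fun z : ℝ × ℝ => potential m ω v z.1 z.2 :=
    measurable_fst.smul (hFm.sub (hdiv.smul hvm))
  refine ⟨memLp_top_of_bound hvm.aestronglyMeasurable C (.of_forall fun z => hC _), ?_⟩
  intro φ hφ hφc
  have hprod : (volume : Measure (ℝ × ℝ)).restrict (Ioi 0 ×ˢ univ) =
      (volume.restrict (Ioi (0 : ℝ))).prod (volume : Measure ℝ) := by
    rw [Measure.volume_eq_prod, ← Measure.prod_restrict, Measure.restrict_univ]
  have hφ' : ∀ a : ℝ × ℝ, ContDiff ℝ (⊤ : ℕ∞) fun z => fderiv ℝ φ z a := fun a =>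
    (hφ.fderiv_right (by simp)).clm_apply contDiff_const
  have hcs : ∀ a : ℝ × ℝ, HasCompactSupport fun z => fderiv ℝ φ z a := fun a =>
    hφc.fderiv_apply ℝ a
  set φt : ℝ × ℝ → ℝ := fun z => fderiv ℝ φ z (1, 0) with hφt
  set φy : ℝ × ℝ → ℝ := fun z => fderiv ℝ φ z (0, 1) with hφy
  set ψ : ℝ × ℝ → ℝ := fun z => fderiv ℝ φt z (0, 1) with hψ
  have hψ' : ∀ z, ψ z = fderiv ℝ φy z (1, 0) := fun z => mixed_derivative_symm hφ z _ _
  have hφtd : Differentiable ℝ φt := (hφ' _).differentiable (by simp)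
  have hφyd : Differentiable ℝ φy := (hφ' _).differentiable (by simp)
  have hψc : Continuous ψ :=
    (((hφ' (1, 0)).fderiv_right (m := 0) (by simp)).clm_apply contDiff_const).continuous
  obtain ⟨M, hM⟩ : ∃ M : ℝ, ∀ z, M ≤ ‖z‖ → φ z = 0 ∧ fderiv ℝ φ z = 0 ∧ ψ z = 0 := by
    obtain ⟨M, hM⟩ := hφc.isCompact.isBounded.subset_ball 0
    refine ⟨M, fun z hz => ?_⟩
    have h1 : z ∉ tsupport φ := fun h => by
      have := hM h
      rw [mem_ball_zero_iff] at this
      linarith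
    have h2 : z ∉ tsupport (fderiv ℝ φ) := fun h => h1 (tsupport_fderiv_subset ℝ h)
    have h3 : z ∉ tsupport φt := fun h => h1 (tsupport_fderiv_apply_subset ℝ (1, 0) h)
    have h4 : z ∉ tsupport ψ := fun h => h3 (tsupport_fderiv_apply_subset ℝ (0, 1) h)
    exact ⟨image_eq_zero_of_notMem_tsupport h1, image_eq_zero_of_notMem_tsupport h2,
      image_eq_zero_of_notMem_tsupport h4⟩
  have hMt : ∀ z, M ≤ ‖z‖ → φt z = 0 := fun z hz => by simp [hφt, (hM z hz).2.1]
  have hMy : ∀ z, M ≤ ‖z‖ → φy z = 0 := fun z hz => by simp [hφy, (hM z hz).2.1]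
  have hiA : Integrable (fun z : ℝ × ℝ => φt z • v (z.2 / z.1))
      ((volume.restrict (Ioi (0 : ℝ))).prod volume) :=
    integrable_smul_of_linear_bound (C' := 0) (hφ' _).continuous (hcs _) hvm
      fun z => by simpa using hC _
  have hiB : Integrable (fun z : ℝ × ℝ => φy z • flux m ω (v (z.2 / z.1)))
      ((volume.restrict (Ioi (0 : ℝ))).prod volume) :=
    integrable_smul_of_linear_bound (C' := 0) (hφ' _).continuous (hcs _) hFm
      fun z => by simpa using hC' _
  have hiK : Integrable (fun z : ℝ × ℝ => ψ z • potential m ω v z.1 z.2)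
      ((volume.restrict (Ioi (0 : ℝ))).prod volume) :=
    integrable_smul_of_linear_bound (C := 0) hψc ((hcs (1, 0)).fderiv_apply ℝ (0, 1)) hΦm
      fun z => by simpa using IsProfile.norm_potential_le hC hC' z
  obtain ⟨B, hB, hd⟩ := hv.hasDerivAt_potential
  have hAK : ∫ z, φt z • v (z.2 / z.1) ∂((volume.restrict (Ioi (0 : ℝ))).prod volume) =
      ∫ z, ψ z • potential m ω v z.1 z.2 ∂((volume.restrict (Ioi (0 : ℝ))).prod volume) := by
    rw [integral_prod _ hiA, integral_prod _ hiK]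
    refine integral_congr_ae ?_
    filter_upwards [hiA.prod_right_ae, hiK.prod_right_ae, ae_restrict_mem measurableSet_Ioi]
      with t h1 h2 ht
    have ht0 : t ≠ 0 := (mem_Ioi.1 ht).ne'
    rw [← sub_eq_zero, ← neg_eq_zero, neg_sub, ← integral_sub h2 h1]
    have hz : ∀ y : ℝ, M ≤ |y| → M ≤ ‖(t, y)‖ := fun y hy => hy.trans (norm_snd_le (t, y))
    refine integral_eq_zero_of_hasDerivAt_off_finite (M := M)
      (h := fun y => φt (t, y) • potential m ω v t y) (B := (fun b => t * b) '' B)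
      (((hφ' (1, 0)).continuous.comp (by fun_prop)).smul (hv.continuous_potential t))
      (hB.image _) (fun y hy => ?_) (h2.sub h1) (fun y hy => by rw [hMt _ (hz y hy), zero_smul])
      (fun y hy => by
        rw [hMt _ (hz y hy), (hM _ (hz y hy)).2.2, zero_smul, zero_smul, sub_zero])
    have hy' : y / t ∉ B := fun h => hy ⟨y / t, h, mul_div_cancel₀ y ht0⟩
    refine ((hasDerivAt_snd_line hφtd t y).fun_smul (hd t ht0 y hy').1).congr_deriv ?_
    rw [smul_neg, neg_add_eq_sub]
  have hiKB : Integrable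
      (fun z : ℝ × ℝ => ψ z • potential m ω v z.1 z.2 + φy z • flux m ω (v (z.2 / z.1)))
      ((volume.restrict (Ioi (0 : ℝ))).prod volume) := hiK.add hiB
  have hBK : ∫ z, (ψ z • potential m ω v z.1 z.2 + φy z • flux m ω (v (z.2 / z.1)))
        ∂((volume.restrict (Ioi (0 : ℝ))).prod volume) =
      ∫ y : ℝ, φy (0, y) • (y • if y < 0 then uL else uR) := by
    rw [integral_prod_symm _ hiKB]
    refine integral_congr_ae ?_
    have hne : ∀ᵐ y : ℝ, y ≠ 0 := by
      simp [ae_iff]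
    filter_upwards [hiKB.prod_left_ae, hne] with y h1 hy
    have hz : ∀ t : ℝ, M ≤ t → M ≤ ‖(t, y)‖ := fun t ht =>
      ht.trans ((le_abs_self t).trans (norm_fst_le (t, y)))
    have h := integral_Ioi_eq_neg_of_hasDerivAt_off_finite (M := M)
      (h := fun t => φy (t, y) •
        if t ≤ 0 then -(y • if y < 0 then uL else uR) else potential m ω v t y)
      (h' := fun t => ψ (t, y) • potential m ω v t y + φy (t, y) • flux m ω (v (y / t)))
      -- For fixed `y ≠ 0`, these are the times at which the line crosses the exceptional rays.
      (B := (fun b => y / b) '' B)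
      (((hφ' (0, 1)).continuous.comp
        (by fun_prop : Continuous fun t : ℝ => (t, y))).continuousOn.smul
        (hv.continuousOn_potential hl hr hy)) (hB.image _) (fun t ht htB => ?_) h1
      (fun t _ ht => by rw [hMy _ (hz t ht), zero_smul])
      (fun t ht => by
        rw [hMy _ (hz t ht), (hM _ (hz t ht)).2.2, zero_smul, zero_smul, add_zero])
    · refine h.trans ?_
      beta_reduce
      rw [if_pos le_rfl, smul_neg, neg_neg]
    · have ht' : y / t ∉ B := fun h => htB ⟨y / t, h, div_div_cancel₀ hy⟩
      have h2 := (hasDerivAt_fst_line hφyd t y).fun_smul (hd t ht.ne' y ht').2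
      rw [← hψ', add_comm] at h2
      refine h2.congr_of_eventuallyEq ?_
      filter_upwards [isOpen_Ioi.mem_nhds ht] with s hs
      rw [if_neg (mem_Ioi.1 hs).not_ge]
  rw [hprod, integral_add hiA hiB, hAK, ← integral_add hiK hiB, hBK]
  exact integral_initial uL uR hφ fun z hz => ⟨(hM z hz).1, (hM z hz).2.1⟩

end Kerr

namespace Kerr

variable (m : Medium) {ω : E3}

/-! ### Reflection `(D, H) ↦ (D, -H)`, `y ↦ -y` -/

/-- The reflection of states, under which the `k`-th field becomes the `(7 - k)`-th one. -/
noncomputable def refl : State →L[ℝ] State :=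
  (ContinuousLinearMap.id ℝ E3).prodMap (-ContinuousLinearMap.id ℝ E3)

theorem refl_apply (u : State) : refl u = (u.1, -u.2) := rfl

theorem refl_refl (u : State) : refl (refl u) = u := by
  simp [refl_apply]

theorem refl_injective : Function.Injective refl := Function.LeftInverse.injective refl_refl

theorem norm_refl (u : State) : ‖refl u‖ = ‖u‖ := by
  simp [refl_apply, Prod.norm_def]

/-- The `D`-flux is odd in `H` and the `H`-flux depends on `D` only. The resulting sign is absorbed
by `y ↦ -y`, so the system is invariant. -/
theorem flux_refl (ω : E3) (u : State) : flux m ω (refl u) = -refl (flux m ω u) := by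
  simp only [flux, refl_apply, cross_neg, Prod.neg_mk, neg_neg]

theorem fastSpeed_refl (u : State) : fastSpeed m (refl u) = fastSpeed m u := rfl

theorem slowSpeed_refl (ω : E3) (u : State) : slowSpeed m ω (refl u) = slowSpeed m ω u := rfl

variable {m}

theorem RankineHugoniot.reflect {σ : ℝ} {ul ur : State} (h : RankineHugoniot m ω σ ul ur) :
    RankineHugoniot m ω (-σ) (refl ur) (refl ul) := by
  have h1 := congrArg refl h
  rw [map_smul, map_sub, map_sub] at h1
  rw [RankineHugoniot, flux_refl, flux_refl, neg_smul, ← smul_neg, neg_sub, h1]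
  abel

theorem IsContact.reflect_one {s : ℝ} {ul ur : State} (h : IsContact m ω 1 s ul ur) :
    IsContact m ω 6 (-s) (refl ur) (refl ul) := by
  obtain ⟨h1, h2, h3⟩ := h
  simp only [eigenvalue] at h1 h2
  refine ⟨?_, ?_, h3.reflect⟩
  · simp only [eigenvalue, fastSpeed_refl]
    linarith
  · simp only [eigenvalue, fastSpeed_refl]
    linarith

theorem IsContact.reflect_six {s : ℝ} {ul ur : State} (h : IsContact m ω 6 s ul ur) :
    IsContact m ω 1 (-s) (refl ur) (refl ul) := by
  obtain ⟨h1, h2, h3⟩ := h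
  simp only [eigenvalue] at h1 h2
  refine ⟨?_, ?_, h3.reflect⟩
  · simp only [eigenvalue, fastSpeed_refl]
    linarith
  · simp only [eigenvalue, fastSpeed_refl]
    linarith

theorem IsLaxShock.reflect {k k' : ℕ} (hk : k = 2 ∧ k' = 5 ∨ k = 5 ∧ k' = 2) {σ : ℝ}
    {ul ur : State} (h : IsLaxShock m ω k σ ul ur) :
    IsLaxShock m ω k' (-σ) (refl ur) (refl ul) := by
  obtain ⟨h1, h2, h3, h4, h5, h6⟩ := h
  refine ⟨fun h => h1 (refl_injective h).symm, h2.reflect, ?_⟩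
  rcases hk with ⟨rfl, rfl⟩ | ⟨rfl, rfl⟩ <;>
  · simp only [eigenvalue, fastSpeed_refl, slowSpeed_refl, Nat.add_one_sub_one,
      Nat.reduceAdd] at h3 h4 h5 h6 ⊢
    refine ⟨?_, ?_, ?_, ?_⟩ <;> linarith

theorem IsWave.reflect {k k' : ℕ} (hk : k = 2 ∧ k' = 5 ∨ k = 5 ∧ k' = 2) {a b : ℝ}
    {ul ur : State} {v : ℝ → State} (h : IsWave m ω k a b ul ur v) :
    IsWave m ω k' (-b) (-a) (refl ur) (refl ul) fun ξ => refl (v (-ξ)) := by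
  have heig : ∀ u, eigenvalue m ω k' (refl u) = -eigenvalue m ω k u := by
    rcases hk with ⟨rfl, rfl⟩ | ⟨rfl, rfl⟩ <;> intro u <;>
      simp only [eigenvalue, slowSpeed_refl, neg_neg]
  rcases h with ⟨h1, h2, h3⟩ | ⟨rfl, h⟩ | ⟨h1, h2, h3, h4, h5⟩
  · refine Or.inl ⟨by rw [h1], ?_, ?_⟩
    · rw [heig, h3, h1]
    · rw [heig, h2, h1]
  · exact Or.inr (Or.inl ⟨rfl, h.reflect hk⟩)
  · refine Or.inr (Or.inr ⟨neg_lt_neg h1, ?_, ?_, ?_, ?_⟩)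
    · exact refl.continuous.comp_continuousOn
        (h2.comp continuousOn_neg fun ξ hξ => ⟨le_neg.1 hξ.2, neg_le.1 hξ.1⟩)
    · simp only [neg_neg, h4]
    · simp only [neg_neg, h3]
    · intro ξ hξ
      have hξ' : -ξ ∈ Ioo a b := ⟨lt_neg.1 hξ.2, neg_lt.1 hξ.1⟩
      obtain ⟨e1, v', e2, e3⟩ := h5 (-ξ) hξ'
      refine ⟨by rw [heig, e1, neg_neg], -refl v', ?_, ?_⟩
      · refine (refl.hasFDerivAt.comp_hasDerivAt ξ
          (e2.scomp ξ (hasDerivAt_neg ξ))).congr_deriv ?_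
        rw [neg_one_smul, map_neg]
      · simp only [flux_refl]
        refine (refl.hasFDerivAt.comp_hasDerivAt ξ
          (e3.scomp ξ (hasDerivAt_neg ξ))).fun_neg.congr_deriv ?_
        rw [neg_one_smul, map_neg, map_smul, neg_neg, neg_smul, smul_neg]

theorem IsProfile.reflect {v : ℝ → State} (hv : IsProfile m ω v) :
    IsProfile m ω fun ξ => refl (v (-ξ)) := by
  have e : (fun ξ => flux m ω (refl (v (-ξ))) - ξ • refl (v (-ξ))) =
      fun ξ => -refl (flux m ω (v (-ξ)) - (-ξ) • v (-ξ)) := by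
    funext ξ
    rw [flux_refl, map_sub, map_smul, neg_smul]
    abel
  refine ⟨refl.continuous.measurable.comp (hv.measurable.comp measurable_neg), ?_, ?_, ?_⟩
  · obtain ⟨C, hC⟩ := hv.bounded
    exact ⟨C, fun ξ => (norm_refl _).trans_le (hC _)⟩
  · rw [e]
    exact (refl.continuous.comp (hv.continuous.comp continuous_neg)).neg
  · obtain ⟨B, hB, hd⟩ := hv.hasDerivAt
    refine ⟨Neg.neg '' B, hB.image _, fun ξ hξ => ?_⟩
    have hξ' : -ξ ∉ B := fun h => hξ ⟨-ξ, h, neg_neg ξ⟩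
    rw [e]
    refine (refl.hasFDerivAt.comp_hasDerivAt ξ
      ((hd _ hξ').scomp ξ (hasDerivAt_neg ξ))).fun_neg.congr_deriv ?_
    rw [smul_neg, neg_one_smul, neg_neg]

variable (m)

/-! ### Analysis of wave fans -/

/-- The contact discontinuity preserves `d` and `d₀`, so the slow wave behind it can be parametrized
by the data of `uL`. -/
theorem exists_isSlowWave_of_isContact (hω : ‖ω‖ = 1) {s a b : ℝ} {uL u1 us : State}
    {v : ℝ → State} (hc : IsContact m ω 1 s uL u1) (hw : IsWave m ω 2 a b u1 us v) :
    ∃ ζ y, s = -fastSpeed m uL ∧ u1.2 = uL.2 - fastSpeed m uL • cross ω (u1.1 - uL.1) ∧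
      IsSlowWave m ω ζ u1.2 (inner ℝ uL.1 ω) ‖cross ω uL.1‖ y a b u1 us v := by
  obtain ⟨h1, h2, h3, h4⟩ := (isContact_one_iff m hω s uL u1).1 hc
  obtain ⟨ζ, y, h⟩ := isSlowWave_of_isWave m hω hw
  rw [h2, h3] at h
  refine ⟨ζ, y, h1, ?_, h⟩
  rw [h1, neg_smul, ← sub_eq_add_neg] at h4
  exact h4

/-- The normal form of a wave fan. -/
structure IsFanForm (ω : E3) (uL uR u1 us uss u2 : State) (v : ℝ → State) (ζ1 ζ2 : E3)
    (y1 y2 a2 b2 a5 b5 : ℝ) : Prop where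
  left : IsSlowWave m ω ζ1 u1.2 (inner ℝ uL.1 ω) ‖cross ω uL.1‖ y1 a2 b2 u1 us v
  right : IsSlowWave m ω ζ2 (-u2.2) (inner ℝ uR.1 ω) ‖cross ω uR.1‖ y2 (-b5) (-a5)
    (refl u2) (refl uss) (fun ξ => refl (v (-ξ)))
  H_left : u1.2 = uL.2 - fastSpeed m uL • cross ω (u1.1 - uL.1)
  H_right : -u2.2 = -uR.2 - fastSpeed m uR • cross ω (u2.1 - uR.1)
  flux_eq : flux m ω us = flux m ω uss
  v_left : ∀ ξ < -fastSpeed m uL, v ξ = uL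
  v_one : ∀ ξ ∈ Ioo (-fastSpeed m uL) a2, v ξ = u1
  v_star : ∀ ξ ∈ Ioo b2 0, v ξ = us
  v_star_star : ∀ ξ ∈ Ioo 0 a5, v ξ = uss
  v_two : ∀ ξ ∈ Ioo b5 (fastSpeed m uR), v ξ = u2
  v_right : ∀ ξ, fastSpeed m uR < ξ → v ξ = uR

/-- The right half of the fan is analysed as the left half of the reflected fan. -/
theorem exists_isFanForm (hω : ‖ω‖ = 1) {uL uR u1 us uss u2 : State} {v : ℝ → State}
    (h : IsWaveFan m ω uL uR u1 us uss u2 v) :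
    ∃ ζ1 ζ2 y1 y2 a2 b2 a5 b5, IsFanForm m ω uL uR u1 us uss u2 v ζ1 ζ2 y1 y2 a2 b2 a5 b5 := by
  obtain ⟨s1, a2, b2, a5, b5, s6, c1, w2, c3, w5, c6, e1, e2, e3, e4, e5, e6⟩ := h
  obtain ⟨ζ1, y1, hs1, hH1, hw1⟩ := exists_isSlowWave_of_isContact m hω c1 w2
  obtain ⟨ζ2, y2, hs6, hH2, hw2⟩ := exists_isSlowWave_of_isContact m hω c6.reflect_six
    (w5.reflect (Or.inr ⟨rfl, rfl⟩))
  rw [fastSpeed_refl, neg_inj] at hs6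
  subst hs1 hs6
  refine ⟨ζ1, ζ2, y1, y2, a2, b2, a5, b5, hw1, hw2, hH1, hH2, ?_, e1, e2, e3, e4, e5, e6⟩
  have h := c3.2.2
  rw [RankineHugoniot, zero_smul] at h
  exact (sub_eq_zero.1 h.symm).symm

theorem fastSpeed_mul_norm (hω : ‖ω‖ = 1) (u : State) :
    fastSpeed m u * ‖cross ω u.1‖ = waveFn m ‖cross ω u.1‖ 0 (inner ℝ u.1 ω) := by
  rw [waveFn_zero m (norm_nonneg _), fastSpeed_eq m hω]

/-- The Rankine-Hugoniot conditions of the stationary contact discontinuity. -/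
theorem flux_eq_iff (hω : ‖ω‖ = 1) (uL uR : State) {ζ1 ζ2 H1 H2 : E3} {y1 y2 : ℝ}
    (n1 : ‖ζ1‖ = 1) (o1 : inner ℝ ζ1 ω = 0) (n2 : ‖ζ2‖ = 1) (o2 : inner ℝ ζ2 ω = 0)
    (hy1 : 0 ≤ y1) (hy2 : 0 ≤ y2)
    (hH1 : H1 = uL.2 - fastSpeed m uL •
      cross ω ((inner ℝ uL.1 ω : ℝ) • ω + ‖cross ω uL.1‖ • ζ1 - uL.1))
    (hH2 : H2 = -uR.2 - fastSpeed m uR •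
      cross ω ((inner ℝ uR.1 ω : ℝ) • ω + ‖cross ω uR.1‖ • ζ2 - uR.1)) :
    flux m ω (waveState m ω ζ1 H1 (inner ℝ uL.1 ω) ‖cross ω uL.1‖ y1) =
      flux m ω (refl (waveState m ω ζ2 H2 (inner ℝ uR.1 ω) ‖cross ω uR.1‖ y2)) ↔
    f m y1 (inner ℝ uL.1 ω) • cross ω ζ1 = f m y2 (inner ℝ uR.1 ω) • cross ω ζ2 ∧
    vecV m ω uL uR =
      (waveFn m ‖cross ω uL.1‖ 0 (inner ℝ uL.1 ω) -
        waveFn m ‖cross ω uL.1‖ y1 (inner ℝ uL.1 ω)) • ζ1 +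
      (waveFn m ‖cross ω uR.1‖ 0 (inner ℝ uR.1 ω) -
        waveFn m ‖cross ω uR.1‖ y2 (inner ℝ uR.1 ω)) • ζ2 := by
  have key : ∀ (u : State) (ζ : E3), inner ℝ ζ ω = 0 →
      cross ω (cross ω ((inner ℝ u.1 ω : ℝ) • ω + ‖cross ω u.1‖ • ζ - u.1)) =
        u.1 - (inner ℝ u.1 ω : ℝ) • ω - ‖cross ω u.1‖ • ζ := by
    intro u ζ hζ
    rw [cross_cross_of_orthogonal hω]
    · abel
    · rw [inner_sub_left, inner_polar hω hζ, sub_self]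
  have e1 : cross ω H1 = cross ω uL.2 - fastSpeed m uL •
      (uL.1 - (inner ℝ uL.1 ω : ℝ) • ω - ‖cross ω uL.1‖ • ζ1) := by
    rw [hH1, cross_sub, cross_smul, key uL ζ1 o1]
  have e2 : cross ω H2 = -cross ω uR.2 - fastSpeed m uR •
      (uR.1 - (inner ℝ uR.1 ω : ℝ) • ω - ‖cross ω uR.1‖ • ζ2) := by
    rw [hH2, cross_sub, cross_neg, cross_smul, key uR ζ2 o2]
  have e3 : vecV m ω uL uR = cross ω uR.2 - cross ω uL.2 +
      fastSpeed m uR • (uR.1 - (inner ℝ uR.1 ω : ℝ) • ω) +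
      fastSpeed m uL • (uL.1 - (inner ℝ uL.1 ω : ℝ) • ω) := by
    simp only [vecV, eigenvalue]
    rw [neg_smul, sub_neg_eq_add, cross_add, cross_smul, cross_smul, cross_sub, cross_sub,
      cross_add, cross_smul, cross_smul, cross_cross hω, cross_cross hω]
    module
  rw [flux_refl, flux_waveState m hω n1 o1 _ _ _ hy1, flux_waveState m hω n2 o2 _ _ _ hy2,
    refl_apply, Prod.neg_mk, neg_neg, Prod.mk.injEq, and_comm]
  refine and_congr_right fun _ => ?_
  -- The terms fast speed times `d`, left by the contact discontinuities, are the values `φ(d, 0)`.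
  rw [e1, e2, e3, ← fastSpeed_mul_norm m hω, ← fastSpeed_mul_norm m hω]
  constructor <;> intro h
  · rw [← sub_eq_zero] at h ⊢
    rw [← h]
    module
  · rw [← sub_eq_zero] at h ⊢
    rw [← h]
    module

variable {m}

theorem IsFanForm.fst_one {uL uR u1 us uss u2 : State} {v : ℝ → State}
    {ζ1 ζ2 : E3} {y1 y2 a2 b2 a5 b5 : ℝ}
    (h : IsFanForm m ω uL uR u1 us uss u2 v ζ1 ζ2 y1 y2 a2 b2 a5 b5) :
    u1.1 = (inner ℝ uL.1 ω : ℝ) • ω + ‖cross ω uL.1‖ • ζ1 :=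
  congrArg Prod.fst h.left.left_eq

theorem IsFanForm.fst_two {uL uR u1 us uss u2 : State} {v : ℝ → State}
    {ζ1 ζ2 : E3} {y1 y2 a2 b2 a5 b5 : ℝ}
    (h : IsFanForm m ω uL uR u1 us uss u2 v ζ1 ζ2 y1 y2 a2 b2 a5 b5) :
    u2.1 = (inner ℝ uR.1 ω : ℝ) • ω + ‖cross ω uR.1‖ • ζ2 :=
  congrArg Prod.fst h.right.left_eq

theorem IsFanForm.vecV_eq (hω : ‖ω‖ = 1) {uL uR u1 us uss u2 : State} {v : ℝ → State}
    {ζ1 ζ2 : E3} {y1 y2 a2 b2 a5 b5 : ℝ}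
    (h : IsFanForm m ω uL uR u1 us uss u2 v ζ1 ζ2 y1 y2 a2 b2 a5 b5) :
    f m y1 (inner ℝ uL.1 ω) • cross ω ζ1 = f m y2 (inner ℝ uR.1 ω) • cross ω ζ2 ∧
    vecV m ω uL uR =
      (waveFn m ‖cross ω uL.1‖ 0 (inner ℝ uL.1 ω) -
        waveFn m ‖cross ω uL.1‖ y1 (inner ℝ uL.1 ω)) • ζ1 +
      (waveFn m ‖cross ω uR.1‖ 0 (inner ℝ uR.1 ω) -
        waveFn m ‖cross ω uR.1‖ y2 (inner ℝ uR.1 ω)) • ζ2 := by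
  rw [← flux_eq_iff m hω uL uR h.left.norm_eq h.left.orthogonal h.right.norm_eq
    h.right.orthogonal h.left.y_nonneg h.right.y_nonneg (h.fst_one ▸ h.H_left) (h.fst_two ▸ h.H_right),
    ← h.left.right_eq, ← h.right.right_eq, refl_refl]
  exact h.flux_eq

theorem f_nonneg {d : ℝ} (hd : 0 ≤ d) (d0 : ℝ) : 0 ≤ f m d d0 := by
  rw [← f_zero m d0]
  exact (f_strictMono m d0).monotone hd

theorem f_pos {d : ℝ} (hd : 0 < d) (d0 : ℝ) : 0 < f m d d0 := by
  rw [← f_zero m d0]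
  exact f_strictMono m d0 hd

theorem f_eq_zero_iff {d d0 : ℝ} : f m d d0 = 0 ↔ d = 0 := by
  refine ⟨fun h => (f_strictMono m d0).injective ?_, fun h => by rw [h, f_zero]⟩
  simp only [h, f_zero]

theorem waveFn_zero_sub_pos {x y : ℝ} (hx : 0 ≤ x) (hy : 0 < y) (d0 : ℝ) :
    0 < waveFn m x 0 d0 - waveFn m x y d0 :=
  sub_pos.2 (waveFn_strictAntiOn m hx d0 self_mem_Ici hy.le hy)

/-- Norms in the first flux equation give `f(y1) = f(y2)`, so both moduli vanish or neither does. In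
the second case dividing by `f > 0` gives a common direction; `V` is then a positive multiple of it,
and taking norms yields the scalar equation. -/
theorem IsFanForm.dichotomy (hω : ‖ω‖ = 1) {uL uR u1 us uss u2 : State} {v : ℝ → State}
    {ζ1 ζ2 : E3} {y1 y2 a2 b2 a5 b5 : ℝ}
    (h : IsFanForm m ω uL uR u1 us uss u2 v ζ1 ζ2 y1 y2 a2 b2 a5 b5) :
    (y1 = 0 ∧ y2 = 0 ∧ vecV m ω uL uR = 0) ∨
    (vecV m ω uL uR ≠ 0 ∧ y2 = G m (inner ℝ uL.1 ω) (inner ℝ uR.1 ω) y1 ∧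
      ζ1 = ‖vecV m ω uL uR‖⁻¹ • vecV m ω uL uR ∧ ζ2 = ‖vecV m ω uL uR‖⁻¹ • vecV m ω uL uR ∧
      waveFn m ‖cross ω uL.1‖ y1 (inner ℝ uL.1 ω) +
        waveFn m ‖cross ω uR.1‖ (G m (inner ℝ uL.1 ω) (inner ℝ uR.1 ω) y1) (inner ℝ uR.1 ω) =
      waveFn m ‖cross ω uL.1‖ 0 (inner ℝ uL.1 ω) +
        waveFn m ‖cross ω uR.1‖ 0 (inner ℝ uR.1 ω) - ‖vecV m ω uL uR‖) := by
  obtain ⟨hf, hV⟩ := h.vecV_eq hω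
  have nK1 : ‖cross ω ζ1‖ = 1 := by
    rw [norm_cross_of_orthogonal hω h.left.orthogonal, h.left.norm_eq]
  have nK2 : ‖cross ω ζ2‖ = 1 := by
    rw [norm_cross_of_orthogonal hω h.right.orthogonal, h.right.norm_eq]
  have hfn : f m y1 (inner ℝ uL.1 ω) = f m y2 (inner ℝ uR.1 ω) := by
    have := congrArg norm hf
    rwa [norm_smul, norm_smul, nK1, nK2, mul_one, mul_one,
      Real.norm_of_nonneg (f_nonneg h.left.y_nonneg _),
      Real.norm_of_nonneg (f_nonneg h.right.y_nonneg _)] at this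
  have hG := eq_G_of_f_eq m hfn
  rcases h.left.y_nonneg.eq_or_lt with h0 | h0
  · left
    rw [← h0, f_zero] at hfn
    have h2 := f_eq_zero_iff.1 hfn.symm
    refine ⟨h0.symm, h2, ?_⟩
    rw [hV, ← h0, h2]
    simp
  · right
    have hf0 := f_pos (m := m) h0 (inner ℝ uL.1 ω)
    have hy2 : 0 < y2 := by
      refine h.right.y_nonneg.lt_of_ne fun h2 => ?_
      rw [← h2, f_zero] at hfn
      linarith
    have hζ : ζ1 = ζ2 := by
      refine eq_of_inner_eq_of_cross_eq hω (by rw [h.left.orthogonal, h.right.orthogonal]) ?_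
      rw [← hfn] at hf
      exact smul_right_injective _ hf0.ne' hf
    have p1 := waveFn_zero_sub_pos (m := m) h.left.x_nonneg h0 (inner ℝ uL.1 ω)
    have p2 := waveFn_zero_sub_pos (m := m) h.right.x_nonneg hy2 (inner ℝ uR.1 ω)
    rw [← hζ, ← add_smul] at hV
    have hn : ‖vecV m ω uL uR‖ = _ := congrArg norm hV
    rw [norm_smul, h.left.norm_eq, mul_one, Real.norm_of_nonneg (add_pos p1 p2).le] at hn
    have hn0 : ‖vecV m ω uL uR‖ ≠ 0 := hn ▸ (add_pos p1 p2).ne'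
    have hζV : ζ1 = ‖vecV m ω uL uR‖⁻¹ • vecV m ω uL uR := by
      rw [eq_inv_smul_iff₀ hn0]
      conv_rhs => rw [hV]
      rw [hn]
    refine ⟨norm_ne_zero_iff.1 hn0, hG, hζV, hζ ▸ hζV, ?_⟩
    rw [← hG, hn]
    ring

/-- Inside a rarefaction wave the modulus is recovered from `ξ`, because `λ(·, d0)` is injective on
`[0, ∞)`. -/
theorem IsSlowWave.ext {ζ H : E3} {d0 x y a b a' b' : ℝ} {ul ur ul' ur' : State}
    {v w : ℝ → State} (hv : IsSlowWave m ω ζ H d0 x y a b ul ur v)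
    (hw : IsSlowWave m ω ζ H d0 x y a' b' ul' ur' w) :
    a = a' ∧ b = b' ∧ ul = ul' ∧ ur = ur' ∧ ∀ ξ ∈ Ioo a b, v ξ = w ξ := by
  have ha : a = a' := by rw [hv.left_speed, hw.left_speed]
  have hb : b = b' := by rw [hv.right_speed, hw.right_speed]
  refine ⟨ha, hb, by rw [hv.left_eq, hw.left_eq], by rw [hv.right_eq, hw.right_eq],
    fun ξ hξ => ?_⟩
  obtain ⟨ρ, h1, h2, h3⟩ := hv.inner_eq ξ hξ
  obtain ⟨ρ', h1', h2', h3'⟩ := hw.inner_eq ξ (ha ▸ hb ▸ hξ)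
  rw [h3, h3', lam_injOn m h1 h1' (h2.trans h2'.symm)]

/-- A wave ending at zero tangential displacement moves with the fast speed of its left state; for
`x = 0` this is the coincidence of the two speeds. -/
theorem rightSpeed_zero {x : ℝ} (hx : 0 ≤ x) (d0 : ℝ) :
    rightSpeed m d0 x 0 = -Real.sqrt (fastSq m x d0) := by
  rcases hx.eq_or_lt with rfl | h
  · rw [rightSpeed, if_neg (lt_irrefl _), ← lam_sq_zero, Real.sqrt_sq (lam_pos m 0 d0).le]
  · rw [rightSpeed, if_pos h, ← waveFn_of_le m hx, waveFn_zero m hx, sub_zero,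
      mul_div_cancel_right₀ _ h.ne']

/-- The contribution of `ζ` to `H` from the contact discontinuity cancels against that of the slow
wave, so the end state is independent of `ζ`. -/
theorem waveState_zero (hω : ‖ω‖ = 1) (u : State) {ζ H : E3}
    (hH : H = u.2 - fastSpeed m u •
      cross ω ((inner ℝ u.1 ω : ℝ) • ω + ‖cross ω u.1‖ • ζ - u.1)) :
    waveState m ω ζ H (inner ℝ u.1 ω) ‖cross ω u.1‖ 0 =
      ((inner ℝ u.1 ω : ℝ) • ω, u.2 + fastSpeed m u • cross ω u.1) := by
  rw [waveState, ← fastSpeed_mul_norm m hω, hH, cross_sub, cross_polar]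
  refine Prod.ext ?_ ?_
  · simp
  · simp only
    module

end Kerr

namespace Kerr

variable {m : Medium} {ω : E3}

/-! ### The solution of the Riemann problem -/

/-- The wave fan with given tangential displacements of the inner states. -/
theorem exists_fan (hω : ‖ω‖ = 1) (uL uR : State) {ζ : E3} (n : ‖ζ‖ = 1) (o : inner ℝ ζ ω = 0)
    {y1 y2 : ℝ} (hy1 : 0 ≤ y1) (hy2 : 0 ≤ y2)
    (hf : f m y1 (inner ℝ uL.1 ω) = f m y2 (inner ℝ uR.1 ω))
    (hV : vecV m ω uL uR =
      (waveFn m ‖cross ω uL.1‖ 0 (inner ℝ uL.1 ω) -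
        waveFn m ‖cross ω uL.1‖ y1 (inner ℝ uL.1 ω)) • ζ +
      (waveFn m ‖cross ω uR.1‖ 0 (inner ℝ uR.1 ω) -
        waveFn m ‖cross ω uR.1‖ y2 (inner ℝ uR.1 ω)) • ζ) :
    ∃ v, IsSuperposition m ω uL uR v ∧ IsWeakRiemannSolution m ω uL uR v := by
  set D1 : E3 := (inner ℝ uL.1 ω : ℝ) • ω + ‖cross ω uL.1‖ • ζ
  set D2 : E3 := (inner ℝ uR.1 ω : ℝ) • ω + ‖cross ω uR.1‖ • ζ
  set u1 : State := (D1, uL.2 - fastSpeed m uL • cross ω (D1 - uL.1))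
  set u2 : State := (D2, -uR.2 - fastSpeed m uR • cross ω (D2 - uR.1))
  obtain ⟨s1, a2, b2, r, c1, w2, hb2, e1, e2, e3, p⟩ :=
    exists_left_fan m hω n o uL u1 hy1 rfl rfl
  obtain ⟨s6, b5, a5, r', c6, w5, ha5, e1', e2', e3', p'⟩ :=
    exists_left_fan m hω n o (refl uR) u2 hy2 rfl rfl
  have hflux := (flux_eq_iff m hω uL uR n o n o hy1 hy2 (H1 := u1.2) (H2 := u2.2) rfl rfl).2
    ⟨by rw [hf], hV⟩
  set us := waveState m ω ζ u1.2 (inner ℝ uL.1 ω) ‖cross ω uL.1‖ y1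
  set uss := waveState m ω ζ u2.2 (inner ℝ uR.1 ω) ‖cross ω uR.1‖ y2
  have e3'' : ∀ ξ, a5 < ξ → r' ξ = uss := e3'
  have w5' : IsWave m ω 5 (-a5) (-b5) (refl uss) (refl u2) fun ξ => refl (r' (-ξ)) :=
    w5.reflect (Or.inl ⟨rfl, rfl⟩)
  have c6' := c6.reflect_one
  rw [refl_refl] at c6'
  have hs1 : s1 < 0 := by
    rw [c1.1]
    exact neg_neg_of_pos (fastSpeed_pos m hω uL)
  have hs6 : s6 < 0 := by
    rw [c6.1]
    exact neg_neg_of_pos (fastSpeed_pos m hω (refl uR))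
  have hba : b5 ≤ a5 := by
    rcases w5 with ⟨-, h1, h2⟩ | ⟨h1, -⟩ | h
    · rw [h1, h2]
    · exact h1.le
    · exact h.1.le
  have hab : a2 ≤ b2 := by
    rcases w2 with ⟨-, h1, h2⟩ | ⟨h1, -⟩ | h
    · rw [h1, h2]
    · exact h1.le
    · exact h.1.le
  set v : ℝ → State := fun ξ => if ξ < 0 then r ξ else refl (r' (-ξ)) with hv
  have vneg : ∀ ξ < 0, v ξ = r ξ := fun ξ hξ => if_pos hξ
  have vpos : ∀ ξ, 0 ≤ ξ → v ξ = refl (r' (-ξ)) := fun ξ hξ => if_neg hξ.not_gt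
  have hl : ∀ ξ < s1, v ξ = uL := fun ξ hξ => by rw [vneg ξ (hξ.trans hs1), e1 ξ hξ]
  have hr : ∀ ξ, -s6 < ξ → v ξ = uR := fun ξ hξ => by
    rw [vpos ξ (by linarith), e1' (-ξ) (by linarith), refl_refl]
  refine ⟨v, ⟨u1, us, refl uss, refl u2, s1, a2, b2, -a5, -b5, -s6, c1, ?_, ?_, ?_, c6', hl, ?_, ?_,
    ?_, ?_, hr⟩, (p.glue p'.reflect ?_ : IsProfile m ω v).isWeakRiemannSolution hl hr⟩
  · exact w2.congr m fun ξ hξ => (vneg ξ (hξ.2.trans_lt hb2)).symm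
  · refine ⟨rfl, rfl, ?_⟩
    rw [RankineHugoniot, zero_smul, hflux, sub_self]
  · exact w5'.congr m fun ξ hξ => (vpos ξ (by linarith [hξ.1])).symm
  · intro ξ hξ
    rw [vneg ξ (by linarith [hξ.2]), e2 ξ hξ.1 hξ.2]
  · intro ξ hξ
    rw [vneg ξ hξ.2, e3 ξ hξ.1]
  · intro ξ hξ
    rw [vpos ξ hξ.1.le, e3'' (-ξ) (by linarith [hξ.2])]
  · intro ξ hξ
    rw [vpos ξ (by linarith [hξ.1]), e2' (-ξ) (by linarith [hξ.2]) (by linarith [hξ.1])]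
  -- At `ξ = 0` the term `ξ v` drops out, and the gluing condition is equality of the fluxes.
  · rw [neg_zero, e3 0 hb2, e3'' 0 ha5, hflux]
    simp

theorem inner_vecV (ω : E3) (uL uR : State) : inner ℝ (vecV m ω uL uR) ω = 0 :=
  inner_cross_self _ _

theorem exists_solution (hω : ‖ω‖ = 1) (uL uR : State) :
    ∃ v, IsSuperposition m ω uL uR v ∧ IsWeakRiemannSolution m ω uL uR v := by
  -- The target value is `φ(d₁, 0) + φ(d₂, 0) - ‖V‖`, which treats both cases at once; for `V = 0`
  -- any direction `ζ` will do.
  obtain ⟨y, hy, h⟩ := exists_scalar_solution m (norm_nonneg (cross ω uL.1))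
    (norm_nonneg (cross ω uR.1)) (inner ℝ uL.1 ω) (inner ℝ uR.1 ω)
    (sub_le_self _ (norm_nonneg (vecV m ω uL uR)))
  have hG : 0 ≤ G m (inner ℝ uL.1 ω) (inner ℝ uR.1 ω) y := by
    rw [← G_zero m (inner ℝ uL.1 ω) (inner ℝ uR.1 ω)]
    exact (G_strictMono m _ _).monotone hy
  obtain ⟨ζ, n, o, hζ⟩ : ∃ ζ : E3, ‖ζ‖ = 1 ∧ inner ℝ ζ ω = 0 ∧
      vecV m ω uL uR = ‖vecV m ω uL uR‖ • ζ := by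
    by_cases hV : vecV m ω uL uR = 0
    · obtain ⟨ζ, n, o⟩ := exists_unit_orthogonal ω
      exact ⟨ζ, n, o, by rw [hV, norm_zero, zero_smul]⟩
    · refine ⟨‖vecV m ω uL uR‖⁻¹ • vecV m ω uL uR, norm_smul_inv_norm hV, ?_, ?_⟩
      · rw [inner_smul_left, inner_vecV, mul_zero]
      · rw [smul_inv_smul₀ (norm_ne_zero_iff.2 hV)]
  refine exists_fan hω uL uR n o hy hG (f_G m _ _ y).symm ?_
  rw [← add_smul]
  refine hζ.trans ?_
  congr 1
  linarith

/-- The profile of the wave fan in the case `V = 0`. -/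
theorem IsWaveFan.eq_of_vecV_eq_zero (hω : ‖ω‖ = 1) {uL uR u1 us uss u2 : State}
    {v : ℝ → State} (h : IsWaveFan m ω uL uR u1 us uss u2 v) (hV : vecV m ω uL uR = 0) :
    us = ((inner ℝ uL.1 ω : ℝ) • ω, uL.2 + fastSpeed m uL • cross ω uL.1) ∧
    uss = ((inner ℝ uR.1 ω : ℝ) • ω, uR.2 - fastSpeed m uR • cross ω uR.1) ∧
    (∀ ξ, ξ < -fastSpeed m uL → v ξ = uL) ∧ (∀ ξ, -fastSpeed m uL < ξ → ξ < 0 → v ξ = us) ∧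
    (∀ ξ, 0 < ξ → ξ < fastSpeed m uR → v ξ = uss) ∧ (∀ ξ, fastSpeed m uR < ξ → v ξ = uR) := by
  obtain ⟨ζ1, ζ2, y1, y2, a2, b2, a5, b5, h⟩ := exists_isFanForm m hω h
  rcases h.dichotomy hω with ⟨rfl, rfl, -⟩ | h'
  · have hus := h.left.right_eq.trans (waveState_zero hω uL (h.fst_one ▸ h.H_left))
    have huss := h.right.right_eq.trans
      (waveState_zero hω (refl uR) (h.fst_two ▸ h.H_right :))
    -- The 2-wave ends at the speed of the 1-contact discontinuity, so `u1` occupies no interval;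
    -- likewise `u2` on the right.
    have hb2 : b2 = -fastSpeed m uL := by
      rw [h.left.right_speed, rightSpeed_zero (norm_nonneg _), fastSpeed_eq m hω]
    have ha5 : a5 = fastSpeed m uR := by
      rw [← neg_inj, h.right.right_speed, rightSpeed_zero (norm_nonneg _), fastSpeed_eq m hω]
    refine ⟨hus, ?_, h.v_left, fun ξ h1 h2 => h.v_star ξ ⟨hb2 ▸ h1, h2⟩,
      fun ξ h1 h2 => h.v_star_star ξ ⟨h1, ha5 ▸ h2⟩, h.v_right⟩
    rw [← refl_refl uss, huss]
    refine Prod.ext rfl ?_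
    simp only [refl_apply]
    abel
  · exact absurd hV h'.1

theorem fan_parameter_unique (hω : ‖ω‖ = 1) {uL uR u1 us uss u2 u1' us' uss' u2' : State}
    {v w : ℝ → State} {ζ1 ζ2 ζ1' ζ2' : E3} {y1 y2 a2 b2 a5 b5 y1' y2' a2' b2' a5' b5' : ℝ}
    (h : IsFanForm m ω uL uR u1 us uss u2 v ζ1 ζ2 y1 y2 a2 b2 a5 b5)
    (h' : IsFanForm m ω uL uR u1' us' uss' u2' w ζ1' ζ2' y1' y2' a2' b2' a5' b5')
    (hV : vecV m ω uL uR ≠ 0) : ζ1 = ζ1' ∧ ζ2 = ζ2' ∧ y1 = y1' ∧ y2 = y2' := by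
  rcases h.dichotomy hω with ⟨-, -, e⟩ | ⟨-, e1, e2, e3, e4⟩
  · exact absurd e hV
  rcases h'.dichotomy hω with ⟨-, -, e⟩ | ⟨-, e1', e2', e3', e4'⟩
  · exact absurd e hV
  have hy : y1 = y1' := (scalar_strictAntiOn m h.left.x_nonneg h.right.x_nonneg _ _).injOn
    h.left.y_nonneg h'.left.y_nonneg (e4.trans e4'.symm)
  exact ⟨e2.trans e2'.symm, e3.trans e3'.symm, hy, by rw [e1, e1', hy]⟩

/-- If `V = 0`, two fans may differ in `u1` and `u2`, but not in the profile between the remaining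
speeds. If `V ≠ 0`, all parameters agree. The exceptional points are among the wave speeds. -/
theorem superposition_unique (hω : ‖ω‖ = 1) {uL uR : State} {v w : ℝ → State}
    (hv : IsSuperposition m ω uL uR v) (hw : IsSuperposition m ω uL uR w) :
    {ξ : ℝ | v ξ ≠ w ξ}.Finite := by
  obtain ⟨u1, us, uss, u2, hv⟩ := hv
  obtain ⟨u1', us', uss', u2', hw⟩ := hw
  by_cases hV : vecV m ω uL uR = 0
  · obtain ⟨e1, e2, e3, e4, e5, e6⟩ := hv.eq_of_vecV_eq_zero hω hV
    obtain ⟨e1', e2', e3', e4', e5', e6'⟩ := hw.eq_of_vecV_eq_zero hω hV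
    refine (toFinite {-fastSpeed m uL, 0, fastSpeed m uR}).subset fun ξ hξ => ?_
    contrapose! hξ
    simp only [mem_insert_iff, mem_singleton_iff, not_or] at hξ
    simp only [mem_ofPred_eq, not_not]
    rcases lt_or_gt_of_ne hξ.1 with h1 | h1
    · rw [e3 ξ h1, e3' ξ h1]
    rcases lt_or_gt_of_ne hξ.2.1 with h2 | h2
    · rw [e4 ξ h1 h2, e4' ξ h1 h2, e1, e1']
    rcases lt_or_gt_of_ne hξ.2.2 with h3 | h3
    · rw [e5 ξ h2 h3, e5' ξ h2 h3, e2, e2']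
    · rw [e6 ξ h3, e6' ξ h3]
  · obtain ⟨ζ1, ζ2, y1, y2, a2, b2, a5, b5, hv⟩ := exists_isFanForm m hω hv
    obtain ⟨ζ1', ζ2', y1', y2', a2', b2', a5', b5', hw⟩ := exists_isFanForm m hω hw
    obtain ⟨rfl, rfl, rfl, rfl⟩ := fan_parameter_unique hω hv hw hV
    have hu1 : u1.2 = u1'.2 := by
      rw [hv.H_left, hw.H_left, hv.fst_one, hw.fst_one]
    have hu2 : -u2.2 = -u2'.2 := by
      rw [hv.H_right, hw.H_right, hv.fst_two, hw.fst_two]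
    obtain ⟨rfl, rfl, rfl, rfl, hin⟩ := hv.left.ext (hu1 ▸ hw.left)
    obtain ⟨hb5, ha5, hu2', huss, hin'⟩ := hv.right.ext (hu2 ▸ hw.right)
    rw [neg_inj] at hb5 ha5
    have hu2' := refl_injective hu2'
    have huss := refl_injective huss
    subst hb5 ha5 hu2' huss
    refine (toFinite {-fastSpeed m uL, a2, b2, 0, a5, b5, fastSpeed m uR}).subset fun ξ hξ => ?_
    contrapose! hξ
    simp only [mem_insert_iff, mem_singleton_iff, not_or] at hξ
    simp only [mem_ofPred_eq, not_not]
    obtain ⟨n1, n2, n3, n4, n5, n6, n7⟩ := hξ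
    rcases lt_or_gt_of_ne n1 with h1 | h1
    · rw [hv.v_left ξ h1, hw.v_left ξ h1]
    rcases lt_or_gt_of_ne n2 with h2 | h2
    · rw [hv.v_one ξ ⟨h1, h2⟩, hw.v_one ξ ⟨h1, h2⟩]
    rcases lt_or_gt_of_ne n3 with h3 | h3
    · exact hin ξ ⟨h2, h3⟩
    rcases lt_or_gt_of_ne n4 with h4 | h4
    · rw [hv.v_star ξ ⟨h3, h4⟩, hw.v_star ξ ⟨h3, h4⟩]
    rcases lt_or_gt_of_ne n5 with h5 | h5
    · rw [hv.v_star_star ξ ⟨h4, h5⟩, hw.v_star_star ξ ⟨h4, h5⟩]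
    rcases lt_or_gt_of_ne n6 with h6 | h6
    · have := hin' (-ξ) ⟨neg_lt_neg h6, neg_lt_neg h5⟩
      simp only [neg_neg] at this
      exact refl_injective this
    rcases lt_or_gt_of_ne n7 with h7 | h7
    · rw [hv.v_two ξ ⟨h6, h7⟩, hw.v_two ξ ⟨h6, h7⟩]
    · rw [hv.v_right ξ h7, hw.v_right ξ h7]

/-- The jump from `u` to the state with vanishing tangential displacement. -/
theorem isLaxShock_zero (hω : ‖ω‖ = 1) {u : State} (hu : cross ω u.1 ≠ 0) :
    IsLaxShock m ω 2 (-fastSpeed m u) u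
      ((inner ℝ u.1 ω : ℝ) • ω, u.2 + fastSpeed m u • cross ω u.1) := by
  obtain ⟨ζ, n, o, hD⟩ := exists_polar hω u.1
  have hx : 0 < ‖cross ω u.1‖ := norm_pos_iff.2 hu
  have h := isLaxShock_waveState m hω n o u.2 (inner ℝ u.1 ω) le_rfl hx
  rw [waveState_self, ← hD, waveState_zero hω u (by rw [← hD]; simp [cross_zero]),
    ← waveFn_of_le m hx.le, ← fastSpeed_mul_norm m hω, sub_zero,
    mul_div_cancel_right₀ _ hx.ne'] at h
  exact h

theorem eq_of_cross_eq_zero (hω : ‖ω‖ = 1) {u : State} (hu : cross ω u.1 = 0) (s : ℝ) :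
    u = ((inner ℝ u.1 ω : ℝ) • ω, u.2 + s • cross ω u.1) := by
  obtain ⟨ζ, n, o, hD⟩ := exists_polar hω u.1
  rw [hu, norm_zero, zero_smul, add_zero] at hD
  exact Prod.ext hD (by simp [hu])

theorem isContact_three_of_vecV_eq_zero (hω : ‖ω‖ = 1) {uL uR : State}
    (hV : vecV m ω uL uR = 0) :
    IsContact m ω 3 0 ((inner ℝ uL.1 ω : ℝ) • ω, uL.2 + fastSpeed m uL • cross ω uL.1)
      ((inner ℝ uR.1 ω : ℝ) • ω, uR.2 - fastSpeed m uR • cross ω uR.1) := by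
  obtain ⟨ζ, n, o⟩ := exists_unit_orthogonal ω
  have h := (flux_eq_iff m hω uL uR n o n o le_rfl le_rfl rfl rfl).2
    ⟨by rw [f_zero, f_zero], by rw [hV]; simp⟩
  rw [waveState_zero hω uL rfl] at h
  have h2 := waveState_zero (m := m) hω (refl uR) (ζ := ζ) rfl
  have e : (((inner ℝ uR.1 ω : ℝ) • ω, uR.2 - fastSpeed m uR • cross ω uR.1) : State) =
      refl ((inner ℝ (refl uR).1 ω : ℝ) • ω,
        (refl uR).2 + fastSpeed m (refl uR) • cross ω (refl uR).1) := by
    refine Prod.ext rfl ?_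
    simp only [refl_apply]
    abel
  refine ⟨rfl, rfl, ?_⟩
  rw [RankineHugoniot, zero_smul, eq_comm, sub_eq_zero, h, e]
  exact congrArg (fun u => flux m ω (refl u)) h2.symm

/-- `|V|` is the inner product of `V` with `ζ`; moving `ω ×` onto `ζ` by skew-symmetry expresses it
through `h₂ - h₁`. This matches the scalar equation of the theorem with that of
`IsFanForm.dichotomy`. -/
theorem norm_vecV_eq (hω : ‖ω‖ = 1) (uL uR : State) (hV : vecV m ω uL uR ≠ 0) :
    let ζ := ‖vecV m ω uL uR‖⁻¹ • vecV m ω uL uR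
    (inner ℝ uR.2 (cross ω ζ) + fastSpeed m uR * (‖cross ω uR.1‖ - inner ℝ uR.1 ζ)) -
      (inner ℝ uL.2 (cross ω ζ) + -fastSpeed m uL * (‖cross ω uL.1‖ - inner ℝ uL.1 ζ)) =
    waveFn m ‖cross ω uL.1‖ 0 (inner ℝ uL.1 ω) + waveFn m ‖cross ω uR.1‖ 0 (inner ℝ uR.1 ω) -
      ‖vecV m ω uL uR‖ := by
  intro ζ
  have hζ : inner ℝ ζ ω = 0 := by rw [inner_smul_left, inner_vecV, mul_zero]
  have h1 : ‖vecV m ω uL uR‖ = inner ℝ (vecV m ω uL uR) ζ := by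
    rw [inner_smul_right, real_inner_self_eq_norm_sq, sq,
      inv_mul_cancel_left₀ (norm_ne_zero_iff.2 hV)]
  rw [h1, ← fastSpeed_mul_norm m hω, ← fastSpeed_mul_norm m hω]
  simp only [vecV, eigenvalue]
  rw [inner_cross_left, inner_sub_left, inner_cross_cross hω, hζ, inner_sub_left, inner_sub_left,
    inner_smul_left, inner_smul_left]
  simp only [conj_trivial]
  ring

end Kerr

/-! ### Assembly of the two cases -/

theorem mainTheorem1 (m : Kerr.Medium) (ω : Kerr.E3) (hω : ‖ω‖ = 1) (uL uR : Kerr.State) :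
    -- existence
    (∃ v : ℝ → Kerr.State,
      Kerr.IsSuperposition m ω uL uR v ∧ Kerr.IsWeakRiemannSolution m ω uL uR v) ∧
    -- uniqueness, up to the values at finitely many velocities
    (∀ v w : ℝ → Kerr.State,
      Kerr.IsSuperposition m ω uL uR v → Kerr.IsSuperposition m ω uL uR w →
      {ξ : ℝ | v ξ ≠ w ξ}.Finite) ∧
    -- the case `V = 0`
    (Kerr.vecV m ω uL uR = 0 →
      let σm : ℝ := Kerr.eigenvalue m ω 1 uL
      let σp : ℝ := Kerr.eigenvalue m ω 6 uR
      let us : Kerr.State := (inner ℝ uL.1 ω • ω, uL.2 - σm • Kerr.cross ω uL.1)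
      let uss : Kerr.State := (inner ℝ uR.1 ω • ω, uR.2 - σp • Kerr.cross ω uR.1)
      (Kerr.cross ω uL.1 = 0 → uL = us) ∧
      (Kerr.cross ω uL.1 ≠ 0 → Kerr.IsLaxShock m ω 2 σm uL us) ∧
      Kerr.IsContact m ω 3 0 us uss ∧
      (Kerr.cross ω uR.1 ≠ 0 → Kerr.IsLaxShock m ω 5 σp uss uR) ∧
      (Kerr.cross ω uR.1 = 0 → uss = uR) ∧
      ∀ (u1 us' uss' u2 : Kerr.State) (v : ℝ → Kerr.State),
        Kerr.IsWaveFan m ω uL uR u1 us' uss' u2 v →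
        us' = us ∧ uss' = uss ∧
        (∀ ξ : ℝ, ξ < σm → v ξ = uL) ∧
        (∀ ξ : ℝ, σm < ξ → ξ < 0 → v ξ = us) ∧
        (∀ ξ : ℝ, 0 < ξ → ξ < σp → v ξ = uss) ∧
        (∀ ξ : ℝ, σp < ξ → v ξ = uR)) ∧
    -- the case `V ≠ 0`
    (Kerr.vecV m ω uL uR ≠ 0 →
      let σm : ℝ := Kerr.eigenvalue m ω 1 uL
      let σp : ℝ := Kerr.eigenvalue m ω 6 uR
      let ζ : Kerr.E3 := ‖Kerr.vecV m ω uL uR‖⁻¹ • Kerr.vecV m ω uL uR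
      let d0m : ℝ := inner ℝ uL.1 ω
      let d0p : ℝ := inner ℝ uR.1 ω
      let d1 : ℝ := ‖Kerr.cross ω (Kerr.cross ω uL.1)‖
      let d2 : ℝ := ‖Kerr.cross ω (Kerr.cross ω uR.1)‖
      let h1 : ℝ := inner ℝ uL.2 (Kerr.cross ω ζ) + σm * (d1 - inner ℝ uL.1 ζ)
      let h2 : ℝ := inner ℝ uR.2 (Kerr.cross ω ζ) + σp * (d2 - inner ℝ uR.1 ζ)
      let D1 : Kerr.E3 := d0m • ω + d1 • ζ
      let D2 : Kerr.E3 := d0p • ω + d2 • ζ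
      let H1 : Kerr.E3 := uL.2 + σm • Kerr.cross ω (D1 - uL.1)
      let H2 : Kerr.E3 := uR.2 - σp • Kerr.cross ω (uR.1 - D2)
      ∃ ds dss : ℝ, 0 < ds ∧ 0 < dss ∧
        -- `(ds, dss)` is the only solution in `ℝ₊²` of the two by two system
        (Kerr.f m ds d0m = Kerr.f m dss d0p ∧
          h1 + Kerr.waveFn m d1 ds d0m = h2 - Kerr.waveFn m d2 dss d0p) ∧
        (∀ x y : ℝ, 0 ≤ x → 0 ≤ y → Kerr.f m x d0m = Kerr.f m y d0p →
          h1 + Kerr.waveFn m d1 x d0m = h2 - Kerr.waveFn m d2 y d0p → x = ds ∧ y = dss) ∧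
        -- `ds` is the only solution in `ℝ₊` of the scalar equation, and `dss = G ds`
        dss = Kerr.G m d0m d0p ds ∧
        h2 - h1 = Kerr.waveFn m d1 ds d0m + Kerr.waveFn m d2 (Kerr.G m d0m d0p ds) d0p ∧
        (∀ x : ℝ, 0 ≤ x →
          h2 - h1 = Kerr.waveFn m d1 x d0m + Kerr.waveFn m d2 (Kerr.G m d0m d0p x) d0p →
          x = ds) ∧
        -- the intermediate states
        ∀ (u1 us uss u2 : Kerr.State) (v : ℝ → Kerr.State),
          Kerr.IsWaveFan m ω uL uR u1 us uss u2 v →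
          u1 = (D1, H1) ∧
          us = (d0m • ω + ds • ζ, H1 + Kerr.waveFn m d1 ds d0m • Kerr.cross ω ζ) ∧
          uss = (d0p • ω + dss • ζ, H2 - Kerr.waveFn m d2 dss d0p • Kerr.cross ω ζ) ∧
          u2 = (D2, H2)) := by
  refine ⟨Kerr.exists_solution hω uL uR, fun v w => Kerr.superposition_unique hω, ?_, ?_⟩
  · intro hV σm σp us uss
    have hus : us = ((inner ℝ uL.1 ω : ℝ) • ω,
        uL.2 + Kerr.fastSpeed m uL • Kerr.cross ω uL.1) := by
      simp only [us, σm, Kerr.eigenvalue, neg_smul, sub_neg_eq_add]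
    have huss : Kerr.refl uss = ((inner ℝ (Kerr.refl uR).1 ω : ℝ) • ω, (Kerr.refl uR).2 +
        Kerr.fastSpeed m (Kerr.refl uR) • Kerr.cross ω (Kerr.refl uR).1) := by
      refine Prod.ext rfl ?_
      simp only [uss, σp, Kerr.eigenvalue, Kerr.refl_apply]
      abel
    refine ⟨fun h => ?_, fun h => ?_, ?_, fun h => ?_, fun h => ?_, ?_⟩
    · rw [hus]
      exact Kerr.eq_of_cross_eq_zero hω h _
    · rw [hus]
      exact Kerr.isLaxShock_zero hω h
    · rw [hus]
      exact Kerr.isContact_three_of_vecV_eq_zero hω hV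
    · have h1 : Kerr.IsLaxShock m ω 2 _ (Kerr.refl uR) _ := Kerr.isLaxShock_zero hω h
      rw [← huss] at h1
      have h2 := h1.reflect (Or.inl ⟨rfl, rfl⟩)
      rw [Kerr.refl_refl, Kerr.refl_refl, neg_neg] at h2
      exact h2
    · refine Kerr.refl_injective (huss.trans (Kerr.eq_of_cross_eq_zero hω ?_ _).symm)
      exact h
    · intro u1 us' uss' u2 v hfan
      obtain ⟨e1, e2, e3, e4, e5, e6⟩ := hfan.eq_of_vecV_eq_zero hω hV
      have h1 : us' = us := e1.trans hus.symm
      have h2 : uss' = uss := e2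
      exact ⟨h1, h2, e3, h1 ▸ e4, h2 ▸ e5, e6⟩
  · intro hV σm σp ζ d0m d0p d1 d2 h1 h2 D1 D2 H1 H2
    have hd1 : d1 = ‖Kerr.cross ω uL.1‖ := Kerr.norm_cross_cross hω _
    have hd2 : d2 = ‖Kerr.cross ω uR.1‖ := Kerr.norm_cross_cross hω _
    have hn1 : 0 ≤ d1 := norm_nonneg _
    have hn2 : 0 ≤ d2 := norm_nonneg _
    have hVpos : 0 < ‖Kerr.vecV m ω uL uR‖ := norm_pos_iff.2 hV
    have hh : h2 - h1 = Kerr.waveFn m d1 0 d0m + Kerr.waveFn m d2 0 d0p -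
        ‖Kerr.vecV m ω uL uR‖ := by
      have := Kerr.norm_vecV_eq (m := m) hω uL uR hV
      rw [← hd1, ← hd2] at this
      exact this
    obtain ⟨ds, hds, hsol⟩ := Kerr.exists_scalar_solution m hn1 hn2 d0m d0p
      (h := h2 - h1) (by rw [hh]; linarith)
    have huniq : ∀ x : ℝ, 0 ≤ x → h2 - h1 = Kerr.waveFn m d1 x d0m +
        Kerr.waveFn m d2 (Kerr.G m d0m d0p x) d0p → x = ds := fun x hx h =>
      (Kerr.scalar_strictAntiOn m hn1 hn2 d0m d0p).injOn hx hds (h.symm.trans hsol)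
    -- At `0` the scalar equation would give `‖V‖ = 0`.
    have hds0 : 0 < ds := by
      refine hds.lt_of_ne fun h0 => ?_
      rw [← h0, Kerr.G_zero, hh] at hsol
      linarith
    have hdss0 : 0 < Kerr.G m d0m d0p ds := by
      rw [← Kerr.G_zero m d0m d0p]
      exact Kerr.G_strictMono m d0m d0p hds0
    refine ⟨ds, Kerr.G m d0m d0p ds, hds0, hdss0, ⟨(Kerr.f_G m _ _ _).symm, by linarith⟩, ?_, rfl,
      hsol, huniq, ?_⟩
    · intro x y hx hy hf hw
      have hy' : y = Kerr.G m d0m d0p x := Kerr.eq_G_of_f_eq m hf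
      have hx' : x = ds := huniq x hx (by rw [← hy']; linarith)
      exact ⟨hx', by rw [hy', hx']⟩
    · intro u1 us uss u2 v hfan
      obtain ⟨ζ1, ζ2, y1, y2, a2, b2, a5, b5, hform⟩ := Kerr.exists_isFanForm m hω hfan
      rcases hform.dichotomy hω with ⟨-, -, e⟩ | ⟨-, hy2, hζ1, hζ2, hscal⟩
      · exact absurd e hV
      rw [← hd1, ← hd2] at hscal
      have hy1 : y1 = ds := huniq y1 hform.left.y_nonneg (hh.trans hscal.symm)
      have hl := hform.left
      have hr := hform.right
      rw [← hd1, show ζ1 = ζ from hζ1, hy1] at hl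
      rw [← hd2, show ζ2 = ζ from hζ2, hy2, hy1] at hr
      have hD1 : u1.1 = D1 := congrArg Prod.fst hl.left_eq
      have hD2 : u2.1 = D2 := congrArg Prod.fst hr.left_eq
      have hH1 : u1.2 = H1 := by
        rw [hform.H_left, hD1, sub_eq_add_neg, ← neg_smul]
        rfl
      have hH2 : u2.2 = H2 := by
        rw [← neg_neg u2.2, hform.H_right, hD2, ← neg_sub uR.1 D2, Kerr.cross_neg, smul_neg]
        simp only [H2, σp, Kerr.eigenvalue]
        abel
      refine ⟨Prod.ext hD1 hH1, ?_, ?_, Prod.ext hD2 hH2⟩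
      · rw [← hH1]
        exact hl.right_eq
      · have := congrArg Kerr.refl hr.right_eq
        rw [Kerr.refl_refl] at this
        rw [this, ← hH2]
        refine Prod.ext rfl ?_
        simp only [Kerr.refl_apply, Kerr.waveState]
        rw [neg_add, neg_neg, ← sub_eq_add_neg]
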